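/- A finite simple graph is called hypohamiltonian if it has no Hamiltonian cycle but, for each of its vertices $v$, the graph $G-v$ has a Hamiltonian cycle. A graph is planar if it can be embedded in the plane without edge crossings. Theorem 3.4. For every integer $n\ge 40$ there exists a planar hypohamiltonian graph with exactly $n$ vertices. -/

import Mathlib

/-- A finite graph is hypohamiltonian if it has no Hamiltonian cycle, but deleting any single
vertex leaves a Hamiltonian graph. -/
def IsHypohamiltonian {V : Type*} [Fintype V] [DecidableEq V] (G : SimpleGraph V) : Prop :=
  ¬ G.IsHamiltonian ∧ ∀ v : V, (G.induce ({v}ᶜ : Set V)).IsHamiltonian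

/-- A planar embedding of `G`: distinct vertices are placed at distinct points of the plane,
every edge is drawn as a simple (Jordan) arc joining the points of its two ends, no arc passes
through a vertex except at its own two endpoints, and two different arcs can meet only at
endpoints. -/
structure PlanarEmbedding {V : Type*} (G : SimpleGraph V) where
  /-- the point of the plane representing a vertex -/
  pos : V → ℝ × ℝ
  /-- the arc representing an edge, with an arbitrarily chosen direction -/
  arc : G.edgeSet → C(unitInterval, ℝ × ℝ)
  pos_injective : Function.Injective pos
  arc_injective : ∀ e, Function.Injective (arc e)
  arc_ends : ∀ e : G.edgeSet, s(arc e 0, arc e 1) = (e : Sym2 V).map pos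
  arc_avoids_vertices : ∀ e t v, arc e t = pos v → t = 0 ∨ t = 1
  arcs_disjoint : ∀ e f, e ≠ f → ∀ s t, arc e s = arc f t →
    (s = 0 ∨ s = 1) ∧ (t = 0 ∨ t = 1)

/-- A graph is planar if it has an embedding in the plane. -/
def IsPlanar {V : Type*} (G : SimpleGraph V) : Prop :=
  Nonempty (PlanarEmbedding G)

/-!
The graphs are ladders over four plane graphs `base36`, `base38`, `base39`, `base41`, found by
computer, on as many vertices as their names say. All faces of these graphs are quadrilaterals and
pentagons.

*No Hamiltonian cycle in the base.* By Grinberg's criterion (`RotationSystem.exists_side`) a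
Hamiltonian cycle of a plane graph with `N` vertices splits the faces into two sides, and the sum
of `len - 2` over the faces of either side is `N - 2`. Pentagons contribute multiples of 3, so
that only the 7 or 9 quadrilaterals matter modulo 3. This leaves few candidates for the set of
quadrilaterals inside the cycle, and each of them is impossible for a local reason: either the
cycle would have a number of edges other than two at some vertex, or a few quadrilaterals would
form a component of one side, hence the whole side, because a side is connected through edges off
the cycle (`PlaneData.not_isCircuit`). The criterion is proved combinatorially, for a rotation
system that satisfies Euler's formula; the Jordan curve theorem is not needed.

*The ladder.* Thomassen's construction replaces a 4-cycle `0123` bounding a face as follows: the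
edges `01` and `23` are deleted, and a new 4-cycle is put outside and joined to the old one by
four spokes. Only the last of the layers obtained by iterating this keeps all four edges
(`closedLadder`). A Hamiltonian cycle of the larger ladder induces one of the smaller ladder,
because each passage through the new 4-cycle can be replaced by an edge of the old one
(`IsCircuitBelow.closedLadder_pred`). Conversely, Hamiltonian cycles of vertex-deleted ladders are
obtained from spanning paths of the open ladder between the vertices of the last layer, and the
collection of these paths reproduces itself one layer up (`HasSpanningPaths.succ`). So every
ladder over a suitable base is hypohamiltonian. A ladder step adds four vertices, and the numbers
36, 38, 39, 41 represent all residues modulo 4.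

*Planarity.* The ladder has a straight-line drawing with integral coordinates: the base lies in a
square with the four terminals at its corners, and the layers lie at the corners of larger squares
with the same centre (`IsBaseDrawing.isPlanar`).

The finitely many facts about the four base graphs are collected in `PlaneData.IsValid` and
verified by evaluation in the kernel.
-/

/-! ### Grinberg's criterion for a rotation system -/

/-- A Hamiltonian cycle, recorded by its successor function `f`: every vertex is adjacent to its
successor and the iterates of `f` lead from each vertex to each other one. -/
structure IsCircuit {V : Type*} (G : SimpleGraph V) (f : V → V) : Prop where
  adj : ∀ v, G.Adj v (f v)
  trans : ∀ u v, ∃ k, f^[k] u = v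

/-- A rotation system of `G` with labelled faces. The neighbours of `v` in cyclic order are
`nb v 0, nb v 1, …`, read periodically, and `left u v` is the face on the left of the edge `uv`
traversed from `u` to `v`; its values on non-adjacent pairs are irrelevant. The axiom `corner` says
that two consecutive edges at `v` span a corner of one face. -/
structure RotationSystem {V : Type*} (G : SimpleGraph V) (F : Type*) where
  nb : V → ℕ → V
  deg : V → ℕ
  left : V → V → F
  deg_pos : ∀ v, 0 < deg v
  periodic : ∀ v i, nb v (i + deg v) = nb v i
  adj_iff : ∀ v w, G.Adj v w ↔ ∃ i, nb v i = w
  corner : ∀ v i, left v (nb v i) = left (nb v (i + 1)) v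

namespace IsCircuit

variable {V : Type*} {G : SimpleGraph V} {f : V → V}

theorem surjective (h : IsCircuit G f) : Function.Surjective f := by
  intro v
  obtain ⟨k, hk⟩ := h.trans (f v) v
  exact ⟨f^[k] v, by rw [← Function.iterate_succ_apply' f k v, Function.iterate_succ_apply, hk]⟩

theorem injective [Finite V] (h : IsCircuit G f) : Function.Injective f :=
  Finite.injective_iff_surjective.2 h.surjective

theorem apply_apply_ne [Fintype V] (h : IsCircuit G f) (hV : 3 ≤ Fintype.card V) (v : V) :
    f (f v) ≠ v := by
  classical
  intro hv
  have key : ∀ k, f^[k] v = v ∨ f^[k] v = f v := by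
    intro k
    induction k with
    | zero => exact Or.inl rfl
    | succ k ih =>
      rw [Function.iterate_succ_apply']
      rcases ih with ih | ih <;> simp [ih, hv]
  have hsub : (Finset.univ : Finset V) ⊆ {v, f v} := by
    intro w _
    obtain ⟨k, rfl⟩ := h.trans v w
    simpa using key k
  have := (Finset.card_le_card hsub).trans Finset.card_le_two
  rw [Finset.card_univ] at this
  omega

end IsCircuit

namespace RotationSystem

variable {V F : Type*} {G : SimpleGraph V}

theorem exists_nb_add (R : RotationSystem G F) {v w : V} (h : G.Adj v w) (i : ℕ) :
    ∃ j, R.nb v (i + j) = w := by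
  obtain ⟨k, rfl⟩ := (R.adj_iff v w).1 h
  have hp : ∀ m, R.nb v (k + m * R.deg v) = R.nb v k := by
    intro m
    induction m with
    | zero => simp
    | succ m ih => rw [Nat.succ_mul, ← add_assoc, R.periodic, ih]
  have hi : i ≤ k + i * R.deg v := by nlinarith [R.deg_pos v]
  exact ⟨k + i * R.deg v - i, by rw [Nat.add_sub_cancel' hi, hp]⟩

/-- The dual graph cut along a circuit: two distinct faces are joined when they share an edge that
does not belong to the circuit. -/
def cutDual (R : RotationSystem G F) (f : V → V) : SimpleGraph F where
  Adj x y := x ≠ y ∧ ∃ u v, G.Adj u v ∧ v ≠ f u ∧ u ≠ f v ∧ R.left u v = x ∧ R.left v u = y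
  symm := ⟨fun _ _ ⟨hne, u, v, h, h1, h2, h3, h4⟩ => ⟨hne.symm, v, u, h.symm, h2, h1, h4, h3⟩⟩
  loopless := ⟨fun _ h => h.1 rfl⟩

theorem reachable_chord (R : RotationSystem G F) {f : V → V} {u v : V} (h : G.Adj u v)
    (h1 : v ≠ f u) (h2 : u ≠ f v) : (R.cutDual f).Reachable (R.left u v) (R.left v u) := by
  by_cases he : R.left u v = R.left v u
  · rw [he]
  · exact SimpleGraph.Adj.reachable ⟨he, u, v, h, h1, h2, rfl, rfl⟩

/-- Turning around `u` from the circuit neighbour `p` up to the other circuit neighbour `q`, one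
only crosses edges off the circuit. -/
theorem reachable_sweep (R : RotationSystem G F) {f : V → V} {u p q : V}
    (hp : G.Adj u p) (hq : G.Adj u q) (hpq : p ≠ q)
    (hchord : ∀ w, G.Adj u w → w ≠ p → w ≠ q → w ≠ f u ∧ u ≠ f w) :
    (R.cutDual f).Reachable (R.left u p) (R.left q u) := by
  classical
  obtain ⟨i, rfl⟩ := (R.adj_iff u p).1 hp
  have hex := R.exists_nb_add hq i
  have key : ∀ j, (∀ l ≤ j, R.nb u (i + l) ≠ q) →
      (R.cutDual f).Reachable (R.left u (R.nb u i)) (R.left u (R.nb u (i + j))) := by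
    intro j
    induction j with
    | zero => intro _; exact SimpleGraph.Reachable.refl _
    | succ j ih =>
      intro hj
      have h0 := ih fun l hl => hj l (hl.trans (Nat.le_succ j))
      by_cases hw : R.nb u (i + (j + 1)) = R.nb u i
      · rw [hw]
      · have hadj : G.Adj u (R.nb u (i + (j + 1))) := (R.adj_iff _ _).2 ⟨_, rfl⟩
        obtain ⟨c1, c2⟩ := hchord _ hadj hw (hj _ le_rfl)
        refine h0.trans ?_
        rw [R.corner u (i + j)]
        exact (R.reachable_chord hadj c1 c2).symm
  set j := Nat.find hex with hjdef
  have hj : R.nb u (i + j) = q := Nat.find_spec hex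
  have hmin : ∀ l < j, R.nb u (i + l) ≠ q := fun l hl => Nat.find_min hex hl
  have hj0 : j ≠ 0 := by
    intro h0
    rw [h0, add_zero] at hj
    exact hpq hj
  obtain ⟨j', hj'⟩ := Nat.exists_eq_succ_of_ne_zero hj0
  have := key j' fun l hl => hmin l (by omega)
  rwa [R.corner u (i + j'), show i + j' + 1 = i + j by omega, hj] at this

section Circuit

variable [Fintype V] {f : V → V}

/-- An edge at `u = f p` that leads neither to `f u` nor to `p` is not on the circuit. -/
theorem chord_of_ne (hf : IsCircuit G f) {u p w : V} (hp : f p = u)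
    (h1 : w ≠ f u) (h2 : w ≠ p) : w ≠ f u ∧ u ≠ f w :=
  ⟨h1, fun h => h2 (hf.injective (h.symm.trans hp.symm))⟩

/-- All faces to the left of the circuit lie in one component of the cut dual graph. -/
theorem reachable_left (R : RotationSystem G F) (hf : IsCircuit G f)
    (hV : 3 ≤ Fintype.card V) (u v : V) :
    (R.cutDual f).Reachable (R.left u (f u)) (R.left v (f v)) := by
  have step : ∀ p, (R.cutDual f).Reachable (R.left p (f p)) (R.left (f p) (f (f p))) := fun p =>
    (R.reachable_sweep (hf.adj _) (hf.adj p).symm (hf.apply_apply_ne hV p)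
      fun _ _ h1 h2 => chord_of_ne hf rfl h1 h2).symm
  obtain ⟨k, rfl⟩ := hf.trans u v
  induction k with
  | zero => exact SimpleGraph.Reachable.refl _
  | succ k ih => rw [Function.iterate_succ_apply']; exact ih.trans (step _)

theorem reachable_right (R : RotationSystem G F) (hf : IsCircuit G f)
    (hV : 3 ≤ Fintype.card V) (u v : V) :
    (R.cutDual f).Reachable (R.left (f u) u) (R.left (f v) v) := by
  have step : ∀ p, (R.cutDual f).Reachable (R.left (f p) p) (R.left (f (f p)) (f p)) := fun p =>
    R.reachable_sweep (hf.adj p).symm (hf.adj _) (hf.apply_apply_ne hV p).symm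
      fun _ _ h1 h2 => chord_of_ne hf rfl h2 h1
  obtain ⟨k, rfl⟩ := hf.trans u v
  induction k with
  | zero => exact SimpleGraph.Reachable.refl _
  | succ k ih => rw [Function.iterate_succ_apply']; exact ih.trans (step _)

/-- Every corner lies in the component of the faces to the left of the circuit or in that of the
faces to its right. -/
theorem reachable_left_or_right (R : RotationSystem G F) (hf : IsCircuit G f)
    (hV : 3 ≤ Fintype.card V) {u v w : V} (h : G.Adj u w) :
    (R.cutDual f).Reachable (R.left v (f v)) (R.left u w) ∨
      (R.cutDual f).Reachable (R.left (f v) v) (R.left u w) := by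
  obtain ⟨p, rfl⟩ := hf.surjective u
  obtain ⟨i, hi⟩ := (R.adj_iff (f p) p).1 (hf.adj p).symm
  obtain ⟨j, rfl⟩ := R.exists_nb_add h i
  clear h
  induction j with
  | zero => rw [add_zero, hi]; exact Or.inr (R.reachable_right hf hV v p)
  | succ j ih =>
    have hadj : G.Adj (f p) (R.nb (f p) (i + (j + 1))) := (R.adj_iff _ _).2 ⟨_, rfl⟩
    by_cases h1 : R.nb (f p) (i + (j + 1)) = f (f p)
    · rw [h1]; exact Or.inl (R.reachable_left hf hV _ _)
    by_cases h2 : R.nb (f p) (i + (j + 1)) = p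
    · rw [h2]; exact Or.inr (R.reachable_right hf hV _ _)
    obtain ⟨c1, c2⟩ := chord_of_ne hf rfl h1 h2
    have hc := (R.reachable_chord hadj c1 c2).symm
    rw [R.corner (f p) (i + j)] at ih
    exact ih.imp (fun h => h.trans hc) fun h => h.trans hc

open Classical in
/-- A component of the cut dual graph is connected, so its number of faces exceeds its number of
edges by at most one. -/
theorem two_mul_card_component_le [Fintype F] (R : RotationSystem G F) (f : V → V) (x : F) :
    2 * Fintype.card {y // (R.cutDual f).Reachable x y} ≤
      Fintype.card {d : G.Dart // (d.snd ≠ f d.fst ∧ d.fst ≠ f d.snd) ∧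
        (R.cutDual f).Reachable x (R.left d.fst d.snd)} + 2 := by
  set A : Set F := {y | (R.cutDual f).Reachable x y} with hA
  have hconn : ((R.cutDual f).induce A).Connected := by
    have h := ((R.cutDual f).connectedComponentMk x).connected_toSimpleGraph
    have hs : ((R.cutDual f).connectedComponentMk x).supp = A := by
      ext y
      simp only [SimpleGraph.ConnectedComponent.mem_supp_iff, SimpleGraph.ConnectedComponent.eq, hA,
        Set.mem_ofPred_eq]
      exact ⟨fun h => h.symm, fun h => h.symm⟩
    rw [← hs]
    exact h
  have h1 := hconn.card_vert_le_card_edgeSet_add_one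
  have h2 := ((R.cutDual f).induce A).dart_card_eq_twice_card_edges
  rw [Nat.card_eq_fintype_card, Nat.card_eq_fintype_card,
    ← SimpleGraph.edgeFinset_card] at h1
  have hchoose : ∀ e : ((R.cutDual f).induce A).Dart, ∃ d : G.Dart,
      (d.snd ≠ f d.fst ∧ d.fst ≠ f d.snd) ∧ R.left d.fst d.snd = e.fst ∧
        R.left d.snd d.fst = e.snd := by
    intro e
    obtain ⟨-, u, v, h, c1, c2, c3, c4⟩ := e.adj
    exact ⟨⟨(u, v), h⟩, ⟨c1, c2⟩, c3, c4⟩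
  choose φ hφ using hchoose
  have h3 : Fintype.card ((R.cutDual f).induce A).Dart ≤
      Fintype.card {d : G.Dart // (d.snd ≠ f d.fst ∧ d.fst ≠ f d.snd) ∧
        (R.cutDual f).Reachable x (R.left d.fst d.snd)} := by
    refine Fintype.card_le_of_injective
      (fun e => ⟨φ e, (hφ e).1, by rw [(hφ e).2.1]; exact e.fst.2⟩) ?_
    intro e e' h
    have h' : φ e = φ e' := congrArg Subtype.val h
    apply SimpleGraph.Dart.ext
    apply Prod.ext
    · apply Subtype.ext; rw [← (hφ e).2.1, ← (hφ e').2.1, h']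
    · apply Subtype.ext; rw [← (hφ e).2.2, ← (hφ e').2.2, h']
  have h4 : Fintype.card {y // (R.cutDual f).Reachable x y} = Fintype.card A := rfl
  omega

open Classical in
/-- **Grinberg's criterion.** In a rotation system with `|E| = |V| + |F| - 2`, a circuit splits the
faces into two sides: circuit edges separate the sides, all other edges do not, each side is
connected through edges off the circuit, and a side with `s` faces has `|V| + 2 * s - 2` darts on
its boundary, that is, `∑ (len - 2) = |V| - 2` over the faces of a side. The two sides are the
components of the cut dual graph: there are at most two, and since it has `|F| - 2` edges, there are
exactly two and each is a tree. -/
theorem exists_side [Fintype F] (R : RotationSystem G F) (hf : IsCircuit G f)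
    (hV : 3 ≤ Fintype.card V) (hF : ∀ x, ∃ u v, G.Adj u v ∧ R.left u v = x)
    (hE : Nat.card G.Dart + 4 = 2 * (Fintype.card V + Fintype.card F)) :
    ∃ A : Finset F, (∀ u, R.left u (f u) ∈ A ∧ R.left (f u) u ∉ A) ∧
      (∀ u v, G.Adj u v → v ≠ f u → u ≠ f v → (R.left u v ∈ A ↔ R.left v u ∈ A)) ∧
      (∀ B : Finset F, B = A ∨ (∀ x, x ∈ B ↔ x ∉ A) →
        Nat.card {d : G.Dart // R.left d.fst d.snd ∈ B} + 2 = Fintype.card V + 2 * B.card ∧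
        ∀ X ⊆ B, X.Nonempty → (∀ u v, G.Adj u v → R.left u v ∈ X → R.left v u ∈ B →
          R.left v u ∈ X) → X = B) := by
  have hinj := hf.injective
  have hff := hf.apply_apply_ne hV
  obtain ⟨v₀⟩ : Nonempty V := Fintype.card_pos_iff.1 (by omega)
  set D := R.cutDual f with hD
  set xl := R.left v₀ (f v₀) with hxl
  set xr := R.left (f v₀) v₀ with hxr
  have hcover : ∀ x, D.Reachable xl x ∨ D.Reachable xr x := by
    intro x
    obtain ⟨u, v, h, rfl⟩ := hF x
    exact R.reachable_left_or_right hf hV h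
  -- the darts fall into those along the circuit, those against it, and the chords
  set C : Finset G.Dart := {d | d.snd ≠ f d.fst ∧ d.fst ≠ f d.snd} with hC
  let fwd : V → G.Dart := fun v => ⟨(v, f v), hf.adj v⟩
  let bwd : V → G.Dart := fun v => ⟨(f v, v), (hf.adj v).symm⟩
  have hsplit : ∀ (P : G.Dart → Prop) [DecidablePred P], (Finset.univ.filter P).card =
      (C.filter P).card + (Finset.univ.filter fun v => P (fwd v)).card +
        (Finset.univ.filter fun v => P (bwd v)).card := by
    intro P _
    have e1 : (Finset.univ.filter fun v => P (fwd v)).card =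
        (Finset.univ.filter fun d : G.Dart => P d ∧ d.snd = f d.fst).card := by
      refine Finset.card_bij (fun v _ => fwd v) ?_ ?_ ?_
      · intro v hv; simpa [fwd] using hv
      · intro v _ w _ h; exact congrArg (fun d : G.Dart => d.fst) h
      · rintro ⟨⟨a, b⟩, hab⟩ hd
        simp only [Finset.mem_filter, Finset.mem_univ, true_and] at hd
        obtain ⟨hd, rfl⟩ := hd
        exact ⟨a, by simpa using hd, rfl⟩
    have e2 : (Finset.univ.filter fun v => P (bwd v)).card =
        (Finset.univ.filter fun d : G.Dart => P d ∧ d.fst = f d.snd).card := by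
      refine Finset.card_bij (fun v _ => bwd v) ?_ ?_ ?_
      · intro v hv; simpa [bwd] using hv
      · intro v _ w _ h; exact congrArg (fun d : G.Dart => d.snd) h
      · rintro ⟨⟨a, b⟩, hab⟩ hd
        simp only [Finset.mem_filter, Finset.mem_univ, true_and] at hd
        obtain ⟨hd, rfl⟩ := hd
        exact ⟨b, by simpa using hd, rfl⟩
    rw [e1, e2, ← Finset.card_union_of_disjoint, ← Finset.card_union_of_disjoint]
    · congr 1
      ext d
      simp only [hC, Finset.mem_filter, Finset.mem_univ, true_and, Finset.mem_union]
      tauto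
    · rw [Finset.disjoint_left]
      intro d hd hd'
      simp only [hC, Finset.mem_filter, Finset.mem_univ, true_and, Finset.mem_union] at hd hd'
      rcases hd with hd | hd
      · exact hd.1.2 hd'.2
      · exact hff d.fst (by rw [← hd.2, ← hd'.2])
    · rw [Finset.disjoint_left]
      intro d hd hd'
      simp only [hC, Finset.mem_filter, Finset.mem_univ, true_and] at hd hd'
      exact hd.1.1 hd'.2
  have hCcard : C.card + 4 = 2 * Fintype.card F := by
    have h := hsplit fun _ => True
    simp only [Finset.filter_true, Finset.card_univ] at h
    rw [Nat.card_eq_fintype_card] at hE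
    omega
  have hcomp : ∀ x, 2 * (Finset.univ.filter fun y => D.Reachable x y).card ≤
      (C.filter fun d => D.Reachable x (R.left d.fst d.snd)).card + 2 := by
    intro x
    have h := R.two_mul_card_component_le f x
    rw [Fintype.card_subtype, Fintype.card_subtype] at h
    rwa [hC, Finset.filter_filter]
  -- the two components differ, for otherwise the cut dual graph would have too few edges
  have hdisj : ¬ D.Reachable xl xr := by
    intro h
    have hall : ∀ x, D.Reachable xl x := fun x => (hcover x).elim id h.trans
    have h1 := hcomp xl
    have h2 : (C.filter fun d => D.Reachable xl (R.left d.fst d.snd)).card ≤ C.card :=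
      Finset.card_filter_le _ _
    have h3 : (Finset.univ.filter fun y => D.Reachable xl y).card = Fintype.card F := by
      rw [Finset.filter_true_of_mem fun x _ => hall x, Finset.card_univ]
    omega
  set A : Finset F := {y | D.Reachable xl y} with hA
  have hmem : ∀ y, y ∈ A ↔ D.Reachable xl y := by simp [hA]
  have hmem' : ∀ y, y ∈ Aᶜ ↔ D.Reachable xr y := by
    intro y
    rw [Finset.mem_compl, hmem]
    exact ⟨fun h => (hcover y).resolve_left h, fun h h' => hdisj (h'.trans h.symm)⟩
  have hleft : ∀ u, R.left u (f u) ∈ A := fun u => (hmem _).2 (R.reachable_left hf hV _ _)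
  have hright : ∀ u, R.left (f u) u ∈ Aᶜ := fun u => (hmem' _).2 (R.reachable_right hf hV _ _)
  have hcA := hcomp xl
  have hcB := hcomp xr
  have hA' : (Finset.univ.filter fun y => D.Reachable xr y) = Aᶜ := by
    ext y; rw [hmem']; simp
  have hA'' : (Finset.univ.filter fun y => D.Reachable xl y) = A := by
    ext y; simp [hmem]
  rw [hA''] at hcA
  rw [hA'] at hcB
  have hCA : (C.filter fun d => D.Reachable xl (R.left d.fst d.snd)) =
      C.filter fun d => R.left d.fst d.snd ∈ A := by simp only [hmem]
  have hCB : (C.filter fun d => D.Reachable xr (R.left d.fst d.snd)) =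
      C.filter fun d => R.left d.fst d.snd ∈ Aᶜ := by simp only [hmem']
  rw [hCA] at hcA
  rw [hCB] at hcB
  have hsumC : (C.filter fun d => R.left d.fst d.snd ∈ A).card +
      (C.filter fun d => R.left d.fst d.snd ∈ Aᶜ).card = C.card := by
    simp only [Finset.mem_compl]
    exact Finset.card_filter_add_card_filter_not _
  have hsumF : A.card + Aᶜ.card = Fintype.card F := Finset.card_add_card_compl A
  refine ⟨A, fun u => ⟨hleft u, Finset.mem_compl.1 (hright u)⟩, ?_, ?_⟩
  · intro u v h h1 h2
    have := R.reachable_chord h h1 h2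
    rw [hmem, hmem]
    exact ⟨fun h => h.trans this, fun h => h.trans this.symm⟩
  · intro B hB
    replace hB : B = A ∨ B = Aᶜ := hB.imp id fun h => by ext x; rw [h, Finset.mem_compl]
    obtain ⟨x, hx⟩ : ∃ x, ∀ y, y ∈ B ↔ D.Reachable x y := by
      rcases hB with rfl | rfl
      exacts [⟨xl, hmem⟩, ⟨xr, hmem'⟩]
    constructor
    · rw [Nat.card_eq_fintype_card, Fintype.card_subtype]
      have hs := hsplit fun d => R.left d.fst d.snd ∈ B
      have hl : ∀ u, R.left (fwd u).fst (fwd u).snd ∈ A := hleft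
      have hr : ∀ u, R.left (bwd u).fst (bwd u).snd ∉ A := fun u => Finset.mem_compl.1 (hright u)
      rcases hB with rfl | rfl
      · simp only [hl, hr, Finset.filter_true, Finset.filter_false, Finset.card_univ,
          Finset.card_empty] at hs
        omega
      · simp only [Finset.mem_compl, hl, hr, not_true_eq_false, not_false_eq_true,
          Finset.filter_true, Finset.filter_false, Finset.card_univ, Finset.card_empty]
          at hs hcB hsumC ⊢
        omega
    · intro X hXB hXne hX
      obtain ⟨x₁, hx₁⟩ := hXne
      refine Finset.Subset.antisymm hXB fun y hy => ?_
      have hr : D.Reachable x₁ y := ((hx _).1 (hXB hx₁)).symm.trans ((hx y).1 hy)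
      obtain ⟨w⟩ := hr
      clear hy
      induction w with
      | nil => exact hx₁
      | cons h w ih =>
        refine ih ?_
        have hv := (hx _).1 (hXB hx₁)
        obtain ⟨u, v, hadj, -, -, rfl, rfl⟩ := h.2
        exact hX u v hadj hx₁ ((hx _).2 (hv.trans h.reachable))

end Circuit

end RotationSystem

/-! ### Hamiltonian cycles as lists and as circuits -/

/-- The exception is the graph with one vertex, which Mathlib counts as Hamiltonian. -/
theorem SimpleGraph.IsHamiltonian.exists_isCircuit {V : Type*} [Fintype V] [DecidableEq V]
    {G : SimpleGraph V} (hG : G.IsHamiltonian) (hV : Fintype.card V ≠ 1) :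
    ∃ f, IsCircuit G f := by
  obtain ⟨a, p, hp⟩ := hG hV
  set n := p.length with hn
  have hpos : 0 < n := by
    have := hp.isCycle.three_le_length
    omega
  let σ : ℕ → V := fun i => p.getVert (i % n)
  have hσ : ∀ i, G.Adj (σ i) (σ (i + 1)) ∧ σ (i + 1) = p.getVert (i % n + 1) := by
    intro i
    have hlt : i % n < n := Nat.mod_lt _ hpos
    have h2 : σ (i + 1) = p.getVert (i % n + 1) := by
      simp only [σ]
      rw [Nat.add_mod, Nat.mod_eq_of_lt (show 1 < n by
        have := hp.isCycle.three_le_length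
        omega)]
      rcases Nat.lt_or_ge (i % n + 1) n with h | h
      · rw [Nat.mod_eq_of_lt h]
      · rw [show i % n + 1 = n by omega, Nat.mod_self, p.getVert_zero, hn, p.getVert_length]
    exact ⟨h2 ▸ p.adj_getVert_succ hlt, h2⟩
  have hsurj : ∀ v, ∃ i < n, p.getVert i = v := by
    intro v
    obtain ⟨i, hi, hle⟩ := SimpleGraph.Walk.mem_support_iff_exists_getVert.1 (hp.mem_support v)
    rcases hle.lt_or_eq with h | h
    · exact ⟨i, h, hi⟩
    · exact ⟨0, hpos, by rw [p.getVert_zero, ← hi, h, p.getVert_length]⟩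
  choose ι hι hιv using hsurj
  have hι' : ∀ i, ι (σ i) = i % n := by
    intro i
    refine hp.isCycle.getVert_injOn' ?_ ?_ (hιv _)
    · have := hι (σ i)
      simp only [Set.mem_ofPred_eq]; omega
    · have := Nat.mod_lt i hpos
      simp only [Set.mem_ofPred_eq]; omega
  have hσι : ∀ v, σ (ι v) = v := fun v => by
    simp only [σ]; rw [Nat.mod_eq_of_lt (hι v), hιv]
  refine ⟨fun v => σ (ι v + 1), fun v => ?_, fun u v => ?_⟩
  · have := (hσ (ι v)).1
    rwa [hσι] at this
  · have hstep : ∀ i, σ (ι (σ i) + 1) = σ (i + 1) := by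
      intro i
      rw [hι']
      simp only [σ]
      rw [Nat.mod_add_mod]
    have hiter : ∀ k i, (fun v => σ (ι v + 1))^[k] (σ i) = σ (i + k) := by
      intro k
      induction k with
      | zero => intro i; rfl
      | succ k ih =>
        intro i
        rw [Function.iterate_succ_apply, hstep, ih]
        congr 1; omega
    refine ⟨ι v + n - ι u, ?_⟩
    rw [← hσι u, hiter, hι', Nat.mod_eq_of_lt (hι u),
      show ι u + (ι v + n - ι u) = ι v + n by have := hι u; omega]
    simp only [σ]
    rw [Nat.add_mod_right, Nat.mod_eq_of_lt (hι v), hιv]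

theorem SimpleGraph.isHamiltonian_of_list {V : Type*} [Fintype V] [DecidableEq V]
    {G : SimpleGraph V} {l : List V} (hne : l ≠ []) (hnd : l.Nodup) (hall : ∀ v, v ∈ l)
    (hchain : l.IsChain G.Adj) (hlen : 3 ≤ l.length)
    (hclose : G.Adj (l.getLast hne) (l.head hne)) : G.IsHamiltonian := by
  intro _
  have hl : (Walk.ofSupport l hne hchain).length + 1 = l.length := by
    rw [← Walk.length_support, Walk.support_ofSupport]
  refine ⟨_, Walk.cons hclose (Walk.ofSupport l hne hchain),
    Walk.isHamiltonianCycle_iff_isCycle_and_length_eq.2 ⟨?_, ?_⟩⟩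
  · have hpath : (Walk.ofSupport l hne hchain).IsPath := by
      rwa [Walk.isPath_def, Walk.support_ofSupport]
    refine (Walk.cons_isCycle_iff _ _).2 ⟨hpath, fun h => ?_⟩
    rw [Sym2.eq_swap] at h
    have := hpath.length_eq_one_of_mem_edges h
    omega
  · rw [Walk.length_cons, hl, ← List.toFinset_card_of_nodup hnd,
      show l.toFinset = Finset.univ by ext v; simp [hall v], Finset.card_univ]

/-- `IsSpanningPath G n v s t l`: the list `l` is a path of `G` from `s` to `t` through all numbers
below `n` except `v`. With `v ≥ n` nothing is left out. -/
structure IsSpanningPath (G : SimpleGraph ℕ) (n v s t : ℕ) (l : List ℕ) : Prop where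
  nodup : l.Nodup
  mem_iff : ∀ x, x ∈ l ↔ x < n ∧ x ≠ v
  chain : l.IsChain G.Adj
  head : l.head? = some s
  last : l.getLast? = some t

namespace IsSpanningPath

variable {G : SimpleGraph ℕ} {n v s t : ℕ} {l : List ℕ}

theorem reverse (h : IsSpanningPath G n v s t l) : IsSpanningPath G n v t s l.reverse where
  nodup := List.nodup_reverse.2 h.nodup
  mem_iff x := by rw [List.mem_reverse, h.mem_iff]
  chain := List.isChain_reverse.2 (h.chain.imp fun _ _ h => h.symm)
  head := by rw [List.head?_reverse, h.last]
  last := by rw [List.getLast?_reverse, h.head]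

theorem mono {H : SimpleGraph ℕ} (hGH : G ≤ H) (h : IsSpanningPath G n v s t l) :
    IsSpanningPath H n v s t l :=
  { h with chain := h.chain.imp fun _ _ h => hGH h }

/-- A spanning path whose ends are adjacent closes up to a Hamiltonian cycle. -/
theorem isHamiltonian {H : SimpleGraph ℕ} (h : IsSpanningPath H n v s t l) (hst : H.Adj s t)
    (hn : 4 ≤ n) (hv : v < n) :
    (((H.comap Fin.val : SimpleGraph (Fin n))).induce {(⟨v, hv⟩ : Fin n)}ᶜ).IsHamiltonian := by
  let φ : ↥({(⟨v, hv⟩ : Fin n)}ᶜ : Set (Fin n)) → ℕ := fun w => w.1.1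
  have hφ : Function.Injective φ := Fin.val_injective.comp Subtype.val_injective
  have hrange : ∀ x ∈ l, ∃ w, φ w = x := by
    intro x hx
    obtain ⟨hxn, hxv⟩ := (h.mem_iff x).1 hx
    exact ⟨⟨⟨x, hxn⟩, by simpa [Fin.ext_iff] using hxv⟩, rfl⟩
  obtain ⟨m, rfl⟩ : ∃ m, List.map φ m = l := by
    have hl : l ∈ Set.range (List.map φ) := by rw [Set.range_list_map]; exact hrange
    exact hl
  have hall : ∀ w, w ∈ m := fun w => by
    have hw : φ w ∈ List.map φ m :=
      (h.mem_iff _).2 ⟨w.1.2, fun he => w.2 (Fin.ext he)⟩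
    exact (List.mem_map_of_injective hφ).1 hw
  have hnd : m.Nodup := h.nodup.of_map
  have hne : m ≠ [] := by
    rintro rfl
    simpa using h.head
  have hlen : 3 ≤ m.length := by
    rw [← List.toFinset_card_of_nodup hnd,
      show m.toFinset = Finset.univ by ext w; simp [hall w], Finset.card_univ,
      Fintype.card_compl_set]
    simp
    omega
  have hhead : φ (m.head hne) = s := by
    have := h.head
    rw [List.head?_map, List.head?_eq_some_head hne] at this
    simpa using this
  have hlast : φ (m.getLast hne) = t := by
    have := h.last
    rw [List.getLast?_map, List.getLast?_eq_some_getLast hne] at this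
    simpa using this
  refine SimpleGraph.isHamiltonian_of_list hne hnd hall ?_ hlen ?_
  · exact (List.isChain_map φ).1 h.chain
  · show H.Adj (φ _) (φ _)
    rw [hhead, hlast]
    exact hst.symm

end IsSpanningPath

/-! ### The ladder over a graph with a distinguished quadrilateral -/

/-- Let `B` be a graph on the numbers below `p + 4` in which `p, p + 1, p + 2, p + 3` is a 4-cycle.
`openLadder B p` deletes the edges `{p, p + 1}` and `{p + 2, p + 3}`, puts a new layer of four
vertices `p + 4 * (j + 1) + i` (`i < 4`) above the layer `p + 4 * j + i` for each `j`, joins each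
vertex to the corresponding vertex of the next layer, and gives each new layer the two edges
`{1, 2}` and `{3, 0}`. -/
def openLadder (B : SimpleGraph ℕ) (p : ℕ) : SimpleGraph ℕ :=
  SimpleGraph.fromRel fun u v =>
    (B.Adj u v ∧ s(u, v) ≠ s(p, p + 1) ∧ s(u, v) ≠ s(p + 2, p + 3)) ∨ (p ≤ u ∧ v = u + 4) ∨
      ∃ j, (u = p + 4 * (j + 1) + 1 ∧ v = u + 1) ∨ (u = p + 4 * (j + 1) ∧ v = u + 3)

/-- The open ladder with the missing edges `{0, 1}` and `{2, 3}` of layer `k` put in. Restricted to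
the numbers below `p + 4 * (k + 1)`, it is the result of `k` ladder steps applied to `B`. -/
def closedLadder (B : SimpleGraph ℕ) (p k : ℕ) : SimpleGraph ℕ :=
  SimpleGraph.fromRel fun u v => (openLadder B p).Adj u v ∨
    (u = p + 4 * k ∧ v = u + 1) ∨ (u = p + 4 * k + 2 ∧ v = u + 1)

/-- `B` is a graph on the numbers below `p + 4` and its last four vertices form a 4-cycle. -/
structure IsLadderBase (B : SimpleGraph ℕ) (p : ℕ) : Prop where
  lt : ∀ {u v}, B.Adj u v → u < p + 4
  adj01 : B.Adj p (p + 1)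
  adj12 : B.Adj (p + 1) (p + 2)
  adj23 : B.Adj (p + 2) (p + 3)
  adj30 : B.Adj p (p + 3)

section Ladder

variable {B : SimpleGraph ℕ} {p k : ℕ}

theorem openLadder_adj {u v : ℕ} : (openLadder B p).Adj u v ↔
    (B.Adj u v ∧ s(u, v) ≠ s(p, p + 1) ∧ s(u, v) ≠ s(p + 2, p + 3)) ∨
      (p ≤ u ∧ v = u + 4) ∨ (p ≤ v ∧ u = v + 4) ∨
      (∃ j, (u = p + 4 * (j + 1) + 1 ∧ v = u + 1) ∨ (u = p + 4 * (j + 1) ∧ v = u + 3)) ∨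
      (∃ j, (v = p + 4 * (j + 1) + 1 ∧ u = v + 1) ∨ (v = p + 4 * (j + 1) ∧ u = v + 3)) := by
  rw [openLadder, SimpleGraph.fromRel_adj, Sym2.eq_swap (a := v), B.adj_comm v u]
  constructor
  · rintro ⟨-, (h | h | h) | (h | h | h)⟩
    exacts [Or.inl h, Or.inr (Or.inl h), Or.inr (Or.inr (Or.inr (Or.inl h))), Or.inl h,
      Or.inr (Or.inr (Or.inl h)), Or.inr (Or.inr (Or.inr (Or.inr h)))]
  · intro h
    constructor
    · rintro rfl
      rcases h with h | h | h | ⟨j, h⟩ | ⟨j, h⟩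
      · exact h.1.ne rfl
      all_goals omega
    · rcases h with h | h | h | h | h
      exacts [Or.inl (Or.inl h), Or.inl (Or.inr (Or.inl h)), Or.inr (Or.inr (Or.inl h)),
        Or.inl (Or.inr (Or.inr h)), Or.inr (Or.inr (Or.inr h))]

theorem closedLadder_adj {u v : ℕ} : (closedLadder B p k).Adj u v ↔
    (openLadder B p).Adj u v ∨ (u = p + 4 * k ∧ v = u + 1) ∨ (u = p + 4 * k + 2 ∧ v = u + 1) ∨
      (v = p + 4 * k ∧ u = v + 1) ∨ (v = p + 4 * k + 2 ∧ u = v + 1) := by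
  rw [closedLadder, SimpleGraph.fromRel_adj, (openLadder B p).adj_comm v u]
  constructor
  · rintro ⟨-, h⟩
    tauto
  · intro h
    refine ⟨?_, by tauto⟩
    rintro rfl
    rcases h with h | h
    · exact h.ne rfl
    · omega

theorem openLadder_le_closedLadder : openLadder B p ≤ closedLadder B p k := fun _ _ h =>
  closedLadder_adj.2 (Or.inl h)

theorem openLadder_adj_add_four {u : ℕ} (h : p ≤ u) : (openLadder B p).Adj u (u + 4) :=
  openLadder_adj.2 (Or.inr (Or.inl ⟨h, rfl⟩))

theorem IsLadderBase.openLadder_adj12 (hB : IsLadderBase B p) (k : ℕ) :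
    (openLadder B p).Adj (p + 4 * k + 1) (p + 4 * k + 2) := by
  rcases k with _ | k
  · refine openLadder_adj.2 (Or.inl ⟨hB.adj12, ?_, ?_⟩) <;> simp
  · exact openLadder_adj.2 (Or.inr (Or.inr (Or.inr (Or.inl ⟨k, Or.inl ⟨rfl, rfl⟩⟩))))

theorem IsLadderBase.openLadder_adj30 (hB : IsLadderBase B p) (k : ℕ) :
    (openLadder B p).Adj (p + 4 * k + 3) (p + 4 * k) := by
  refine SimpleGraph.Adj.symm ?_
  rcases k with _ | k
  · refine openLadder_adj.2 (Or.inl ⟨hB.adj30, ?_, ?_⟩) <;> simp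
  · exact openLadder_adj.2 (Or.inr (Or.inr (Or.inr (Or.inl ⟨k, Or.inr ⟨rfl, rfl⟩⟩))))

theorem closedLadder_adj01 : (closedLadder B p k).Adj (p + 4 * k) (p + 4 * k + 1) :=
  closedLadder_adj.2 (by omega)

theorem closedLadder_adj23 : (closedLadder B p k).Adj (p + 4 * k + 2) (p + 4 * k + 3) :=
  closedLadder_adj.2 (by omega)

/-! ### Spanning paths of the ladder -/

/-- The spanning paths that make every vertex-deleted ladder Hamiltonian: for each vertex `v` of the
first `k + 1` layers a path missing `v` alone that joins the ends of one of the two deleted edges of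
layer `k`, and two paths through all vertices that join opposite vertices of layer `k`. -/
structure HasSpanningPaths (B : SimpleGraph ℕ) (p k : ℕ) : Prop where
  detour : ∀ v < p + 4 * (k + 1),
    (∃ l, IsSpanningPath (openLadder B p) (p + 4 * (k + 1)) v (p + 4 * k) (p + 4 * k + 1) l) ∨
    ∃ l, IsSpanningPath (openLadder B p) (p + 4 * (k + 1)) v (p + 4 * k + 2) (p + 4 * k + 3) l
  diag02 : ∃ l, IsSpanningPath (openLadder B p) (p + 4 * (k + 1)) (p + 4 * (k + 1))
    (p + 4 * k) (p + 4 * k + 2) l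
  diag13 : ∃ l, IsSpanningPath (openLadder B p) (p + 4 * (k + 1)) (p + 4 * (k + 1))
    (p + 4 * k + 1) (p + 4 * k + 3) l

/-- Extending a path at both ends into the next layer. Of the four new vertices exactly those in
`x` and `y` are used. -/
theorem IsSpanningPath.extend {G : SimpleGraph ℕ} {n v v' s t s' t' : ℕ} {l x y : List ℕ}
    (h : IsSpanningPath G n v s t l) (hnd : (x ++ y).Nodup)
    (hmem : ∀ z, (z ∈ x ∨ z ∈ y) ↔ n ≤ z ∧ z < n + 4 ∧ z ≠ v')
    (hv : ∀ z < n, z ≠ v ↔ z ≠ v')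
    (hx : (x ++ [s]).IsChain G.Adj) (hy : (t :: y).IsChain G.Adj)
    (hs' : (x ++ [s]).head? = some s') (ht' : (t :: y).getLast? = some t') :
    IsSpanningPath G (n + 4) v' s' t' (x ++ (l ++ y)) where
  nodup := by
    rw [List.nodup_append] at hnd ⊢
    refine ⟨hnd.1, List.nodup_append.2 ⟨h.nodup, hnd.2.1, ?_⟩, ?_⟩
    · intro a ha b hb
      have h1 := (h.mem_iff a).1 ha
      have h2 := (hmem b).1 (Or.inr hb)
      omega
    · intro a ha b hb
      rcases List.mem_append.1 hb with hb | hb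
      · have h1 := (h.mem_iff b).1 hb
        have h2 := (hmem a).1 (Or.inl ha)
        omega
      · exact hnd.2.2 a ha b hb
  mem_iff z := by
    have h1 := h.mem_iff z
    have h2 := hmem z
    have h3 := hv z
    rw [List.mem_append, List.mem_append]
    by_cases hz : z < n
    · have h4 := h3 hz
      have : ¬ (z ∈ x ∨ z ∈ y) := fun h => by have := h2.1 h; omega
      constructor
      · intro h'
        have : z ∈ l := by tauto
        have := h1.1 this
        exact ⟨by omega, h4.1 this.2⟩
      · intro h'
        exact Or.inr (Or.inl (h1.2 ⟨hz, h4.2 h'.2⟩))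
    · have : z ∉ l := fun h' => hz (h1.1 h').1
      constructor
      · intro h'
        have := h2.1 (by tauto)
        exact ⟨this.2.1, this.2.2⟩
      · intro h'
        have := h2.2 ⟨by omega, h'.1, h'.2⟩
        tauto
  chain := by
    have hl := h.chain
    have hh := h.head
    have ht := h.last
    rw [List.isChain_append] at hx ⊢
    refine ⟨hx.1, ?_, ?_⟩
    · rw [List.isChain_append]
      rw [List.isChain_cons] at hy
      refine ⟨hl, hy.2, fun a ha b hb => ?_⟩
      rw [ht] at ha
      obtain rfl : t = a := by simpa using ha
      exact hy.1 b hb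
    · intro a ha b hb
      rw [List.head?_append, hh] at hb
      exact hx.2.2 a ha b (by simpa using hb)
  head := by
    rw [← hs']
    have hh := h.head
    cases x <;> simp [List.head?_append, hh]
  last := by
    have ht := h.last
    rw [List.getLast?_append, List.getLast?_append, ht]
    rw [List.getLast?_cons] at ht'
    cases hy : y.getLast? <;> simp_all

/-- A detour around an old vertex is continued through all four new vertices; a detour around a new
vertex comes from a diagonal path. -/
theorem HasSpanningPaths.succ (hB : IsLadderBase B p) (h : HasSpanningPaths B p k) :
    HasSpanningPaths B p (k + 1) := by
  have e12 := hB.openLadder_adj12 (k + 1)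
  have e30 := hB.openLadder_adj30 (k + 1)
  set n := p + 4 * (k + 1) with hn
  have hn' : p + 4 * (k + 1 + 1) = n + 4 := by omega
  have r0 : (openLadder B p).Adj (p + 4 * k) n := openLadder_adj_add_four (by omega)
  have r1 : (openLadder B p).Adj (p + 4 * k + 1) (n + 1) := by
    have := openLadder_adj_add_four (B := B) (show p ≤ p + 4 * k + 1 by omega)
    rwa [show p + 4 * k + 1 + 4 = n + 1 by omega] at this
  have r2 : (openLadder B p).Adj (p + 4 * k + 2) (n + 2) := by
    have := openLadder_adj_add_four (B := B) (show p ≤ p + 4 * k + 2 by omega)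
    rwa [show p + 4 * k + 2 + 4 = n + 2 by omega] at this
  have r3 : (openLadder B p).Adj (p + 4 * k + 3) (n + 3) := by
    have := openLadder_adj_add_four (B := B) (show p ≤ p + 4 * k + 3 by omega)
    rwa [show p + 4 * k + 3 + 4 = n + 3 by omega] at this
  obtain ⟨l02, h02⟩ := h.diag02
  obtain ⟨l13, h13⟩ := h.diag13
  rw [← hn] at h02 h13
  constructor
  · rw [hn']
    intro v hv
    by_cases hvn : v < n
    · rcases h.detour v hvn with ⟨l, hl⟩ | ⟨l, hl⟩
      · right
        refine ⟨_, hl.reverse.extend (x := [n + 2, n + 1]) (y := [n, n + 3])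
          ?_ ?_ ?_ ?_ ?_ rfl rfl⟩
        · simp
        · intro z; simp; omega
        · simp
        · simp [r1.symm, e12.symm]
        · simp [r0, e30.symm]
      · left
        refine ⟨_, hl.reverse.extend (x := [n, n + 3]) (y := [n + 2, n + 1])
          ?_ ?_ ?_ ?_ ?_ rfl rfl⟩
        · simp
        · intro z; simp; omega
        · simp
        · simp [r3.symm, e30.symm]
        · simp [r2, e12.symm]
    · obtain rfl | rfl | rfl | rfl : v = n ∨ v = n + 1 ∨ v = n + 2 ∨ v = n + 3 := by omega
      · right
        refine ⟨_, h13.extend (x := [n + 2, n + 1]) (y := [n + 3]) ?_ ?_ ?_ ?_ ?_ rfl rfl⟩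
        · simp
        · intro z; simp; omega
        · intro z hz; omega
        · simp [r1.symm, e12.symm]
        · simp [r3]
      · right
        refine ⟨_, h02.reverse.extend (x := [n + 2]) (y := [n, n + 3]) ?_ ?_ ?_ ?_ ?_ rfl rfl⟩
        · simp
        · intro z; simp; omega
        · intro z hz; omega
        · simp [r2.symm]
        · simp [r0, e30.symm]
      · left
        refine ⟨_, h13.reverse.extend (x := [n, n + 3]) (y := [n + 1]) ?_ ?_ ?_ ?_ ?_ rfl rfl⟩
        · simp
        · intro z; simp; omega
        · intro z hz; omega
        · simp [r3.symm, e30.symm]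
        · simp [r1]
      · left
        refine ⟨_, h02.extend (x := [n]) (y := [n + 2, n + 1]) ?_ ?_ ?_ ?_ ?_ rfl rfl⟩
        · simp
        · intro z; simp; omega
        · intro z hz; omega
        · simp [r0.symm]
        · simp [r2, e12.symm]
  · rw [hn']
    refine ⟨_, h13.reverse.extend (x := [n, n + 3]) (y := [n + 1, n + 2]) ?_ ?_ ?_ ?_ ?_ rfl rfl⟩
    · simp
    · intro z; simp; omega
    · intro z hz; omega
    · simp [r3.symm, e30.symm]
    · simp [r1, e12]
  · rw [hn']
    refine ⟨_, h02.reverse.extend (x := [n + 1, n + 2]) (y := [n, n + 3]) ?_ ?_ ?_ ?_ ?_ rfl rfl⟩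
    · simp
    · intro z; simp; omega
    · intro z hz; omega
    · simp [r2.symm, e12]
    · simp [r0, e30.symm]

theorem HasSpanningPaths.isHamiltonian (h : HasSpanningPaths B p k) (v : Fin (p + 4 * (k + 1))) :
    (((closedLadder B p k).comap Fin.val : SimpleGraph (Fin (p + 4 * (k + 1)))).induce
      ({v}ᶜ : Set (Fin (p + 4 * (k + 1))))).IsHamiltonian := by
  rcases h.detour v v.2 with ⟨l, hl⟩ | ⟨l, hl⟩
  · exact (hl.mono openLadder_le_closedLadder).isHamiltonian closedLadder_adj01 (by omega) v.2
  · exact (hl.mono openLadder_le_closedLadder).isHamiltonian closedLadder_adj23 (by omega) v.2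

end Ladder

/-! ### Circuits of the ladder -/

/-- `f` is a circuit, in the sense of `IsCircuit`, on the numbers below `n`. -/
structure IsCircuitBelow (G : SimpleGraph ℕ) (n : ℕ) (f : ℕ → ℕ) : Prop where
  lt : ∀ v < n, f v < n
  adj : ∀ v < n, G.Adj v (f v)
  trans : ∀ u < n, ∀ v < n, ∃ k, f^[k] u = v

theorem IsCircuit.exists_isCircuitBelow {G : SimpleGraph ℕ} {n : ℕ} {f : Fin n → Fin n}
    (hf : IsCircuit (G.comap Fin.val) f) : ∃ g, IsCircuitBelow G n g := by
  let g : ℕ → ℕ := fun v => if h : v < n then f ⟨v, h⟩ else v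
  have hg : Function.Semiconj Fin.val f g := fun v => by simp [g]
  refine ⟨g, fun v hv => ?_, fun v hv => ?_, fun u hu v hv => ?_⟩
  · simp only [g, dif_pos hv]; exact (f ⟨v, hv⟩).2
  · simp only [g, dif_pos hv]; exact hf.adj ⟨v, hv⟩
  · obtain ⟨k, hk⟩ := hf.trans ⟨u, hu⟩ ⟨v, hv⟩
    exact ⟨k, by have := (hg.iterate_right k).eq ⟨u, hu⟩; rw [hk] at this; exact this.symm⟩

namespace IsCircuitBelow

variable {G : SimpleGraph ℕ} {n : ℕ} {f : ℕ → ℕ}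

theorem exists_isCircuit (hf : IsCircuitBelow G n f) :
    ∃ g : Fin n → Fin n, (∀ v, (g v).1 = f v.1) ∧ IsCircuit (G.comap Fin.val) g := by
  let g : Fin n → Fin n := fun v => ⟨f v.1, hf.lt v.1 v.2⟩
  have hg : Function.Semiconj Fin.val g f := fun v => rfl
  refine ⟨g, fun _ => rfl, fun v => hf.adj v.1 v.2, fun u v => ?_⟩
  obtain ⟨k, hk⟩ := hf.trans u.1 u.2 v.1 v.2
  exact ⟨k, Fin.ext (by rw [(hg.iterate_right k).eq u, hk])⟩

theorem injOn (hf : IsCircuitBelow G n f) {u v : ℕ} (hu : u < n) (hv : v < n) (h : f u = f v) :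
    u = v := by
  obtain ⟨g, hg, hgc⟩ := hf.exists_isCircuit
  have := hgc.injective (a₁ := ⟨u, hu⟩) (a₂ := ⟨v, hv⟩) (Fin.ext (by rw [hg, hg]; exact h))
  simpa using this

theorem exists_apply_eq (hf : IsCircuitBelow G n f) {v : ℕ} (hv : v < n) : ∃ u < n, f u = v := by
  obtain ⟨g, hg, hgc⟩ := hf.exists_isCircuit
  obtain ⟨u, hu⟩ := hgc.surjective ⟨v, hv⟩
  exact ⟨u.1, u.2, by rw [← hg, hu]⟩

theorem apply_apply_ne (hf : IsCircuitBelow G n f) (hn : 3 ≤ n) {v : ℕ} (hv : v < n) :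
    f (f v) ≠ v := by
  obtain ⟨g, hg, hgc⟩ := hf.exists_isCircuit
  intro h
  exact hgc.apply_apply_ne (by simpa using hn) ⟨v, hv⟩ (Fin.ext (by rw [hg, hg]; exact h))

/-- The first-return map of a circuit to the numbers below `m` is again a circuit, provided that
each number is adjacent to the first number below `m` that follows it. -/
theorem firstReturn {H : SimpleGraph ℕ} {m : ℕ} (hf : IsCircuitBelow G n f) (hmn : m ≤ n)
    (h : ∀ u < m, ∃ r, f^[r + 1] u < m ∧ (∀ i < r, m ≤ f^[i + 1] u) ∧ H.Adj u (f^[r + 1] u)) :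
    ∃ g, IsCircuitBelow H m g := by
  have h' : ∀ u, ∃ r, u < m → f^[r + 1] u < m ∧ (∀ i < r, m ≤ f^[i + 1] u) ∧
      H.Adj u (f^[r + 1] u) := by
    intro u
    by_cases hu : u < m
    · obtain ⟨r, hr⟩ := h u hu
      exact ⟨r, fun _ => hr⟩
    · exact ⟨0, fun h => absurd h hu⟩
  choose r hr using h'
  refine ⟨fun u => f^[r u + 1] u, fun v hv => (hr v hv).1, fun v hv => (hr v hv).2.2, ?_⟩
  intro u hu v hv
  obtain ⟨k, hk⟩ := hf.trans u (hu.trans_le hmn) v (hv.trans_le hmn)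
  induction k using Nat.strong_induction_on generalizing u with
  | _ k ih =>
    rcases Nat.eq_zero_or_pos k with rfl | hpos
    · exact ⟨0, hk⟩
    have hle : r u + 1 ≤ k := by
      by_contra! hlt
      have := (hr u hu).2.1 (k - 1) (by omega)
      rw [Nat.sub_add_cancel hpos, hk] at this
      omega
    obtain ⟨j, hj⟩ := ih (k - (r u + 1)) (by omega) _ (hr u hu).1 (by
      rw [← Function.iterate_add_apply, Nat.sub_add_cancel hle, hk])
    exact ⟨j + 1, by rw [Function.iterate_succ_apply]; exact hj⟩

end IsCircuitBelow

/-- A circuit that enters the 4-cycle `p q r s` from `P` leaves it at `q` or `s`, for leaving it at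
`r` would skip the fourth vertex. Here `P`, `Q`, `R`, `S` are the outer neighbours. -/
theorem exit_of_enter {f : ℕ → ℕ} {p q r s P Q R S : ℕ}
    (hinj : ∀ x ∈ [p, q, r, s, P, Q, R, S], ∀ y ∈ [p, q, r, s, P, Q, R, S], f x = f y → x = y)
    (hnd : [p, q, r, s, P, Q, R, S].Nodup)
    (hff : ∀ x ∈ [p, q, r, s, P, Q, R, S], f (f x) ≠ x) (hP : f P = p)
    (hp : f p = P ∨ f p = q ∨ f p = s) (hq : f q = Q ∨ f q = r ∨ f q = p)
    (hs : f s = S ∨ f s = p ∨ f s = r)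
    (hq' : f Q = q ∨ f r = q ∨ f p = q) (hs' : f S = s ∨ f p = s ∨ f r = s) :
    (f p = q ∧ f q = Q) ∨ (f p = s ∧ f s = S) ∨
      (f p = q ∧ f q = r ∧ f r = s ∧ f s = S) ∨ (f p = s ∧ f s = r ∧ f r = q ∧ f q = Q) := by
  simp only [List.mem_cons, List.not_mem_nil, or_false, forall_eq_or_imp, forall_eq,
    List.nodup_cons, not_or] at hinj hnd hff
  grind

/-- A Hamiltonian cycle of a ladder induces one of the ladder with one layer less: it enters and
leaves the last layer at the ends of an edge of the last but one layer. -/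
theorem IsCircuitBelow.closedLadder_pred {B : SimpleGraph ℕ} {p k : ℕ} (hB : IsLadderBase B p)
    {f : ℕ → ℕ} (hf : IsCircuitBelow (closedLadder B p (k + 1)) (p + 4 * (k + 1 + 1)) f) :
    ∃ g, IsCircuitBelow (closedLadder B p k) (p + 4 * (k + 1)) g := by
  set m := p + 4 * (k + 1) with hm
  have hm4 : p + 4 * (k + 1 + 1) = m + 4 := by omega
  rw [hm4] at hf
  have hlt : ∀ {u v}, B.Adj u v → u < p + 4 ∧ v < p + 4 := fun h => ⟨hB.lt h, hB.lt h.symm⟩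
  -- adjacency in the ladder with `k + 2` layers, by position relative to the last layer
  have hold : ∀ u v, u < m → v < m → (closedLadder B p (k + 1)).Adj u v →
      (closedLadder B p k).Adj u v := by
    intro u v hu hv h
    rcases closedLadder_adj.1 h with h | h
    · exact openLadder_le_closedLadder h
    · omega
  have hup : ∀ u v, u < m → m ≤ v → v < m + 4 → (closedLadder B p (k + 1)).Adj u v →
      v = u + 4 := by
    intro u v hu hv hv' h
    rcases closedLadder_adj.1 h with h | h
    · rcases openLadder_adj.1 h with h | h | h | ⟨j, h⟩ | ⟨j, h⟩
      · have := hlt h.1; omega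
      all_goals omega
    · omega
  have hnew : ∀ i < 4, ∀ v < m + 4, (closedLadder B p (k + 1)).Adj (m + i) v →
      v = m + i - 4 ∨ v = m + (i + 1) % 4 ∨ v = m + (i + 3) % 4 := by
    intro i hi v hv h
    rcases closedLadder_adj.1 h with h | h
    · rcases openLadder_adj.1 h with h | h | h | ⟨j, h⟩ | ⟨j, h⟩
      · have := hlt h.1; omega
      all_goals interval_cases i <;> omega
    · interval_cases i <;> omega
  have hcyc : ∀ i < 4, (closedLadder B p k).Adj (p + 4 * k + i) (p + 4 * k + (i + 1) % 4) := by
    intro i hi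
    interval_cases i
    · exact closedLadder_adj01
    · exact openLadder_le_closedLadder (hB.openLadder_adj12 k)
    · exact closedLadder_adj23
    · exact openLadder_le_closedLadder (hB.openLadder_adj30 k)
  refine hf.firstReturn (by omega) fun u hu => ?_
  by_cases hfu : f u < m
  · exact ⟨0, hfu, by simp, hold _ _ hu hfu (hf.adj u (by omega))⟩
  have hfu4 := hup u (f u) hu (by omega) (hf.lt u (by omega)) (hf.adj u (by omega))
  obtain ⟨i, hi, rfl⟩ : ∃ i < 4, u = p + 4 * k + i := ⟨u - (p + 4 * k), by omega, by omega⟩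
  -- the successors and predecessors of the vertices of the last layer
  have hsucc : ∀ j < 4, f (m + j) = m + j - 4 ∨ f (m + j) = m + (j + 1) % 4 ∨
      f (m + j) = m + (j + 3) % 4 := fun j hj =>
    hnew j hj _ (hf.lt _ (by omega)) (hf.adj _ (by omega))
  have hpred : ∀ j < 4, f (m + j - 4) = m + j ∨ f (m + (j + 1) % 4) = m + j ∨
      f (m + (j + 3) % 4) = m + j := by
    intro j hj
    obtain ⟨w, hw, hwj⟩ := hf.exists_apply_eq (show m + j < m + 4 by omega)
    have hadj := hf.adj w hw
    rw [hwj] at hadj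
    rcases hnew j hj w hw hadj.symm with rfl | rfl | rfl
    exacts [Or.inl hwj, Or.inr (Or.inl hwj), Or.inr (Or.inr hwj)]
  have hcases := exit_of_enter (f := f) (p := m + i) (q := m + (i + 1) % 4)
    (r := m + (i + 2) % 4) (s := m + (i + 3) % 4) (P := m + i - 4) (Q := m + (i + 1) % 4 - 4)
    (R := m + (i + 2) % 4 - 4) (S := m + (i + 3) % 4 - 4)
    (fun x hx y hy h => hf.injOn
      (by simp only [List.mem_cons, List.not_mem_nil, or_false] at hx; omega)
      (by simp only [List.mem_cons, List.not_mem_nil, or_false] at hy; omega) h)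
    (by simp only [List.nodup_cons, List.mem_cons, List.not_mem_nil, or_false, not_or,
          not_false_eq_true, List.nodup_nil, and_true]; omega)
    (fun x hx => hf.apply_apply_ne (by omega)
      (by simp only [List.mem_cons, List.not_mem_nil, or_false] at hx; omega))
    (by rw [show m + i - 4 = p + 4 * k + i by omega, hfu4]; omega)
    (hsucc i hi)
    (by have := hsucc ((i + 1) % 4) (by omega); interval_cases i <;> simpa using this)
    (by have := hsucc ((i + 3) % 4) (by omega); interval_cases i <;> simpa using this)
    (by have := hpred ((i + 1) % 4) (by omega); interval_cases i <;> simpa using this)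
    (by have := hpred ((i + 3) % 4) (by omega); interval_cases i <;> simpa using this)
  rw [show m + i = f (p + 4 * k + i) by omega] at hcases
  have hnext := hcyc i hi
  have hprev := (hcyc ((i + 3) % 4) (by omega)).symm
  rw [show ((i + 3) % 4 + 1) % 4 = i by omega] at hprev
  have e1 : m + (i + 1) % 4 - 4 = p + 4 * k + (i + 1) % 4 := by omega
  have e3 : m + (i + 3) % 4 - 4 = p + 4 * k + (i + 3) % 4 := by omega
  rw [e1, e3] at hcases
  rcases hcases with ⟨h1, h2⟩ | ⟨h1, h2⟩ | ⟨h1, h2, h3, h4⟩ | ⟨h1, h2, h3, h4⟩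
  · refine ⟨2, ?_, ?_, ?_⟩
    · simp only [Function.iterate_succ_apply, Function.iterate_zero_apply, h1, h2]; omega
    · intro j hj
      interval_cases j <;>
        simp only [Function.iterate_succ_apply, Function.iterate_zero_apply, h1] <;> omega
    · simp only [Function.iterate_succ_apply, Function.iterate_zero_apply, h1, h2]; exact hnext
  · refine ⟨2, ?_, ?_, ?_⟩
    · simp only [Function.iterate_succ_apply, Function.iterate_zero_apply, h1, h2]; omega
    · intro j hj
      interval_cases j <;>
        simp only [Function.iterate_succ_apply, Function.iterate_zero_apply, h1] <;> omega
    · simp only [Function.iterate_succ_apply, Function.iterate_zero_apply, h1, h2]; exact hprev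
  · refine ⟨4, ?_, ?_, ?_⟩
    · simp only [Function.iterate_succ_apply, Function.iterate_zero_apply, h1, h2, h3, h4]; omega
    · intro j hj
      interval_cases j <;>
        simp only [Function.iterate_succ_apply, Function.iterate_zero_apply, h1, h2, h3] <;> omega
    · simp only [Function.iterate_succ_apply, Function.iterate_zero_apply, h1, h2, h3, h4]
      exact hprev
  · refine ⟨4, ?_, ?_, ?_⟩
    · simp only [Function.iterate_succ_apply, Function.iterate_zero_apply, h1, h2, h3, h4]; omega
    · intro j hj
      interval_cases j <;>
        simp only [Function.iterate_succ_apply, Function.iterate_zero_apply, h1, h2, h3] <;> omega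
    · simp only [Function.iterate_succ_apply, Function.iterate_zero_apply, h1, h2, h3, h4]
      exact hnext

/-- A ladder over a base without Hamiltonian cycle has no Hamiltonian cycle. -/
theorem not_isHamiltonian_closedLadder {B : SimpleGraph ℕ} {p : ℕ} (hB : IsLadderBase B p)
    (h : ∀ f : Fin (p + 4) → Fin (p + 4), ¬ IsCircuit (B.comap Fin.val) f) (k : ℕ) :
    ¬ ((closedLadder B p k).comap Fin.val :
      SimpleGraph (Fin (p + 4 * (k + 1)))).IsHamiltonian := by
  have hno : ∀ g, ¬ IsCircuitBelow (closedLadder B p k) (p + 4 * (k + 1)) g := by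
    induction k with
    | zero =>
      intro g hg
      obtain ⟨g', -, hg'⟩ := hg.exists_isCircuit
      refine h g' ⟨fun v => ?_, hg'.trans⟩
      have hadj := hg'.adj v
      have h1 := v.2
      have h2 := (g' v).2
      rw [SimpleGraph.comap_adj] at hadj ⊢
      rcases closedLadder_adj.1 hadj with h' | h'
      · rcases openLadder_adj.1 h' with h' | h' | h' | ⟨j, h'⟩ | ⟨j, h'⟩
        · exact h'.1
        all_goals omega
      · rcases h' with ⟨e1, e2⟩ | ⟨e1, e2⟩ | ⟨e1, e2⟩ | ⟨e1, e2⟩ <;> rw [e2, e1]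
        exacts [hB.adj01, hB.adj23, hB.adj01.symm, hB.adj23.symm]
    | succ k ih =>
      intro g hg
      obtain ⟨g', hg'⟩ := hg.closedLadder_pred hB
      exact ih g' hg'
  intro hham
  obtain ⟨f, hf⟩ := hham.exists_isCircuit (by simp; omega)
  obtain ⟨g, hg⟩ := hf.exists_isCircuitBelow
  exact hno g hg

/-! ### Straight-line drawings -/

open AffineMap in
/-- The segments `pq` and `rs` meet only in points that are ends of both, in terms of the
parameters along the segments. -/
def MeetAtEnds (p q r s : ℝ × ℝ) : Prop :=
  ∀ a ∈ Set.Icc (0 : ℝ) 1, ∀ b ∈ Set.Icc (0 : ℝ) 1, lineMap p q a = lineMap r s b →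
    (a = 0 ∨ a = 1) ∧ (b = 0 ∨ b = 1)

namespace MeetAtEnds

variable {p q r s : ℝ × ℝ}

theorem symm (h : MeetAtEnds p q r s) : MeetAtEnds r s p q := fun a ha b hb hab =>
  (h b hb a ha hab.symm).symm

theorem swap_left (h : MeetAtEnds p q r s) : MeetAtEnds q p r s := by
  intro a ha b hb hab
  have h' := h (1 - a) ⟨by linarith [ha.2], by linarith [ha.1]⟩ b hb (by
    rw [AffineMap.lineMap_apply_one_sub, hab])
  exact ⟨h'.1.symm.imp (fun h => by linarith) fun h => by linarith, h'.2⟩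

theorem swap_right (h : MeetAtEnds p q r s) : MeetAtEnds p q s r :=
  h.symm.swap_left.symm

end MeetAtEnds

/-- A graph has a planar embedding as soon as it can be drawn with straight edges that meet only at
ends. The second hypothesis excludes leaves, so that no edge can run through a vertex. -/
theorem isPlanar_of_meetAtEnds {V : Type*} {G : SimpleGraph V} (pos : V → ℝ × ℝ)
    (hpos : Function.Injective pos) (hdeg : ∀ v w, v ≠ w → ∃ x, x ≠ w ∧ G.Adj v x)
    (hmeet : ∀ u v u' v', G.Adj u v → G.Adj u' v' → s(u, v) ≠ s(u', v') →
      MeetAtEnds (pos u) (pos v) (pos u') (pos v')) : IsPlanar G := by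
  have hends : ∀ e : G.edgeSet, ∃ u v, (e : Sym2 V) = s(u, v) := by
    rintro ⟨e, he⟩
    induction e with
    | _ u v => exact ⟨u, v, rfl⟩
  choose x y hxy using hends
  have hadj : ∀ e, G.Adj (x e) (y e) := fun e => by
    have := e.2; rwa [hxy, SimpleGraph.mem_edgeSet] at this
  let arc : G.edgeSet → C(unitInterval, ℝ × ℝ) := fun e =>
    ⟨fun t => AffineMap.lineMap (pos (x e)) (pos (y e)) (t : ℝ), by
      exact AffineMap.lineMap_continuous.comp continuous_subtype_val⟩
  have harc : ∀ e t, arc e t = AffineMap.lineMap (pos (x e)) (pos (y e)) (t : ℝ) := fun _ _ => rfl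
  have h01 : ∀ t : unitInterval, ((t : ℝ) = 0 ∨ (t : ℝ) = 1) → (t = 0 ∨ t = 1) := fun t h =>
    h.imp (fun h => Subtype.ext h) fun h => Subtype.ext h
  have hdisj : ∀ e f, e ≠ f → ∀ s t, arc e s = arc f t → (s = 0 ∨ s = 1) ∧ (t = 0 ∨ t = 1) := by
    intro e f hef s t hst
    have := hmeet _ _ _ _ (hadj e) (hadj f)
      (by rw [← hxy, ← hxy]; exact fun h => hef (Subtype.ext h)) s s.2 t t.2 hst
    exact ⟨h01 _ this.1, h01 _ this.2⟩
  refine ⟨⟨pos, arc, hpos, ?_, ?_, ?_, hdisj⟩⟩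
  · intro e s t hst
    exact Subtype.ext (AffineMap.lineMap_injective ℝ (hpos.ne (hadj e).ne) hst)
  · intro e
    rw [harc, harc, hxy e, Sym2.map_mk]
    simp
  · intro e t v hv
    obtain ⟨w, hw, hew⟩ : ∃ w, G.Adj v w ∧ (e : Sym2 V) ≠ s(v, w) := by
      rw [hxy e]
      by_cases hve : v = x e
      · obtain ⟨w, hw, hvw⟩ := hdeg v (y e) (hve ▸ (hadj e).ne)
        refine ⟨w, hvw, fun h => hw ?_⟩
        rcases Sym2.eq_iff.1 h with h | h
        exacts [h.2.symm, (G.irrefl (h.1 ▸ hve ▸ hvw)).elim]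
      · obtain ⟨w, hw, hvw⟩ := hdeg v (x e) hve
        refine ⟨w, hvw, fun h => ?_⟩
        rcases Sym2.eq_iff.1 h with h | h
        exacts [hve h.1.symm, hw h.1.symm]
    set f : G.edgeSet := ⟨s(v, w), hw⟩ with hf
    have hfv : v = x f ∨ v = y f := by
      have := hxy f
      rcases Sym2.eq_iff.1 (show s(v, w) = s(x f, y f) from this) with h | h
      exacts [Or.inl h.1, Or.inr h.1]
    have hne : e ≠ f := fun h => hew (congrArg Subtype.val h)
    rcases hfv with h | h
    · exact (hdisj e f hne t 0 (by rw [hv, harc, h]; simp)).1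
    · exact (hdisj e f hne t 1 (by rw [hv, harc, h]; simp)).1

/-- Twice the signed area of the triangle `pqr`. -/
def cross {K : Type*} [Ring K] (p q r : K × K) : K :=
  (q.1 - p.1) * (r.2 - p.2) - (q.2 - p.2) * (r.1 - p.1)

theorem cross_lineMap (p q r s : ℝ × ℝ) (b : ℝ) :
    cross p q (AffineMap.lineMap r s b) = (1 - b) * cross p q r + b * cross p q s := by
  simp only [cross, AffineMap.lineMap_apply, vsub_eq_sub, vadd_eq_add, Prod.fst_add, Prod.snd_add,
    Prod.smul_fst, Prod.smul_snd, Prod.fst_sub, Prod.snd_sub, smul_eq_mul]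
  ring

theorem cross_lineMap_self (p q : ℝ × ℝ) (a : ℝ) : cross p q (AffineMap.lineMap p q a) = 0 := by
  rw [cross_lineMap]
  simp only [cross]
  ring

theorem MeetAtEnds.of_cross_mul_pos {p q r s : ℝ × ℝ} (h : 0 < cross p q r * cross p q s) :
    MeetAtEnds p q r s := by
  intro a _ b hb hab
  exfalso
  have h0 := cross_lineMap_self p q a
  rw [hab, cross_lineMap] at h0
  obtain ⟨hb0, hb1⟩ := hb
  rcases mul_pos_iff.1 h with ⟨h1, h2⟩ | ⟨h1, h2⟩
  · rcases hb0.eq_or_lt with rfl | hb0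
    · linarith
    · nlinarith [mul_pos hb0 h2, mul_nonneg (sub_nonneg.2 hb1) h1.le]
  · rcases hb0.eq_or_lt with rfl | hb0
    · linarith
    · nlinarith [mul_pos hb0 (neg_pos.2 h2), mul_nonneg (sub_nonneg.2 hb1) (neg_pos.2 h1).le]

theorem MeetAtEnds.of_cross_ne_zero {p q s : ℝ × ℝ} (h : cross p q s ≠ 0) :
    MeetAtEnds p q p s := by
  intro a _ b _ hab
  have h0 := cross_lineMap_self p q a
  rw [hab, cross_lineMap, show cross p q p = 0 by simp [cross], mul_zero, zero_add] at h0
  have hb : b = 0 := (mul_eq_zero.1 h0).resolve_right h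
  have hpq : p ≠ q := by rintro rfl; simp [cross] at h
  rw [hb, AffineMap.lineMap_apply_zero, AffineMap.lineMap_eq_left_iff] at hab
  exact ⟨Or.inl (hab.resolve_left hpq), Or.inl hb⟩

/-- A decidable certificate that two segments with integral ends meet only at ends: one of them lies
strictly on one side of the line through the other, or they span a proper angle at a common end. -/
def SegmentsApart (p q r s : ℤ × ℤ) : Prop :=
  0 < cross p q r * cross p q s ∨ 0 < cross r s p * cross r s q ∨
    (p = r ∧ cross p q s ≠ 0) ∨ (p = s ∧ cross p q r ≠ 0) ∨ (q = r ∧ cross q p s ≠ 0) ∨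
      (q = s ∧ cross q p r ≠ 0)

instance (p q r s : ℤ × ℤ) : Decidable (SegmentsApart p q r s) := by
  unfold SegmentsApart; infer_instance

/-- The inclusion of the integral points in the plane. -/
def toPlane (p : ℤ × ℤ) : ℝ × ℝ := (p.1, p.2)

theorem toPlane_injective : Function.Injective toPlane := by
  intro p q h
  simp only [toPlane, Prod.mk.injEq, Int.cast_inj] at h
  exact Prod.ext h.1 h.2

theorem cross_toPlane (p q r : ℤ × ℤ) :
    cross (toPlane p) (toPlane q) (toPlane r) = cross p q r := by
  simp [cross, toPlane]

theorem SegmentsApart.meetAtEnds {p q r s : ℤ × ℤ} (h : SegmentsApart p q r s) :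
    MeetAtEnds (toPlane p) (toPlane q) (toPlane r) (toPlane s) := by
  have hne : ∀ {p q r : ℤ × ℤ}, cross p q r ≠ 0 →
      cross (toPlane p) (toPlane q) (toPlane r) ≠ 0 := fun h => by
    rw [cross_toPlane]; exact_mod_cast h
  rcases h with h | h | ⟨rfl, h⟩ | ⟨rfl, h⟩ | ⟨rfl, h⟩ | ⟨rfl, h⟩
  · refine .of_cross_mul_pos ?_
    rw [cross_toPlane, cross_toPlane]; exact_mod_cast h
  · refine (MeetAtEnds.of_cross_mul_pos ?_).symm
    rw [cross_toPlane, cross_toPlane]; exact_mod_cast h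
  · exact .of_cross_ne_zero (hne h)
  · exact (MeetAtEnds.of_cross_ne_zero (hne h)).swap_right
  · exact (MeetAtEnds.of_cross_ne_zero (hne h)).swap_left
  · exact (MeetAtEnds.of_cross_ne_zero (hne h)).swap_left.swap_right

/-! ### A drawing of the ladder -/

/-- The corners `(1, 1)`, `(-1, 1)`, `(-1, -1)`, `(1, -1)` of a square, indexed modulo 4. -/
def corner (i : ℕ) : ℤ × ℤ :=
  (if i % 4 = 0 ∨ i % 4 = 3 then 1 else -1, if i % 4 = 0 ∨ i % 4 = 1 then 1 else -1)

/-- The drawing of the ladder extending the drawing `pts` of the vertices below `p`: the layer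
`p + 4 * j + i` (`i < 4`) is placed at the corners of the square of radius `R + j`. -/
def ladderPos (pts : ℕ → ℤ × ℤ) (p R v : ℕ) : ℤ × ℤ :=
  if v < p then pts v else ((R + (v - p) / 4 : ℕ) : ℤ) • corner (v - p)

/-- The vertices of the base lie in the open square of radius `R`, except for the last four, which
`ladderPos` puts at its corners, and the edges of the base meet only at ends. -/
structure IsBaseDrawing (B : SimpleGraph ℕ) (pts : ℕ → ℤ × ℤ) (p R : ℕ) : Prop where
  pos : 0 < R
  box : ∀ v < p, |(pts v).1| < R ∧ |(pts v).2| < R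
  inj : ∀ u < p, ∀ v < p, pts u = pts v → u = v
  apart : ∀ {u v u' v'}, B.Adj u v → B.Adj u' v' → s(u, v) ≠ s(u', v') →
    MeetAtEnds (toPlane (ladderPos pts p R u)) (toPlane (ladderPos pts p R v))
      (toPlane (ladderPos pts p R u')) (toPlane (ladderPos pts p R v'))

open AffineMap in
theorem norm_lineMap_le {p q : ℝ × ℝ} {r a : ℝ} (hp : ‖p‖ ≤ r) (hq : ‖q‖ ≤ r)
    (ha : a ∈ Set.Icc (0 : ℝ) 1) : ‖lineMap p q a‖ ≤ r := by
  have h := (convex_closedBall (0 : ℝ × ℝ) r).lineMap_mem (by simpa using hp) (by simpa using hq) ha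
  simpa using h

theorem corner_sq (i : ℕ) : ((corner i).1 = 1 ∨ (corner i).1 = -1) ∧
    ((corner i).2 = 1 ∨ (corner i).2 = -1) := by
  simp only [corner]
  constructor <;> split_ifs <;> simp

theorem norm_toPlane_smul_corner (i : ℕ) {r : ℝ} (hr : 0 ≤ r) : ‖r • toPlane (corner i)‖ = r := by
  rw [norm_smul, Real.norm_of_nonneg hr]
  obtain ⟨h1 | h1, h2 | h2⟩ := corner_sq i <;> simp [toPlane, Prod.norm_def, h1, h2]

open AffineMap in
/-- The corners of a square are extreme points of it. -/
theorem lineMap_eq_corner {p q : ℝ × ℝ} {r a : ℝ} {i : ℕ} (hp : ‖p‖ ≤ r) (hq : ‖q‖ ≤ r)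
    (hpq : p ≠ q) (ha : a ∈ Set.Icc (0 : ℝ) 1) (h : lineMap p q a = r • toPlane (corner i)) :
    a = 0 ∨ a = 1 := by
  by_contra! hne
  have ha0 : 0 < a := lt_of_le_of_ne ha.1 (Ne.symm hne.1)
  have ha1 : a < 1 := lt_of_le_of_ne ha.2 hne.2
  rw [Prod.norm_def, max_le_iff, Real.norm_eq_abs, Real.norm_eq_abs, abs_le, abs_le] at hp hq
  have key : ∀ x y c : ℝ, (c = 1 ∨ c = -1) → -r ≤ x → x ≤ r → -r ≤ y → y ≤ r →
      (1 - a) * x + a * y = r * c → x = y := by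
    rintro x y c (rfl | rfl) h1 h2 h3 h4 h5
    · have hx : x = r := by nlinarith
      have hy : y = r := by nlinarith
      rw [hx, hy]
    · have hx : x = -r := by nlinarith
      have hy : y = -r := by nlinarith
      rw [hx, hy]
  rw [lineMap_apply_module] at h
  have e1 := congrArg Prod.fst h
  have e2 := congrArg Prod.snd h
  simp only [Prod.fst_add, Prod.snd_add, Prod.smul_fst, Prod.smul_snd, smul_eq_mul, toPlane]
    at e1 e2
  obtain ⟨c1, c2⟩ := corner_sq i
  exact hpq (Prod.ext
    (key _ _ _ (c1.imp (fun h => by rw [h]; simp) fun h => by rw [h]; simp)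
      hp.1.1 hp.1.2 hq.1.1 hq.1.2 e1)
    (key _ _ _ (c2.imp (fun h => by rw [h]; simp) fun h => by rw [h]; simp)
      hp.2.1 hp.2.2 hq.2.1 hq.2.2 e2))

/-- Points in the directions of two different corners are different. -/
theorem smul_corner_ne {i i' : ℕ} (hi : i < 4) (hi' : i' < 4) {r r' : ℝ} (hr : 0 < r)
    (hr' : 0 < r') (h : r • toPlane (corner i) = r' • toPlane (corner i')) : i = i' := by
  have e1 := congrArg Prod.fst h
  have e2 := congrArg Prod.snd h
  interval_cases i <;> interval_cases i' <;> first
    | rfl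
    | (exfalso; simp [toPlane, corner] at e1 e2; linarith)

open AffineMap in
theorem norm_lineMap_corner (i : ℕ) {a : ℝ} (ha : a ∈ Set.Icc (0 : ℝ) 1) :
    ‖lineMap (toPlane (corner i)) (toPlane (corner (i + 1))) a‖ = 1 := by
  have hcase : (corner i).1 = (corner (i + 1)).1 ∨ (corner i).2 = (corner (i + 1)).2 := by
    simp only [corner]
    have : i % 4 < 4 := Nat.mod_lt _ (by norm_num)
    have h4 : (i + 1) % 4 = (i % 4 + 1) % 4 := by omega
    rw [h4]
    interval_cases i % 4 <;> simp
  refine le_antisymm (norm_lineMap_le ?_ ?_ ha) ?_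
  · simpa using (norm_toPlane_smul_corner i zero_le_one).le
  · simpa using (norm_toPlane_smul_corner (i + 1) zero_le_one).le
  · rw [lineMap_apply_module, Prod.norm_def]
    obtain ⟨c1, c2⟩ := corner_sq i
    rcases hcase with h | h
    · refine le_max_of_le_left ?_
      simp only [toPlane, Prod.fst_add, Prod.smul_fst, smul_eq_mul, ← h]
      rw [← add_mul, sub_add_cancel, one_mul]
      rcases c1 with c | c <;> simp [c]
    · refine le_max_of_le_right ?_
      simp only [toPlane, Prod.snd_add, Prod.smul_snd, smul_eq_mul, ← h]
      rw [← add_mul, sub_add_cancel, one_mul]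
      rcases c2 with c | c <;> simp [c]

/-- Two sides of a square meet only at corners. -/
theorem meetAtEnds_corner {i i' : ℕ} (hi : i < 4) (hi' : i' < 4) (h : i ≠ i') :
    MeetAtEnds (toPlane (corner i)) (toPlane (corner (i + 1))) (toPlane (corner i'))
      (toPlane (corner (i' + 1))) := by
  intro a ha b hb hab
  rw [AffineMap.lineMap_apply_module, AffineMap.lineMap_apply_module] at hab
  have e1 := congrArg Prod.fst hab
  have e2 := congrArg Prod.snd hab
  obtain ⟨ha0, ha1⟩ := ha
  obtain ⟨hb0, hb1⟩ := hb
  interval_cases i <;> interval_cases i' <;>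
    simp [toPlane, corner] at h e1 e2 <;>
    first
      | (exfalso; linarith)
      | exact ⟨Or.inl (by linarith), Or.inl (by linarith)⟩
      | exact ⟨Or.inl (by linarith), Or.inr (by linarith)⟩
      | exact ⟨Or.inr (by linarith), Or.inl (by linarith)⟩

section Drawing

variable {B : SimpleGraph ℕ} {pts : ℕ → ℤ × ℤ} {p R : ℕ}

theorem toPlane_ladderPos_add (j i : ℕ) (hi : i < 4) :
    toPlane (ladderPos pts p R (p + 4 * j + i)) = ((R : ℝ) + j) • toPlane (corner i) := by
  have h1 : p + 4 * j + i - p = 4 * j + i := by omega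
  have h2 : (4 * j + i) / 4 = j := by omega
  have h3 : corner (4 * j + i) = corner i := by
    simp only [corner, show (4 * j + i) % 4 = i % 4 by omega]
  rw [ladderPos, if_neg (by omega), h1, h2, h3]
  simp [toPlane]

theorem IsBaseDrawing.norm_lt (h : IsBaseDrawing B pts p R) {v : ℕ} (hv : v < p) :
    ‖toPlane (ladderPos pts p R v)‖ < R := by
  obtain ⟨h1, h2⟩ := h.box v hv
  rw [ladderPos, if_pos hv, toPlane, Prod.norm_def, max_lt_iff, Real.norm_eq_abs, Real.norm_eq_abs]
  dsimp only
  exact ⟨by exact_mod_cast h1, by exact_mod_cast h2⟩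

theorem exists_layer {v : ℕ} (hv : p ≤ v) : ∃ j, ∃ i < 4, v = p + 4 * j + i :=
  ⟨(v - p) / 4, (v - p) % 4, by omega, by omega⟩

theorem IsBaseDrawing.norm_le (h : IsBaseDrawing B pts p R) {v : ℕ} (hv : v < p + 4) :
    ‖toPlane (ladderPos pts p R v)‖ ≤ R := by
  rcases Nat.lt_or_ge v p with hvp | hvp
  · exact (h.norm_lt hvp).le
  · obtain ⟨j, i, hi, rfl⟩ := exists_layer hvp
    obtain rfl : j = 0 := by omega
    rw [toPlane_ladderPos_add _ _ hi, Nat.cast_zero, add_zero]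
    exact (norm_toPlane_smul_corner i (Nat.cast_nonneg R)).le

theorem IsBaseDrawing.ladderPos_injective (h : IsBaseDrawing B pts p R) :
    Function.Injective fun v => toPlane (ladderPos pts p R v) := by
  have hR : (0 : ℝ) < R := Nat.cast_pos.2 h.pos
  have hlayer : ∀ j i, i < 4 → ‖toPlane (ladderPos pts p R (p + 4 * j + i))‖ = R + j := by
    intro j i hi
    rw [toPlane_ladderPos_add j i hi, norm_toPlane_smul_corner i (by positivity)]
  have hmix : ∀ u v, u < p → p ≤ v →
      toPlane (ladderPos pts p R u) ≠ toPlane (ladderPos pts p R v) := by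
    intro u v hu hv he
    obtain ⟨j, i, hi, rfl⟩ := exists_layer hv
    have h1 := h.norm_lt hu
    rw [he, hlayer j i hi] at h1
    have : (0 : ℝ) ≤ j := Nat.cast_nonneg j
    linarith
  intro u v huv
  simp only at huv
  rcases Nat.lt_or_ge u p with hu | hu <;> rcases Nat.lt_or_ge v p with hv | hv
  · have := toPlane_injective huv
    rw [ladderPos, ladderPos, if_pos hu, if_pos hv] at this
    exact h.inj u hu v hv this
  · exact (hmix u v hu hv huv).elim
  · exact (hmix v u hv hu huv.symm).elim
  · obtain ⟨j, i, hi, rfl⟩ := exists_layer hu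
    obtain ⟨j', i', hi', rfl⟩ := exists_layer hv
    have hj := congrArg norm huv
    rw [hlayer j i hi, hlayer j' i' hi', add_right_inj, Nat.cast_inj] at hj
    subst hj
    rw [toPlane_ladderPos_add _ _ hi, toPlane_ladderPos_add _ _ hi'] at huv
    have := smul_corner_ne hi hi' (by positivity) (by positivity) huv
    rw [this]

/-- The edges of the ladder, up to orientation: base edges, edges between consecutive layers, and
edges within a layer above the base. -/
def LadderEdge (B : SimpleGraph ℕ) (p u v : ℕ) : Prop :=
  B.Adj u v ∨ (∃ j, ∃ i < 4, u = p + 4 * j + i ∧ v = p + 4 * (j + 1) + i) ∨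
    ∃ j, ∃ i < 4, u = p + 4 * (j + 1) + i ∧ v = p + 4 * (j + 1) + (i + 1) % 4

theorem ladderEdge_of_adj (hB : IsLadderBase B p) {k u v : ℕ}
    (h : (closedLadder B p k).Adj u v) : LadderEdge B p u v ∨ LadderEdge B p v u := by
  have hspoke : ∀ u, p ≤ u → LadderEdge B p u (u + 4) := by
    intro u hu
    obtain ⟨j, i, hi, rfl⟩ := exists_layer hu
    exact Or.inr (Or.inl ⟨j, i, hi, rfl, by omega⟩)
  have hside : ∀ j, ∀ i < 4, LadderEdge B p (p + 4 * (j + 1) + i) (p + 4 * (j + 1) + (i + 1) % 4) :=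
    fun j i hi => Or.inr (Or.inr ⟨j, i, hi, rfl, rfl⟩)
  have hclosing : ∀ i, i = 0 ∨ i = 2 → LadderEdge B p (p + 4 * k + i) (p + 4 * k + i + 1) := by
    rintro i (rfl | rfl) <;> rcases k with _ | k
    exacts [Or.inl hB.adj01, hside k 0 (by omega), Or.inl hB.adj23, hside k 2 (by omega)]
  rcases closedLadder_adj.1 h with h | ⟨rfl, rfl⟩ | ⟨rfl, rfl⟩ | ⟨rfl, rfl⟩ | ⟨rfl, rfl⟩
  · rcases openLadder_adj.1 h with h | ⟨hp, rfl⟩ | ⟨hp, rfl⟩ | ⟨j, ⟨rfl, rfl⟩ | ⟨rfl, rfl⟩⟩ |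
      ⟨j, ⟨rfl, rfl⟩ | ⟨rfl, rfl⟩⟩
    exacts [Or.inl (Or.inl h.1), Or.inl (hspoke _ hp), Or.inr (hspoke _ hp),
      Or.inl (hside j 1 (by omega)), Or.inr (hside j 3 (by omega)),
      Or.inr (hside j 1 (by omega)), Or.inl (hside j 3 (by omega))]
  exacts [Or.inl (hclosing 0 (Or.inl rfl)), Or.inl (hclosing 2 (Or.inr rfl)),
    Or.inr (hclosing 0 (Or.inl rfl)), Or.inr (hclosing 2 (Or.inr rfl))]

theorem eq_zero_or_one_of_add_eq {j j' : ℕ} {a b : ℝ} (ha : a ∈ Set.Icc (0 : ℝ) 1)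
    (hb : b ∈ Set.Icc (0 : ℝ) 1) (hjj : j ≠ j') (h : (j : ℝ) + a = j' + b) :
    (a = 0 ∨ a = 1) ∧ (b = 0 ∨ b = 1) := by
  obtain ⟨ha0, ha1⟩ := ha
  obtain ⟨hb0, hb1⟩ := hb
  rcases hjj.lt_or_gt with hlt | hlt
  · have : (j : ℝ) + 1 ≤ j' := by exact_mod_cast hlt
    exact ⟨Or.inr (by linarith), Or.inl (by linarith)⟩
  · have : (j' : ℝ) + 1 ≤ j := by exact_mod_cast hlt
    exact ⟨Or.inl (by linarith), Or.inr (by linarith)⟩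

/-- Base edges, spokes and sides of squares meet only at ends. The maximum norm separates them: it
is at most `R` on base edges, constant on the sides of a square, and increasing on the spokes. -/
theorem IsBaseDrawing.meetAtEnds (h : IsBaseDrawing B pts p R) (hB : IsLadderBase B p)
    {u v u' v' : ℕ} (huv : LadderEdge B p u v) (huv' : LadderEdge B p u' v')
    (hne : s(u, v) ≠ s(u', v')) :
    MeetAtEnds (toPlane (ladderPos pts p R u)) (toPlane (ladderPos pts p R v))
      (toPlane (ladderPos pts p R u')) (toPlane (ladderPos pts p R v')) := by
  have hR : (0 : ℝ) < R := Nat.cast_pos.2 h.pos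
  have hinj := h.ladderPos_injective
  -- points on an edge between layers, and on an edge within a layer
  have hspoke : ∀ (j i : ℕ) (b : ℝ), i < 4 →
      AffineMap.lineMap (toPlane (ladderPos pts p R (p + 4 * j + i)))
        (toPlane (ladderPos pts p R (p + 4 * (j + 1) + i))) b =
          ((R : ℝ) + j + b) • toPlane (corner i) := by
    intro j i b hi
    rw [toPlane_ladderPos_add _ _ hi, toPlane_ladderPos_add _ _ hi, AffineMap.lineMap_apply_module,
      smul_smul, smul_smul, ← add_smul]
    congr 1
    push_cast; ring
  have hside : ∀ (j i : ℕ) (b : ℝ), i < 4 →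
      AffineMap.lineMap (toPlane (ladderPos pts p R (p + 4 * (j + 1) + i)))
        (toPlane (ladderPos pts p R (p + 4 * (j + 1) + (i + 1) % 4))) b =
          ((R : ℝ) + (j + 1 : ℕ)) •
            AffineMap.lineMap (toPlane (corner i)) (toPlane (corner (i + 1))) b := by
    intro j i b hi
    have hc : corner ((i + 1) % 4) = corner (i + 1) := by simp [corner]
    rw [toPlane_ladderPos_add _ _ hi, toPlane_ladderPos_add _ _ (Nat.mod_lt _ (by norm_num)), hc,
      AffineMap.lineMap_apply_module, AffineMap.lineMap_apply_module, smul_add, smul_comm,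
      smul_comm b]
  have hnspoke : ∀ (j i : ℕ) (b : ℝ), b ∈ Set.Icc (0 : ℝ) 1 →
      ‖((R : ℝ) + j + b) • toPlane (corner i)‖ = R + j + b := fun j i b hb =>
    norm_toPlane_smul_corner i (by have := hb.1; positivity)
  have hnside : ∀ (j i : ℕ) (b : ℝ), b ∈ Set.Icc (0 : ℝ) 1 → ‖((R : ℝ) + (j + 1 : ℕ)) •
      AffineMap.lineMap (toPlane (corner i)) (toPlane (corner (i + 1))) b‖ = R + (j + 1 : ℕ) := by
    intro j i b hb
    rw [norm_smul, norm_lineMap_corner i hb, mul_one, Real.norm_of_nonneg (by positivity)]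
  have hbase : ∀ {u v} {a : ℝ}, B.Adj u v → a ∈ Set.Icc (0 : ℝ) 1 →
      ‖AffineMap.lineMap (toPlane (ladderPos pts p R u)) (toPlane (ladderPos pts p R v)) a‖ ≤ R :=
    fun huv ha => norm_lineMap_le (h.norm_le (hB.lt huv)) (h.norm_le (hB.lt huv.symm)) ha
  -- the mixed cases
  have hbase_spoke : ∀ {u v j i : ℕ}, B.Adj u v → i < 4 →
      MeetAtEnds (toPlane (ladderPos pts p R u)) (toPlane (ladderPos pts p R v))
        (toPlane (ladderPos pts p R (p + 4 * j + i)))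
        (toPlane (ladderPos pts p R (p + 4 * (j + 1) + i))) := by
    intro u v j i huv hi a ha b hb hab
    have h1 := hbase huv ha
    rw [hab, hspoke j i b hi, hnspoke j i b hb] at h1
    have hj0 : (0 : ℝ) ≤ j := Nat.cast_nonneg j
    have hb0 : b = 0 := by have := hb.1; linarith
    have hj : (j : ℝ) = 0 := by have := hb.1; linarith
    refine ⟨lineMap_eq_corner (r := R) (i := i) (h.norm_le (hB.lt huv))
      (h.norm_le (hB.lt huv.symm)) (hinj.ne huv.ne) ha ?_, Or.inl hb0⟩
    rw [hab, hspoke j i b hi, hb0, hj, add_zero, add_zero]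
  have hbase_side : ∀ {u v j i : ℕ}, B.Adj u v → i < 4 →
      MeetAtEnds (toPlane (ladderPos pts p R u)) (toPlane (ladderPos pts p R v))
        (toPlane (ladderPos pts p R (p + 4 * (j + 1) + i)))
        (toPlane (ladderPos pts p R (p + 4 * (j + 1) + (i + 1) % 4))) := by
    intro u v j i huv hi a ha b hb hab
    have h1 := hbase huv ha
    rw [hab, hside j i b hi, hnside j i b hb] at h1
    have : (0 : ℝ) < (j + 1 : ℕ) := by positivity
    linarith
  have hside_spoke : ∀ {j i j' i' : ℕ}, i < 4 → i' < 4 →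
      MeetAtEnds (toPlane (ladderPos pts p R (p + 4 * (j + 1) + i)))
        (toPlane (ladderPos pts p R (p + 4 * (j + 1) + (i + 1) % 4)))
        (toPlane (ladderPos pts p R (p + 4 * j' + i')))
        (toPlane (ladderPos pts p R (p + 4 * (j' + 1) + i'))) := by
    intro j i j' i' hi hi' a ha b hb hab
    have h1 := congrArg norm hab
    rw [hside j i a hi, hspoke j' i' b hi', hnspoke j' i' b hb, hnside j i a ha, add_assoc,
      add_right_inj] at h1
    have hb01 : b = 0 ∨ b = 1 := by
      by_cases hj : j + 1 = j'
      · rw [hj] at h1; exact Or.inl (by linarith)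
      · exact (eq_zero_or_one_of_add_eq ⟨le_rfl, zero_le_one⟩ hb hj
          (a := 0) (by rw [add_zero]; exact h1)).2
    refine ⟨lineMap_eq_corner (p := toPlane (ladderPos pts p R (p + 4 * (j + 1) + i)))
      (q := toPlane (ladderPos pts p R (p + 4 * (j + 1) + (i + 1) % 4)))
      (r := R + (j + 1 : ℕ)) (i := i') ?_ ?_ (hinj.ne ?_) ha ?_, hb01⟩
    · rw [toPlane_ladderPos_add _ _ hi, norm_toPlane_smul_corner i (by positivity)]
    · rw [toPlane_ladderPos_add _ _ (Nat.mod_lt _ (by norm_num)),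
        norm_toPlane_smul_corner _ (by positivity)]
    · omega
    · rw [hab, hspoke j' i' b hi', add_assoc, h1]
  rcases huv with huv | ⟨j, i, hi, rfl, rfl⟩ | ⟨j, i, hi, rfl, rfl⟩ <;>
    rcases huv' with huv' | ⟨j', i', hi', rfl, rfl⟩ | ⟨j', i', hi', rfl, rfl⟩
  · exact h.apart huv huv' hne
  · exact hbase_spoke huv hi'
  · exact hbase_side huv hi'
  · exact (hbase_spoke huv' hi).symm
  · intro a ha b hb hab
    rw [hspoke j i a hi, hspoke j' i' b hi'] at hab
    have hii := smul_corner_ne hi hi' (by have := ha.1; positivity)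
      (by have := hb.1; positivity) hab
    subst hii
    have h1 := congrArg norm hab
    rw [hnspoke j i a ha, hnspoke j' i b hb, add_assoc, add_assoc, add_right_inj] at h1
    exact eq_zero_or_one_of_add_eq ha hb (fun hj => hne (by rw [hj])) h1
  · exact (hside_spoke hi' hi).symm
  · exact (hbase_side huv' hi).symm
  · exact hside_spoke hi hi'
  · intro a ha b hb hab
    rw [hside j i a hi, hside j' i' b hi'] at hab
    have h1 := congrArg norm hab
    rw [hnside j i a ha, hnside j' i' b hb, add_right_inj, Nat.cast_inj] at h1
    rw [h1] at hab
    have hpos : (R : ℝ) + (j' + 1 : ℕ) ≠ 0 := by positivity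
    refine meetAtEnds_corner hi hi' (fun hii => hne ?_) a ha b hb
      (smul_right_injective _ hpos hab)
    rw [hii, show j = j' by omega]

theorem IsBaseDrawing.isPlanar (h : IsBaseDrawing B pts p R) (hB : IsLadderBase B p) {k : ℕ}
    (hdeg : ∀ v w : Fin (p + 4 * (k + 1)), v ≠ w → ∃ x, x ≠ w ∧ (closedLadder B p k).Adj v x) :
    IsPlanar ((closedLadder B p k).comap Fin.val : SimpleGraph (Fin (p + 4 * (k + 1)))) := by
  refine isPlanar_of_meetAtEnds (fun v => toPlane (ladderPos pts p R v))
    (h.ladderPos_injective.comp Fin.val_injective) hdeg ?_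
  intro u v u' v' huv huv' hne
  have hne' : s(u.1, v.1) ≠ s(u'.1, v'.1) := fun h => hne (by
    rw [Sym2.eq_iff] at h ⊢
    simpa [Fin.ext_iff] using h)
  rcases ladderEdge_of_adj hB huv with h1 | h1 <;> rcases ladderEdge_of_adj hB huv' with h2 | h2
  · exact h.meetAtEnds hB h1 h2 hne'
  · exact (h.meetAtEnds hB h1 h2 (by rwa [Sym2.eq_swap (a := v'.1)])).swap_right
  · exact (h.meetAtEnds hB h1 h2 (by rwa [Sym2.eq_swap (a := v.1)])).swap_left
  · exact (h.meetAtEnds hB h1 h2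
      (by rwa [Sym2.eq_swap (a := v.1), Sym2.eq_swap (a := v'.1)])).swap_left.swap_right

end Drawing

/-! ### Plane graphs given by tables -/

/-- The table of a plane graph on the numbers below `p + 4` whose faces are quadrilaterals (the
labels below `quads`) and pentagons (the other labels below `faces`), with the certificates used to
show that it starts a ladder of hypohamiltonian graphs. -/
structure PlaneData where
  /-- the vertices `p, p + 1, p + 2, p + 3` form the quadrilateral where the ladder is attached -/
  p : ℕ
  faces : ℕ
  quads : ℕ
  /-- the entries `(w, l, r)` of row `v` are the neighbours `w` of `v` in cyclic order, with the
  faces `l` and `r` on the left and on the right of the edge from `v` to `w` -/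
  rot : List (List (ℕ × ℕ × ℕ))
  /-- sets of quadrilaterals that have to be compared with the sides of a Hamiltonian cycle -/
  clusters : List (List ℕ)
  /-- the first `p` vertices are drawn inside the square of this radius -/
  radius : ℕ
  pts : List (ℤ × ℤ)
  /-- entry `v` is a spanning path of the graph without `v` and without the edges `{p, p + 1}` and
  `{p + 2, p + 3}`, which joins the ends of one of these -/
  detours : List (List ℕ)
  /-- a spanning path from `p` to `p + 2` without these two edges -/
  diag02 : List ℕ
  /-- a spanning path from `p + 1` to `p + 3` without these two edges -/
  diag13 : List ℕ

namespace PlaneData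

variable (D : PlaneData)

/-- The neighbours of `v` with the faces on both sides, in cyclic order. -/
def row (v : ℕ) : List (ℕ × ℕ × ℕ) := D.rot.getD v []

/-- Adjacency, as it can be read off from the table. -/
abbrev Joins (u v : ℕ) : Prop := v ∈ (D.row u).map Prod.fst

/-- Adjacency in the graph without the edges `{p, p + 1}` and `{p + 2, p + 3}`. -/
abbrev OpenJoins (u v : ℕ) : Prop :=
  D.Joins u v ∧
    (u, v) ∉ [(D.p, D.p + 1), (D.p + 1, D.p), (D.p + 2, D.p + 3), (D.p + 3, D.p + 2)]

/-- An edge that separates a quadrilateral in `S` from a quadrilateral not in `S`. -/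
abbrev Separates (S : List ℕ) (e : ℕ × ℕ × ℕ) : Prop :=
  e.2.1 < D.quads ∧ e.2.2 < D.quads ∧ ¬ (e.2.1 ∈ S ↔ e.2.2 ∈ S)

/-- If `S` is the set of quadrilaterals inside a Hamiltonian cycle, then the cycle has the wrong
number of edges at `v`. -/
def IsBadVertex (S : List ℕ) (v : ℕ) : Prop :=
  2 < (D.row v).countP (D.Separates S) ∨
    (∀ e ∈ D.row v, e.2.1 < D.quads ∧ e.2.2 < D.quads) ∧
      (D.row v).countP (D.Separates S) ≠ 2

instance (S : List ℕ) (v : ℕ) : Decidable (D.IsBadVertex S v) := by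
  unfold IsBadVertex; infer_instance

/-- `X` is a set of quadrilaterals on one side of `S`, without neighbours on the same side. If `S`
is the set of quadrilaterals inside a Hamiltonian cycle, then `X` is one whole side of the cycle. -/
def IsCluster (S X : List ℕ) : Prop :=
  X ≠ [] ∧ (∀ x ∈ X, x < D.quads) ∧ ((∀ x ∈ X, x ∈ S) ∨ ∀ x ∈ X, x ∉ S) ∧
    ∀ v < D.p + 4, ∀ e ∈ D.row v, e.2.1 ∈ X →
      e.2.2 ∈ X ∨ e.2.2 < D.quads ∧ ¬ (e.2.1 ∈ S ↔ e.2.2 ∈ S)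

instance (S X : List ℕ) : Decidable (D.IsCluster S X) := by
  unfold IsCluster; infer_instance

/-- The edges, oriented upwards. -/
def edges : List (ℕ × ℕ) :=
  (List.range (D.p + 4)).flatMap fun u =>
    (((D.row u).map Prod.fst).filter (u < ·)).map fun v => (u, v)

/-- The position of `v` in the drawing. -/
def pos (v : ℕ) : ℤ × ℤ := ladderPos (fun v => D.pts.getD v 0) D.p D.radius v

/-- The properties of a path that can be read off from the table. -/
def IsPathFromTo (n s t : ℕ) (l : List ℕ) : Prop :=
  l.Nodup ∧ l.length = n ∧ (∀ x ∈ l, x < D.p + 4) ∧ l.IsChain D.OpenJoins ∧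
    l.head? = some s ∧ l.getLast? = some t

instance (n s t : ℕ) (l : List ℕ) : Decidable (D.IsPathFromTo n s t l) := by
  unfold IsPathFromTo; infer_instance

/-- The table describes a plane graph of the required kind, and its certificates are correct. In
`coloring`, `S` is a candidate for the set of quadrilaterals inside a Hamiltonian cycle; Grinberg's
criterion gives `2 * |S| + 3 * m = p + 2`, where `m` is the number of pentagons inside. -/
structure IsValid : Prop where
  nodup : ∀ v < D.p + 4, ((D.row v).map Prod.fst).Nodup
  ne_nil : ∀ v < D.p + 4, D.row v ≠ []
  length_rot : D.rot.length = D.p + 4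
  symm : ∀ v < D.p + 4, ∀ e ∈ D.row v, e.1 ≠ v ∧ (v, e.2.2, e.2.1) ∈ D.row e.1
  corner : ∀ v < D.p + 4, ∀ i < (D.row v).length,
    ((D.row v).getD ((i + 1) % (D.row v).length) 0).2.2 = ((D.row v).getD i 0).2.1
  face_lt : ∀ v < D.p + 4, ∀ e ∈ D.row v, e.2.1 < D.faces
  card_face : ∀ x < D.faces, ∑ v ∈ Finset.range (D.p + 4), (D.row v).countP (·.2.1 = x) =
    if x < D.quads then 4 else 5
  euler : 5 * D.faces + 4 = 2 * (D.p + 4) + 2 * D.faces + D.quads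
  quads_le : 2 * D.quads + 2 < D.p + 4 ∧ D.quads ≤ D.faces
  coloring : ∀ S ∈ (List.range D.quads).sublists, (2 * S.length) % 3 = (D.p + 2) % 3 →
    (∃ v < D.p + 4, D.IsBadVertex S v) ∨ ∃ X ∈ D.clusters, D.IsCluster S X
  terminals : D.Joins D.p (D.p + 1) ∧ D.Joins (D.p + 1) (D.p + 2) ∧
    D.Joins (D.p + 2) (D.p + 3) ∧ D.Joins D.p (D.p + 3)
  pts_lt : 0 < D.radius ∧ D.pts.length = D.p ∧
    ∀ q ∈ D.pts, q.1.natAbs < D.radius ∧ q.2.natAbs < D.radius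
  pts_nodup : D.pts.Nodup
  edges_apart : D.edges.Pairwise fun e e' =>
    SegmentsApart (D.pos e.1) (D.pos e.2) (D.pos e'.1) (D.pos e'.2)
  detour : ∀ v < D.p + 4, v ∉ D.detours.getD v [] ∧
    (D.IsPathFromTo (D.p + 3) D.p (D.p + 1) (D.detours.getD v []) ∨
      D.IsPathFromTo (D.p + 3) (D.p + 2) (D.p + 3) (D.detours.getD v []))
  diag02 : D.IsPathFromTo (D.p + 4) D.p (D.p + 2) D.diag02
  diag13 : D.IsPathFromTo (D.p + 4) (D.p + 1) (D.p + 3) D.diag13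

variable {D : PlaneData}

theorem row_eq_nil (h : D.IsValid) {v : ℕ} (hv : D.p + 4 ≤ v) : D.row v = [] := by
  rw [row, List.getD_eq_default _ _ (by rw [h.length_rot]; exact hv)]

theorem lt_of_mem_row (h : D.IsValid) {v : ℕ} {e : ℕ × ℕ × ℕ} (he : e ∈ D.row v) :
    v < D.p + 4 := by
  by_contra hv
  rw [row_eq_nil h (not_lt.1 hv)] at he
  exact List.not_mem_nil he

/-- The graph described by a table. -/
def graph (D : PlaneData) : SimpleGraph ℕ := SimpleGraph.fromRel D.Joins

theorem joins_symm (h : D.IsValid) {u v : ℕ} (huv : D.Joins u v) : D.Joins v u := by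
  obtain ⟨e, he, rfl⟩ := List.mem_map.1 huv
  exact List.mem_map.2 ⟨_, (h.symm u (lt_of_mem_row h he) e he).2, rfl⟩

theorem graph_adj (h : D.IsValid) {u v : ℕ} : D.graph.Adj u v ↔ D.Joins u v := by
  rw [graph, SimpleGraph.fromRel_adj]
  refine ⟨fun ⟨_, h'⟩ => h'.elim id (joins_symm h), fun huv => ⟨?_, Or.inl huv⟩⟩
  obtain ⟨e, he, rfl⟩ := List.mem_map.1 huv
  exact (h.symm u (lt_of_mem_row h he) e he).1.symm

theorem graph_adj_iff (h : D.IsValid) {u v : ℕ} :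
    D.graph.Adj u v ↔ ∃ e ∈ D.row u, e.1 = v := by
  rw [graph_adj h, Joins, List.mem_map]

theorem lt_of_adj (h : D.IsValid) {u v : ℕ} (huv : D.graph.Adj u v) : u < D.p + 4 := by
  obtain ⟨e, he, -⟩ := (graph_adj_iff h).1 huv
  exact lt_of_mem_row h he

theorem isLadderBase (h : D.IsValid) : IsLadderBase D.graph D.p where
  lt := lt_of_adj h
  adj01 := (graph_adj h).2 h.terminals.1
  adj12 := (graph_adj h).2 h.terminals.2.1
  adj23 := (graph_adj h).2 h.terminals.2.2.1
  adj30 := (graph_adj h).2 h.terminals.2.2.2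

/-! ### The rotation system of a table -/

theorem _root_.List.lookup_eq_some_of_mem {α β : Type*} [DecidableEq α] {l : List (α × β)}
    (hl : (l.map Prod.fst).Nodup) {e : α × β} (he : e ∈ l) : l.lookup e.1 = some e.2 := by
  induction l with
  | nil => simp at he
  | cons x l ih =>
    rw [List.map_cons, List.nodup_cons] at hl
    obtain ⟨a, b⟩ := x
    rw [List.lookup_cons]
    rcases List.mem_cons.1 he with rfl | he
    · simp
    · have hne : (e.1 == a) = false :=
        beq_false_of_ne fun hea => hl.1 (List.mem_map.2 ⟨e, he, hea⟩)
      simp [hne, ih hl.2 he]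

/-- The face on the left of the edge from `u` to `v`, or 0 if there is no such edge. -/
def left (D : PlaneData) (u v : ℕ) : ℕ := (((D.row u).lookup v).getD (0, 0)).1

theorem left_of_mem (h : D.IsValid) {u : ℕ} {e : ℕ × ℕ × ℕ} (he : e ∈ D.row u) :
    D.left u e.1 = e.2.1 := by
  rw [left, List.lookup_eq_some_of_mem (h.nodup u (lt_of_mem_row h he)) he, Option.getD_some]

theorem right_of_mem (h : D.IsValid) {u : ℕ} {e : ℕ × ℕ × ℕ} (he : e ∈ D.row u) :
    D.left e.1 u = e.2.2 :=
  left_of_mem h (h.symm u (lt_of_mem_row h he) e he).2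

theorem left_lt (h : D.IsValid) (u v : ℕ) : D.left u v < D.faces := by
  by_cases huv : ∃ e ∈ D.row u, e.1 = v
  · obtain ⟨e, he, rfl⟩ := huv
    rw [left_of_mem h he]
    exact h.face_lt u (lt_of_mem_row h he) e he
  · have hnone : (D.row u).lookup v = none := by
      rw [List.lookup_eq_none_iff]
      intro e he
      simpa using fun hev => huv ⟨e, he, hev.symm⟩
    rw [left, hnone]
    have h0 : 0 < D.p + 4 := by omega
    exact (Nat.zero_le _).trans_lt (h.face_lt 0 h0 _ (List.head_mem (h.ne_nil 0 h0)))

/-- The graph of a table on the vertex set `Fin (p + 4)`. -/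
abbrev finGraph (D : PlaneData) : SimpleGraph (Fin (D.p + 4)) := D.graph.comap Fin.val

theorem length_row_pos (h : D.IsValid) (v : Fin (D.p + 4)) : 0 < (D.row v).length :=
  List.length_pos_of_ne_nil (h.ne_nil v v.2)

/-- The entry of row `v` with index `i`, read cyclically. -/
def entry (h : D.IsValid) (v : Fin (D.p + 4)) (i : ℕ) : ℕ × ℕ × ℕ :=
  (D.row v)[i % (D.row v).length]'(Nat.mod_lt _ (length_row_pos h v))

theorem entry_mem (h : D.IsValid) (v : Fin (D.p + 4)) (i : ℕ) : entry h v i ∈ D.row v :=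
  List.getElem_mem _

theorem fst_lt_of_mem_row (h : D.IsValid) {v : ℕ} {e : ℕ × ℕ × ℕ} (he : e ∈ D.row v) :
    e.1 < D.p + 4 :=
  lt_of_mem_row h (h.symm v (lt_of_mem_row h he) e he).2

/-- The rotation system described by a table. -/
def rotationSystem (h : D.IsValid) : RotationSystem D.finGraph (Fin D.faces) where
  nb v i := ⟨(entry h v i).1, fst_lt_of_mem_row h (entry_mem h v i)⟩
  deg v := (D.row v).length
  left u v := ⟨D.left u v, left_lt h u v⟩
  deg_pos := length_row_pos h
  periodic v i := by simp only [entry, Nat.add_mod_right]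
  adj_iff v w := by
    rw [SimpleGraph.comap_adj, graph_adj_iff h]
    constructor
    · rintro ⟨e, he, hew⟩
      obtain ⟨i, hi, rfl⟩ := List.mem_iff_getElem.1 he
      refine ⟨i, Fin.ext ?_⟩
      simp only [entry, Nat.mod_eq_of_lt hi, hew]
    · rintro ⟨i, rfl⟩
      exact ⟨_, entry_mem h v i, rfl⟩
  corner v i := by
    refine Fin.ext ?_
    simp only
    rw [left_of_mem h (entry_mem h v i), right_of_mem h (entry_mem h v (i + 1))]
    have hi := Nat.mod_lt i (length_row_pos h v)
    have hc := h.corner v v.2 _ hi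
    rw [Nat.mod_add_mod, List.getD_eq_getElem _ _ hi,
      List.getD_eq_getElem _ _ (Nat.mod_lt _ (length_row_pos h v))] at hc
    exact hc.symm

/-- Counting neighbours of `v` in the graph amounts to counting entries of row `v`. -/
theorem card_filter_row (h : D.IsValid) (v : Fin (D.p + 4)) (Q : ℕ × ℕ × ℕ → Prop)
    [DecidablePred Q] (s : Finset (Fin (D.p + 4)))
    (hs : ∀ w, w ∈ s ↔ ∃ e ∈ D.row v, e.1 = (w : ℕ) ∧ Q e) :
    s.card = (D.row v).countP Q := by
  have hmap : s.map Fin.valEmbedding = (((D.row v).filter Q).map Prod.fst).toFinset := by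
    ext x
    simp only [Finset.mem_map, Fin.valEmbedding_apply, List.mem_toFinset, List.mem_map,
      List.mem_filter, decide_eq_true_eq, hs]
    constructor
    · rintro ⟨w, ⟨e, he, hew, hQ⟩, rfl⟩
      exact ⟨e, ⟨he, hQ⟩, hew⟩
    · rintro ⟨e, ⟨he, hQ⟩, rfl⟩
      exact ⟨⟨e.1, fst_lt_of_mem_row h he⟩, ⟨e, he, rfl, hQ⟩, rfl⟩
  rw [← Finset.card_map, hmap, List.toFinset_card_of_nodup, List.length_map,
    List.countP_eq_length_filter]
  exact (h.nodup v v.2).sublist (List.filter_sublist.map _)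

theorem card_dart_left (h : D.IsValid) (B : Finset (Fin D.faces)) :
    Nat.card {d : D.finGraph.Dart // (rotationSystem h).left d.fst d.snd ∈ B} =
      ∑ x ∈ B, if (x : ℕ) < D.quads then 4 else 5 := by
  classical
  let s : Fin D.faces → Fin (D.p + 4) → Finset (Fin (D.p + 4)) := fun x v =>
    Finset.univ.filter fun w => D.finGraph.Adj v w ∧ D.left v w = x
  have hs : ∀ x v, (s x v).card = (D.row v).countP fun e => e.2.1 = (x : ℕ) := by
    intro x v
    refine card_filter_row h v _ _ fun w => ?_
    rw [Finset.mem_filter_univ, SimpleGraph.comap_adj, graph_adj_iff h]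
    constructor
    · rintro ⟨⟨e, he, hew⟩, hx⟩
      rw [← hew, left_of_mem h he] at hx
      exact ⟨e, he, hew, hx⟩
    · rintro ⟨e, he, hew, hx⟩
      rw [← hew, left_of_mem h he]
      exact ⟨⟨e, he, rfl⟩, hx⟩
  have hcard : ∀ x : Fin D.faces, ∑ v, (s x v).card = if (x : ℕ) < D.quads then 4 else 5 := by
    intro x
    rw [← h.card_face x x.2, Finset.sum_range]
    exact Finset.sum_congr rfl fun v _ => hs x v
  rw [← Finset.sum_congr rfl fun x _ => hcard x,
    ← Finset.sum_congr rfl fun x _ => Finset.card_sigma Finset.univ (s x), ← Finset.card_sigma,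
    Nat.card_eq_fintype_card, Fintype.card_subtype]
  refine Finset.card_bij (fun d _ => ⟨(rotationSystem h).left d.fst d.snd, d.fst, d.snd⟩) ?_ ?_ ?_
  · intro d hd
    simp only [Finset.mem_sigma, s, Finset.mem_filter_univ]
    exact ⟨(Finset.mem_filter.1 hd).2, Finset.mem_univ _, d.adj, rfl⟩
  · intro d _ d' _ hdd
    simp only [Sigma.mk.injEq, heq_eq_eq] at hdd
    exact SimpleGraph.Dart.ext _ _ (Prod.ext hdd.2.1 hdd.2.2)
  · rintro ⟨x, v, w⟩ hx
    simp only [Finset.mem_sigma, s, Finset.mem_filter_univ] at hx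
    obtain ⟨hxB, -, hadj, hxl⟩ := hx
    have hl : (rotationSystem h).left v w = x := Fin.ext hxl
    exact ⟨⟨(v, w), hadj⟩, Finset.mem_filter.2 ⟨Finset.mem_univ _, by rw [hl]; exact hxB⟩,
      by rw [hl]⟩

/-- The number of edges agrees with Euler's formula. -/
theorem card_dart (h : D.IsValid) :
    Nat.card D.finGraph.Dart + 4 =
      2 * (Fintype.card (Fin (D.p + 4)) + Fintype.card (Fin D.faces)) := by
  have h1 := card_dart_left h Finset.univ
  rw [Nat.card_congr (Equiv.subtypeUnivEquiv fun d => Finset.mem_univ _),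
    Finset.sum_ite, Finset.sum_const, Finset.sum_const, smul_eq_mul, smul_eq_mul] at h1
  have h2 := Finset.card_filter_add_card_filter_not (s := (Finset.univ : Finset (Fin D.faces)))
    (fun x => (x : ℕ) < D.quads)
  have h3 : (Finset.univ.filter fun x : Fin D.faces => (x : ℕ) < D.quads).card = D.quads := by
    rw [Fin.card_filter_val_lt, min_eq_right h.quads_le.2]
  rw [Finset.card_univ] at h2
  rw [Fintype.card_fin] at h2 ⊢
  rw [Fintype.card_fin]
  have := h.euler
  omega

/-- Grinberg's criterion: the checks made for every set `S` of quadrilaterals exclude that `S`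
consists of the quadrilaterals inside a Hamiltonian cycle. -/
theorem not_isCircuit (h : D.IsValid) (f : Fin (D.p + 4) → Fin (D.p + 4)) :
    ¬ IsCircuit D.finGraph f := by
  classical
  intro hf
  have hV : 3 ≤ Fintype.card (Fin (D.p + 4)) := by rw [Fintype.card_fin]; omega
  have hquads := h.quads_le
  have hF : ∀ x, ∃ u v, D.finGraph.Adj u v ∧ (rotationSystem h).left u v = x := by
    intro x
    have hx := card_dart_left h {x}
    rw [Finset.sum_singleton] at hx
    have : 0 < Nat.card {d : D.finGraph.Dart // (rotationSystem h).left d.fst d.snd ∈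
        ({x} : Finset (Fin D.faces))} := by
      rw [hx]; split_ifs <;> norm_num
    obtain ⟨⟨d, hd⟩⟩ := (Nat.card_pos_iff.1 this).1
    exact ⟨d.fst, d.snd, d.adj, Finset.mem_singleton.1 hd⟩
  obtain ⟨A, hcirc, hchord, hside⟩ :=
    (rotationSystem h).exists_side hf hV hF (card_dart h)
  let inA : ℕ → Prop := fun x => ∃ hx : x < D.faces, (⟨x, hx⟩ : Fin D.faces) ∈ A
  have hinA : ∀ x : Fin D.faces, inA x ↔ x ∈ A := fun x => ⟨fun ⟨_, hx⟩ => hx, fun hx => ⟨x.2, hx⟩⟩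
  let S : List ℕ := (List.range D.quads).filter inA
  have hS : ∀ x : Fin D.faces, (x : ℕ) < D.quads → ((x : ℕ) ∈ S ↔ x ∈ A) := by
    intro x hx
    simp only [S, List.mem_filter, List.mem_range, decide_eq_true_eq, hinA, hx, true_and]
  -- the faces on the two sides of an edge, and whether the edge lies on the circuit
  have hleft : ∀ (v w : Fin (D.p + 4)) (e), e ∈ D.row v → e.1 = (w : ℕ) →
      D.finGraph.Adj v w ∧ ((rotationSystem h).left v w : ℕ) = e.2.1 ∧
        ((rotationSystem h).left w v : ℕ) = e.2.2 := by
    intro v w e he hew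
    refine ⟨?_, ?_, ?_⟩
    · rw [SimpleGraph.comap_adj, graph_adj_iff h]; exact ⟨e, he, hew⟩
    · exact (congrArg (D.left v) hew.symm).trans (left_of_mem h he)
    · exact (congrArg (fun x => D.left x v) hew.symm).trans (right_of_mem h he)
  have hmod : (2 * S.length) % 3 = (D.p + 2) % 3 := by
    have h1 := (hside A (Or.inl rfl)).1
    rw [card_dart_left, Finset.sum_ite, Finset.sum_const, Finset.sum_const, smul_eq_mul,
      smul_eq_mul, Fintype.card_fin] at h1
    have h2 := Finset.card_filter_add_card_filter_not (s := A)
      (fun x : Fin D.faces => (x : ℕ) < D.quads)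
    have h3 : S.length = (A.filter fun x : Fin D.faces => (x : ℕ) < D.quads).card := by
      have hnd : S.Nodup := List.nodup_range.filter _
      rw [← List.toFinset_card_of_nodup hnd, ← Finset.card_map Fin.valEmbedding]
      congr 1
      ext x
      simp only [S, List.mem_toFinset, List.mem_filter, List.mem_range, decide_eq_true_eq,
        Finset.mem_map, Finset.mem_filter, Fin.valEmbedding_apply]
      constructor
      · rintro ⟨hx, hxF, hxA⟩
        exact ⟨⟨x, hxF⟩, ⟨hxA, hx⟩, rfl⟩
      · rintro ⟨y, ⟨hyA, hy⟩, rfl⟩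
        exact ⟨hy, y.2, hyA⟩
    omega
  rcases h.coloring S (List.mem_sublists.2 List.filter_sublist) hmod with
    ⟨v, hv, hbad⟩ | ⟨X, -, hne, hXq, hmono, hlink⟩
  · -- the two circuit edges at `v` are the only ones separating the sides
    lift v to Fin (D.p + 4) using hv
    obtain ⟨u, hu⟩ := hf.surjective v
    have huv : f v ≠ u := by
      rintro rfl
      exact hf.apply_apply_ne hV v hu
    have hcard : ({f v, u} : Finset (Fin (D.p + 4))).card = 2 := Finset.card_pair huv
    have hsep : ∀ (w : Fin (D.p + 4)) (e), e ∈ D.row v → e.1 = (w : ℕ) → D.Separates S e →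
        w = f v ∨ w = u := by
      intro w e he hew ⟨hl, hr, hlr⟩
      obtain ⟨hadj, h1, h2⟩ := hleft v w e he hew
      by_contra! hw
      refine hlr ?_
      rw [← h1, ← h2, hS _ (h1 ▸ hl), hS _ (h2 ▸ hr)]
      exact hchord v w hadj hw.1 fun hvw => hw.2 (hf.injective (hvw ▸ hu.symm))
    have hcount := card_filter_row h v (D.Separates S)
      (Finset.univ.filter fun w : Fin (D.p + 4) => ∃ e ∈ D.row v, e.1 = (w : ℕ) ∧ D.Separates S e)
      fun w => Finset.mem_filter_univ w
    rcases hbad with hbad | ⟨hall, hbad⟩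
    · rw [← hcount] at hbad
      have hle := Finset.card_le_card (show (Finset.univ.filter fun w : Fin (D.p + 4) =>
          ∃ e ∈ D.row v, e.1 = (w : ℕ) ∧ D.Separates S e) ⊆ {f v, u} by
        intro w hw
        obtain ⟨e, he, hew, hs⟩ := (Finset.mem_filter_univ w).1 hw
        simpa using hsep w e he hew hs)
      omega
    · rw [← hcount] at hbad
      refine hbad (Eq.trans (congrArg _ ?_) hcard)
      ext w
      rw [Finset.mem_filter_univ, Finset.mem_insert, Finset.mem_singleton]
      constructor
      · rintro ⟨e, he, hew, hs⟩
        exact hsep w e he hew hs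
      · intro hw
        have hadj : D.finGraph.Adj v w := by
          rcases hw with rfl | rfl
          exacts [hf.adj v, hu ▸ (hf.adj w).symm]
        obtain ⟨e, he, hew⟩ := (graph_adj_iff h).1 hadj
        obtain ⟨-, h1, h2⟩ := hleft v w e he hew
        obtain ⟨hl, hr⟩ := hall e he
        refine ⟨e, he, hew, hl, hr, ?_⟩
        rw [← h1, ← h2, hS _ (h1 ▸ hl), hS _ (h2 ▸ hr)]
        rcases hw with rfl | rfl
        · have := hcirc v
          tauto
        · have := hcirc w
          rw [hu] at this
          tauto
  · -- a side consisting of quadrilaterals only would have too many faces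
    obtain ⟨B, hB, hXB⟩ : ∃ B : Finset (Fin D.faces), (B = A ∨ ∀ x, x ∈ B ↔ x ∉ A) ∧
        ∀ x : Fin D.faces, (x : ℕ) < D.quads → (x : ℕ) ∈ X → ∀ y : Fin D.faces,
          (y : ℕ) < D.quads → (y ∈ B ↔ ((x : ℕ) ∈ S ↔ (y : ℕ) ∈ S)) := by
      rcases hmono with hm | hm
      · refine ⟨A, Or.inl rfl, fun x hx hxX y hy => ?_⟩
        rw [hS y hy]
        have := hm x hxX
        tauto
      · refine ⟨Aᶜ, Or.inr fun x => Finset.mem_compl, fun x hx hxX y hy => ?_⟩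
        rw [hS y hy, Finset.mem_compl]
        have := hm x hxX
        tauto
    let Y : Finset (Fin D.faces) := Finset.univ.filter fun x => (x : ℕ) ∈ X
    have hY : ∀ x, x ∈ Y ↔ (x : ℕ) ∈ X := fun x => Finset.mem_filter_univ x
    have hYB : Y = B := by
      refine (hside B hB).2 Y ?_ ?_ ?_
      · intro x hx
        have hxX := (hY x).1 hx
        exact (hXB x (hXq x hxX) hxX x (hXq x hxX)).2 Iff.rfl
      · obtain ⟨x, l, rfl⟩ := List.exists_cons_of_ne_nil hne
        exact ⟨⟨x, (hXq x List.mem_cons_self).trans_le hquads.2⟩, (hY _).2 List.mem_cons_self⟩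
      · intro u v hadj hu hv
        obtain ⟨e, he, hew⟩ := (graph_adj_iff h).1 hadj
        obtain ⟨-, h1, h2⟩ := hleft u v e he hew
        rw [hY, h1] at hu
        rw [hY, h2]
        refine (hlink u u.2 e he hu).resolve_right fun ⟨hr, hlr⟩ => hlr ?_
        have := (hXB ((rotationSystem h).left u v) (by rw [h1]; exact hXq _ hu)
          (by rw [h1]; exact hu) _ (by rw [h2]; exact hr)).1 hv
        rwa [h1, h2] at this
    have h1 := (hside B hB).1
    have hlt : ∀ x ∈ B, (x : ℕ) < D.quads := fun x hx => hXq x ((hY x).1 (hYB ▸ hx))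
    rw [card_dart_left, Finset.sum_congr rfl fun x hx => if_pos (hlt x hx), Finset.sum_const,
      smul_eq_mul, Fintype.card_fin] at h1
    have hcard : B.card ≤ D.quads := by
      rw [← Finset.card_map Fin.valEmbedding, ← Finset.card_range D.quads]
      refine Finset.card_le_card fun y hy => ?_
      obtain ⟨x, hx, rfl⟩ := Finset.mem_map.1 hy
      exact Finset.mem_range.2 (hlt x hx)
    omega

/-! ### Spanning paths and drawing of a table -/

theorem isSpanningPath (h : D.IsValid) {n v s t : ℕ} {l : List ℕ} (hl : D.IsPathFromTo n s t l)
    (hv : v ∉ l) (hn : n = ((Finset.range (D.p + 4)).erase v).card) :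
    IsSpanningPath (openLadder D.graph D.p) (D.p + 4) v s t l := by
  obtain ⟨hnd, hlen, hlt, hchain, hhead, hlast⟩ := hl
  have heq : l.toFinset = (Finset.range (D.p + 4)).erase v := by
    refine Finset.eq_of_subset_of_card_le (fun x hx => ?_) ?_
    · rw [List.mem_toFinset] at hx
      exact Finset.mem_erase.2 ⟨fun hxv => hv (hxv ▸ hx), Finset.mem_range.2 (hlt x hx)⟩
    · rw [← hn, List.toFinset_card_of_nodup hnd, hlen]
  refine ⟨hnd, fun x => ?_, hchain.imp fun x y hxy => ?_, hhead, hlast⟩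
  · rw [← List.mem_toFinset, heq, Finset.mem_erase, Finset.mem_range, and_comm]
  · refine openLadder_adj.2 (Or.inl ⟨(graph_adj h).2 hxy.1, ?_, ?_⟩) <;>
    · have := hxy.2
      simp only [List.mem_cons, Prod.mk.injEq, List.not_mem_nil, or_false, not_or] at this
      rw [Ne, Sym2.eq_iff]
      tauto

theorem hasSpanningPaths (h : D.IsValid) : HasSpanningPaths D.graph D.p 0 := by
  have hfull : ∀ {s t : ℕ} {l : List ℕ}, D.IsPathFromTo (D.p + 4) s t l →
      IsSpanningPath (openLadder D.graph D.p) (D.p + 4) (D.p + 4) s t l := fun hl =>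
    isSpanningPath h hl (fun hv => lt_irrefl _ (hl.2.2.1 _ hv)) (by
      rw [Finset.erase_eq_of_notMem Finset.notMem_range_self, Finset.card_range])
  refine ⟨fun v hv => ?_, ⟨_, hfull h.diag02⟩, ⟨_, hfull h.diag13⟩⟩
  have hcard : D.p + 3 = ((Finset.range (D.p + 4)).erase v).card := by
    rw [Finset.card_erase_of_mem (Finset.mem_range.2 hv), Finset.card_range]
    omega
  obtain ⟨hnot, hd | hd⟩ := h.detour v hv
  · exact Or.inl ⟨_, isSpanningPath h hd hnot hcard⟩
  · exact Or.inr ⟨_, isSpanningPath h hd hnot hcard⟩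

theorem isBaseDrawing (h : D.IsValid) :
    IsBaseDrawing D.graph (fun v => D.pts.getD v 0) D.p D.radius where
  pos := h.pts_lt.1
  box v hv := by
    rw [← h.pts_lt.2.1] at hv
    obtain ⟨h1, h2⟩ := h.pts_lt.2.2 _ (List.getElem_mem hv)
    rw [List.getD_eq_getElem _ _ hv, Int.abs_eq_natAbs, Int.abs_eq_natAbs]
    exact ⟨by exact_mod_cast h1, by exact_mod_cast h2⟩
  inj u hu v hv huv := by
    rw [← h.pts_lt.2.1] at hu hv
    simp only [List.getD_eq_getElem _ _ hu, List.getD_eq_getElem _ _ hv] at huv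
    exact (h.pts_nodup.getElem_inj_iff).1 huv
  apart {u v u' v'} huv huv' hne := by
    have hedge : ∀ {u v}, D.graph.Adj u v → (u, v) ∈ D.edges ∨ (v, u) ∈ D.edges := by
      have hlt : ∀ {u v}, D.graph.Adj u v → u < v → (u, v) ∈ D.edges := by
        intro u v huv hlt
        refine List.mem_flatMap.2 ⟨u, List.mem_range.2 (lt_of_adj h huv),
          List.mem_map.2 ⟨v, List.mem_filter.2 ⟨(graph_adj h).1 huv, by simpa using hlt⟩, rfl⟩⟩
      intro u v huv
      rcases huv.ne.lt_or_gt with hlt' | hlt'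
      exacts [Or.inl (hlt huv hlt'), Or.inr (hlt huv.symm hlt')]
    have hall : ∀ e ∈ D.edges, ∀ e' ∈ D.edges, e ≠ e' →
        MeetAtEnds (toPlane (D.pos e.1)) (toPlane (D.pos e.2)) (toPlane (D.pos e'.1))
          (toPlane (D.pos e'.2)) := by
      intro e he e' he'
      have : Std.Symm fun e e' : ℕ × ℕ => MeetAtEnds (toPlane (D.pos e.1)) (toPlane (D.pos e.2))
          (toPlane (D.pos e'.1)) (toPlane (D.pos e'.2)) := ⟨fun _ _ hs => hs.symm⟩
      have hpw : D.edges.Pairwise fun e e' => MeetAtEnds (toPlane (D.pos e.1)) (toPlane (D.pos e.2))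
          (toPlane (D.pos e'.1)) (toPlane (D.pos e'.2)) := h.edges_apart.imp fun hs => hs.meetAtEnds
      exact hpw.forall he he'
    have hs : ∀ {a b c d : ℕ}, s(a, b) ≠ s(c, d) → (a, b) ≠ (c, d) ∧ (a, b) ≠ (d, c) ∧
        (b, a) ≠ (c, d) ∧ (b, a) ≠ (d, c) := by
      intro a b c d hab
      rw [Ne, Sym2.eq_iff] at hab
      simp only [ne_eq, Prod.mk.injEq]
      tauto
    obtain ⟨h1, h2, h3, h4⟩ := hs hne
    change MeetAtEnds (toPlane (D.pos u)) (toPlane (D.pos v)) (toPlane (D.pos u'))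
      (toPlane (D.pos v'))
    rcases hedge huv with he | he <;> rcases hedge huv' with he' | he'
    · exact hall (u, v) he (u', v') he' h1
    · exact (hall (u, v) he (v', u') he' h2).swap_right
    · exact (hall (v, u) he (u', v') he' h3).swap_left
    · exact (hall (v, u) he (v', u') he' h4).swap_left.swap_right

end PlaneData

namespace PlaneData

variable {D : PlaneData}

/-- Every ladder over the graph of a valid table is planar and hypohamiltonian. -/
theorem exists_isPlanar_isHypohamiltonian (h : D.IsValid) (k : ℕ) :
    ∃ G : SimpleGraph (Fin (D.p + 4 * (k + 1))), IsPlanar G ∧ IsHypohamiltonian G := by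
  have hB := isLadderBase h
  have hpaths : ∀ k, HasSpanningPaths D.graph D.p k := fun k => by
    induction k with
    | zero => exact hasSpanningPaths h
    | succ k ih => exact ih.succ hB
  have hham := (hpaths k).isHamiltonian
  refine ⟨(closedLadder D.graph D.p k).comap Fin.val, ?_,
    not_isHamiltonian_closedLadder hB (not_isCircuit h) k, hham⟩
  -- a neighbour of `v` other than `w` is its successor on a Hamiltonian cycle missing `w`
  refine (isBaseDrawing h).isPlanar hB fun v w hvw => ?_
  obtain ⟨f, hf⟩ := (hham w).exists_isCircuit (by
    rw [Fintype.card_compl_set, Fintype.card_fin, Set.card_singleton]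
    have := h.quads_le.1
    omega)
  let v' : ({w}ᶜ : Set (Fin (D.p + 4 * (k + 1)))) := ⟨v, by simpa using hvw⟩
  exact ⟨(f v').1, (f v').2, hf.adj v'⟩

end PlaneData

/-! ### Four plane graphs -/

/-- A plane graph on 36 vertices whose faces are pentagons and seven quadrilaterals. -/
def base36 : PlaneData where
  p := 32
  faces := 25
  quads := 7
  radius := 50
  rot := [
    [(1, 0, 2), (34, 1, 0), (4, 2, 1)],
    [(0, 2, 0), (2, 3, 2), (35, 0, 3)],
    [(1, 2, 3), (4, 4, 2), (3, 3, 4)],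
    [(35, 3, 5), (2, 4, 3), (7, 7, 4), (5, 5, 7)],
    [(7, 4, 8), (2, 2, 4), (0, 1, 2), (6, 8, 1)],
    [(11, 9, 7), (10, 10, 9), (32, 5, 10), (3, 7, 5)],
    [(12, 11, 12), (15, 8, 11), (4, 1, 8), (34, 12, 1)],
    [(23, 13, 8), (18, 7, 13), (3, 4, 7), (4, 8, 4)],
    [(33, 14, 12), (13, 15, 14), (12, 12, 15)],
    [(10, 16, 10), (14, 14, 16), (33, 10, 14)],
    [(9, 10, 16), (5, 9, 10), (16, 16, 9)],
    [(18, 17, 7), (17, 9, 17), (5, 7, 9)],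
    [(6, 12, 11), (8, 15, 12), (19, 11, 15)],
    [(8, 14, 15), (14, 18, 14), (20, 15, 18)],
    [(22, 19, 16), (21, 18, 19), (13, 14, 18), (9, 16, 14)],
    [(24, 20, 11), (23, 8, 20), (6, 11, 8)],
    [(17, 21, 9), (22, 16, 21), (10, 9, 16)],
    [(11, 17, 9), (25, 21, 17), (16, 9, 21)],
    [(11, 7, 17), (7, 13, 7), (26, 17, 13)],
    [(20, 22, 15), (24, 11, 22), (12, 15, 11)],
    [(27, 22, 18), (19, 15, 22), (13, 18, 15)],
    [(14, 19, 18), (28, 23, 19), (27, 18, 23)],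
    [(16, 21, 16), (29, 19, 21), (14, 16, 19)],
    [(15, 20, 8), (30, 13, 20), (7, 8, 13)],
    [(15, 11, 20), (19, 22, 11), (31, 20, 22)],
    [(26, 24, 17), (29, 21, 24), (17, 17, 21)],
    [(30, 24, 13), (25, 17, 24), (18, 13, 17)],
    [(20, 18, 22), (21, 23, 18), (31, 22, 23)],
    [(30, 23, 24), (21, 19, 23), (29, 24, 19)],
    [(25, 24, 21), (28, 19, 24), (22, 21, 19)],
    [(28, 24, 23), (26, 13, 24), (23, 20, 13), (31, 23, 20)],
    [(30, 20, 23), (24, 22, 20), (27, 23, 22)],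
    [(33, 6, 10), (35, 5, 6), (5, 10, 5)],
    [(9, 14, 10), (8, 12, 14), (34, 6, 12), (32, 10, 6)],
    [(6, 1, 12), (0, 0, 1), (35, 6, 0), (33, 12, 6)],
    [(34, 0, 6), (1, 3, 0), (3, 5, 3), (32, 6, 5)]]
  clusters := [[0], [2], [3], [0, 2], [0, 3], [2, 3]]
  pts := [
    (-14, -38), (15, -38), (9, -27), (19, -19), (-8, -25), (17, 14), (-26, -21), (0, -13),
    (-35, 23), (-25, 29), (-5, 19), (4, 8), (-28, 2), (-26, 16), (-20, 17), (-19, -10), (-7, 14),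
    (-3, 10), (-1, -1), (-24, 3), (-23, 9), (-18, 10), (-13, 13), (-10, -7), (-20, -2), (-7, 7),
    (-6, 2), (-19, 7), (-14, 7), (-11, 9), (-12, 1), (-17, 2)]
  detours := [
    [32, 35, 1, 2, 4, 7, 3, 5, 10, 9, 14, 22, 16, 17, 11, 18, 26, 25, 29, 28, 21, 27, 31, 30,
      23, 15, 24, 19, 20, 13, 8, 12, 6, 34, 33],
    [32, 35, 3, 2, 4, 0, 34, 6, 12, 19, 20, 27, 21, 28, 30, 31, 24, 15, 23, 7, 18, 26, 25, 29,
      22, 16, 17, 11, 5, 10, 9, 14, 13, 8, 33],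
    [32, 35, 1, 0, 4, 7, 3, 5, 10, 9, 14, 22, 16, 17, 11, 18, 26, 25, 29, 28, 21, 27, 31, 30,
      23, 15, 24, 19, 20, 13, 8, 12, 6, 34, 33],
    [32, 35, 1, 2, 4, 0, 34, 6, 12, 19, 20, 27, 21, 28, 30, 31, 24, 15, 23, 7, 18, 26, 25, 29,
      22, 16, 17, 11, 5, 10, 9, 14, 13, 8, 33],
    [32, 35, 3, 2, 1, 0, 34, 6, 12, 19, 20, 27, 21, 28, 30, 31, 24, 15, 23, 7, 18, 26, 25, 29,
      22, 16, 17, 11, 5, 10, 9, 14, 13, 8, 33],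
    [32, 35, 3, 2, 1, 0, 34, 6, 4, 7, 18, 11, 17, 25, 26, 30, 23, 15, 24, 31, 27, 21, 28, 29,
      22, 16, 10, 9, 14, 13, 20, 19, 12, 8, 33],
    [34, 33, 9, 10, 16, 22, 29, 28, 21, 14, 13, 8, 12, 19, 20, 27, 31, 24, 15, 23, 30, 26, 25,
      17, 11, 18, 7, 4, 0, 1, 2, 3, 5, 32, 35],
    [32, 35, 1, 0, 4, 2, 3, 5, 11, 18, 26, 25, 17, 16, 10, 9, 14, 22, 29, 28, 21, 27, 20, 13, 8,
      12, 19, 24, 31, 30, 23, 15, 6, 34, 33],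
    [32, 35, 3, 5, 11, 17, 25, 26, 18, 7, 4, 2, 1, 0, 34, 6, 12, 19, 20, 13, 14, 21, 27, 31, 24,
      15, 23, 30, 28, 29, 22, 16, 10, 9, 33],
    [32, 35, 1, 0, 34, 6, 12, 19, 20, 27, 21, 28, 30, 31, 24, 15, 23, 7, 4, 2, 3, 5, 10, 16, 17,
      11, 18, 26, 25, 29, 22, 14, 13, 8, 33],
    [32, 35, 1, 0, 34, 6, 4, 2, 3, 5, 11, 17, 16, 22, 29, 25, 26, 18, 7, 23, 15, 24, 31, 30, 28,
      21, 27, 20, 19, 12, 8, 13, 14, 9, 33],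
    [32, 35, 3, 5, 10, 16, 17, 25, 26, 18, 7, 4, 2, 1, 0, 34, 6, 12, 8, 13, 20, 19, 24, 15, 23,
      30, 31, 27, 21, 28, 29, 22, 14, 9, 33],
    [32, 35, 3, 5, 10, 9, 14, 22, 16, 17, 11, 18, 7, 4, 2, 1, 0, 34, 6, 15, 23, 30, 26, 25, 29,
      28, 21, 27, 31, 24, 19, 20, 13, 8, 33],
    [32, 35, 3, 2, 1, 0, 34, 6, 4, 7, 18, 26, 25, 29, 22, 16, 17, 11, 5, 10, 9, 14, 21, 28, 30,
      23, 15, 24, 31, 27, 20, 19, 12, 8, 33],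
    [32, 35, 3, 5, 11, 17, 25, 26, 18, 7, 4, 2, 1, 0, 34, 6, 12, 8, 13, 20, 19, 24, 15, 23, 30,
      31, 27, 21, 28, 29, 22, 16, 10, 9, 33],
    [32, 35, 1, 0, 34, 6, 12, 19, 24, 31, 30, 23, 7, 4, 2, 3, 5, 10, 9, 14, 22, 16, 17, 11, 18,
      26, 25, 29, 28, 21, 27, 20, 13, 8, 33],
    [32, 35, 3, 7, 18, 26, 25, 17, 11, 5, 10, 9, 14, 22, 29, 28, 21, 27, 31, 30, 23, 15, 24, 19,
      20, 13, 8, 12, 6, 4, 2, 1, 0, 34, 33],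
    [32, 35, 3, 7, 4, 2, 1, 0, 34, 6, 12, 8, 13, 20, 19, 24, 15, 23, 30, 31, 27, 21, 28, 29, 25,
      26, 18, 11, 5, 10, 16, 22, 14, 9, 33],
    [32, 35, 1, 2, 3, 5, 11, 17, 16, 10, 9, 14, 22, 29, 25, 26, 30, 28, 21, 27, 31, 24, 19, 20,
      13, 8, 12, 6, 15, 23, 7, 4, 0, 34, 33],
    [32, 35, 3, 5, 10, 9, 14, 22, 16, 17, 11, 18, 26, 25, 29, 28, 21, 27, 20, 13, 8, 12, 6, 15,
      24, 31, 30, 23, 7, 4, 2, 1, 0, 34, 33],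
    [32, 35, 3, 2, 1, 0, 34, 6, 4, 7, 23, 15, 24, 19, 12, 8, 13, 14, 21, 27, 31, 30, 28, 29, 22,
      16, 17, 25, 26, 18, 11, 5, 10, 9, 33],
    [32, 35, 1, 0, 34, 6, 12, 19, 24, 15, 23, 7, 4, 2, 3, 5, 10, 9, 14, 22, 16, 17, 11, 18, 26,
      25, 29, 28, 30, 31, 27, 20, 13, 8, 33],
    [32, 35, 3, 2, 1, 0, 34, 6, 4, 7, 23, 15, 24, 31, 30, 26, 18, 11, 5, 10, 16, 17, 25, 29, 28,
      21, 27, 20, 19, 12, 8, 13, 14, 9, 33],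
    [32, 35, 3, 7, 18, 26, 25, 29, 22, 16, 17, 11, 5, 10, 9, 14, 21, 28, 30, 31, 27, 20, 13, 8,
      12, 19, 24, 15, 6, 4, 2, 1, 0, 34, 33],
    [32, 35, 3, 5, 11, 17, 25, 26, 18, 7, 4, 2, 1, 0, 34, 6, 15, 23, 30, 31, 27, 20, 19, 12, 8,
      13, 14, 21, 28, 29, 22, 16, 10, 9, 33],
    [32, 35, 1, 0, 4, 2, 3, 5, 11, 17, 16, 10, 9, 14, 22, 29, 28, 21, 27, 31, 30, 26, 18, 7, 23,
      15, 24, 19, 20, 13, 8, 12, 6, 34, 33],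
    [32, 35, 1, 0, 34, 6, 4, 2, 3, 5, 11, 18, 7, 23, 15, 24, 31, 30, 28, 21, 27, 20, 19, 12, 8,
      13, 14, 22, 29, 25, 17, 16, 10, 9, 33],
    [34, 33, 9, 10, 16, 17, 11, 18, 26, 25, 29, 22, 14, 21, 28, 30, 31, 24, 19, 20, 13, 8, 12,
      6, 15, 23, 7, 4, 0, 1, 2, 3, 5, 32, 35],
    [32, 35, 1, 0, 34, 6, 12, 8, 13, 20, 19, 24, 15, 23, 30, 31, 27, 21, 14, 22, 29, 25, 26, 18,
      7, 4, 2, 3, 5, 11, 17, 16, 10, 9, 33],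
    [32, 35, 1, 0, 34, 6, 4, 2, 3, 5, 11, 17, 25, 26, 18, 7, 23, 15, 24, 31, 30, 28, 21, 27, 20,
      19, 12, 8, 13, 14, 22, 16, 10, 9, 33],
    [32, 5, 11, 18, 26, 25, 17, 16, 10, 9, 14, 22, 29, 28, 21, 27, 31, 24, 19, 20, 13, 8, 12, 6,
      15, 23, 7, 3, 35, 1, 2, 4, 0, 34, 33],
    [32, 35, 3, 5, 10, 9, 14, 22, 16, 17, 11, 18, 7, 23, 30, 26, 25, 29, 28, 21, 27, 20, 13, 8,
      12, 19, 24, 15, 6, 4, 2, 1, 0, 34, 33],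
    [34, 33, 8, 12, 6, 15, 23, 7, 18, 11, 17, 16, 22, 29, 25, 26, 30, 28, 21, 27, 31, 24, 19,
      20, 13, 14, 9, 10, 5, 3, 2, 4, 0, 1, 35],
    [34, 0, 1, 2, 3, 7, 4, 6, 12, 8, 13, 20, 19, 24, 15, 23, 30, 31, 27, 21, 28, 29, 25, 26, 18,
      11, 17, 16, 22, 14, 9, 10, 5, 32, 35],
    [32, 35, 3, 2, 1, 0, 4, 6, 12, 19, 20, 27, 21, 28, 30, 31, 24, 15, 23, 7, 18, 26, 25, 29,
      22, 16, 17, 11, 5, 10, 9, 14, 13, 8, 33],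
    [32, 5, 3, 2, 1, 0, 34, 6, 4, 7, 18, 11, 17, 25, 26, 30, 23, 15, 24, 31, 27, 20, 19, 12, 8,
      13, 14, 21, 28, 29, 22, 16, 10, 9, 33]]
  diag02 := [
    32, 5, 10, 16, 22, 29, 28, 21, 27, 31, 30, 26, 25, 17, 11, 18, 7, 23, 15, 24, 19, 20, 13, 14,
    9, 33, 8, 12, 6, 4, 2, 3, 35, 1, 0, 34]
  diag13 := [
    33, 9, 10, 16, 22, 29, 28, 21, 14, 13, 8, 12, 19, 20, 27, 31, 24, 15, 23, 30, 26, 25, 17, 11,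
    18, 7, 4, 6, 34, 0, 1, 2, 3, 5, 32, 35]

set_option maxRecDepth 10000 in
theorem base36_isValid : base36.IsValid where
  nodup := by decide +kernel
  ne_nil := by decide +kernel
  length_rot := by decide +kernel
  symm := by decide +kernel
  corner := by decide +kernel
  face_lt := by decide +kernel
  card_face := by decide +kernel
  euler := by decide +kernel
  quads_le := by decide +kernel
  coloring := by decide +kernel
  terminals := by decide +kernel
  pts_lt := by decide +kernel
  pts_nodup := by decide +kernel
  edges_apart := by decide +kernel
  detour := by decide +kernel
  diag02 := by decide +kernel
  diag13 := by decide +kernel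

/-- A plane graph on 38 vertices whose faces are pentagons and nine quadrilaterals. -/
def base38 : PlaneData where
  p := 34
  faces := 27
  quads := 9
  radius := 50
  rot := [
    [(3, 0, 2), (2, 1, 0), (36, 2, 1)],
    [(3, 2, 4), (36, 3, 2), (6, 4, 3)],
    [(0, 0, 1), (4, 5, 0), (37, 1, 5)],
    [(4, 0, 6), (0, 2, 0), (1, 4, 2), (7, 6, 4)],
    [(2, 0, 5), (3, 6, 0), (5, 5, 6)],
    [(37, 5, 7), (4, 6, 5), (7, 9, 6), (8, 7, 9)],
    [(7, 4, 10), (1, 3, 4), (9, 10, 3)],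
    [(25, 11, 10), (20, 9, 11), (5, 6, 9), (3, 4, 6), (6, 10, 4)],
    [(13, 12, 9), (12, 13, 12), (34, 7, 13), (5, 9, 7)],
    [(15, 14, 15), (17, 10, 14), (6, 3, 10), (36, 15, 3)],
    [(15, 15, 17), (35, 16, 15), (14, 17, 16)],
    [(35, 13, 16), (12, 18, 13), (16, 16, 18)],
    [(18, 18, 12), (11, 13, 18), (8, 12, 13)],
    [(20, 19, 9), (19, 12, 19), (8, 9, 12)],
    [(16, 20, 16), (21, 17, 20), (10, 16, 17)],
    [(10, 17, 15), (22, 14, 17), (9, 15, 14)],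
    [(24, 21, 18), (23, 20, 21), (14, 16, 20), (11, 18, 16)],
    [(26, 22, 14), (25, 10, 22), (9, 14, 10)],
    [(12, 12, 18), (19, 23, 12), (24, 18, 23)],
    [(27, 23, 19), (18, 12, 23), (13, 19, 12)],
    [(28, 19, 11), (13, 9, 19), (7, 11, 9)],
    [(29, 24, 20), (22, 17, 24), (14, 20, 17)],
    [(21, 24, 17), (26, 14, 24), (15, 17, 14)],
    [(16, 21, 20), (30, 25, 21), (29, 20, 25)],
    [(16, 18, 21), (18, 23, 18), (31, 21, 23)],
    [(7, 10, 11), (17, 22, 10), (32, 11, 22)],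
    [(22, 24, 14), (33, 22, 24), (17, 14, 22)],
    [(28, 26, 19), (31, 23, 26), (19, 19, 23)],
    [(27, 19, 26), (20, 11, 19), (32, 26, 11)],
    [(33, 24, 25), (21, 20, 24), (23, 25, 20)],
    [(23, 21, 25), (31, 26, 21), (32, 25, 26)],
    [(27, 26, 23), (30, 21, 26), (24, 23, 21)],
    [(30, 26, 25), (28, 11, 26), (25, 22, 11), (33, 25, 22)],
    [(26, 24, 22), (29, 25, 24), (32, 22, 25)],
    [(35, 8, 13), (37, 7, 8), (8, 13, 7)],
    [(11, 16, 13), (10, 15, 16), (36, 8, 15), (34, 13, 8)],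
    [(9, 3, 15), (1, 2, 3), (0, 1, 2), (37, 8, 1), (35, 15, 8)],
    [(36, 1, 8), (2, 5, 1), (5, 7, 5), (34, 8, 7)]]
  clusters := [[0], [1], [2], [5], [0, 2], [0, 5], [1, 5], [0, 2, 5], [1, 2, 5]]
  pts := [
    (-16, -41), (-29, -36), (13, -41), (-12, -32), (5, -32), (15, -22), (-23, -26), (-9, -19),
    (14, 12), (-33, -22), (-38, 22), (-27, 28), (-8, 17), (0, 5), (-30, 15), (-33, 0), (-24, 15),
    (-25, -12), (-11, 12), (-7, 7), (-7, -5), (-27, 7), (-29, 1), (-22, 8), (-17, 11),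
    (-17, -11), (-25, -4), (-12, 4), (-12, -1), (-24, 5), (-18, 4), (-16, 6), (-17, -2), (-22, 0)]
  detours := [
    [34, 37, 2, 4, 3, 1, 6, 7, 5, 8, 12, 11, 16, 24, 18, 19, 13, 20, 28, 27, 31, 30, 23, 29, 33,
      32, 25, 17, 26, 22, 21, 14, 10, 15, 9, 36, 35],
    [34, 8, 12, 11, 16, 24, 18, 19, 13, 20, 28, 27, 31, 30, 23, 29, 33, 32, 25, 17, 26, 22, 21,
      14, 10, 15, 9, 6, 7, 3, 4, 5, 37, 2, 0, 36, 35],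
    [34, 37, 5, 4, 3, 0, 36, 1, 6, 7, 20, 28, 27, 31, 24, 18, 19, 13, 8, 12, 11, 16, 23, 30, 32,
      25, 17, 9, 15, 22, 26, 33, 29, 21, 14, 10, 35],
    [34, 37, 5, 4, 2, 0, 36, 1, 6, 7, 20, 28, 27, 31, 24, 18, 19, 13, 8, 12, 11, 16, 23, 30, 32,
      25, 17, 9, 15, 22, 26, 33, 29, 21, 14, 10, 35],
    [34, 37, 2, 0, 3, 1, 6, 7, 5, 8, 12, 11, 16, 24, 18, 19, 13, 20, 28, 27, 31, 30, 23, 29, 33,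
      32, 25, 17, 26, 22, 21, 14, 10, 15, 9, 36, 35],
    [34, 37, 2, 4, 3, 0, 36, 1, 6, 7, 20, 28, 27, 31, 24, 18, 19, 13, 8, 12, 11, 16, 23, 30, 32,
      25, 17, 9, 15, 22, 26, 33, 29, 21, 14, 10, 35],
    [34, 37, 2, 0, 36, 1, 3, 4, 5, 7, 20, 28, 27, 31, 24, 18, 19, 13, 8, 12, 11, 16, 23, 30, 32,
      25, 17, 9, 15, 22, 26, 33, 29, 21, 14, 10, 35],
    [34, 37, 2, 4, 5, 8, 12, 11, 16, 24, 18, 19, 13, 20, 28, 27, 31, 30, 23, 29, 33, 32, 25, 17,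
      26, 22, 21, 14, 10, 15, 9, 6, 1, 3, 0, 36, 35],
    [34, 37, 5, 4, 2, 0, 36, 9, 6, 1, 3, 7, 20, 13, 19, 27, 28, 32, 25, 17, 26, 33, 29, 23, 30,
      31, 24, 18, 12, 11, 16, 14, 21, 22, 15, 10, 35],
    [34, 8, 5, 37, 2, 4, 3, 0, 36, 1, 6, 7, 25, 17, 26, 33, 29, 21, 22, 15, 10, 14, 16, 23, 30,
      32, 28, 20, 13, 19, 27, 31, 24, 18, 12, 11, 35],
    [34, 8, 5, 37, 2, 4, 3, 0, 36, 1, 6, 7, 25, 32, 30, 23, 29, 33, 26, 17, 9, 15, 22, 21, 14,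
      16, 24, 31, 27, 28, 20, 13, 19, 18, 12, 11, 35],
    [34, 37, 2, 0, 36, 1, 6, 9, 15, 22, 21, 29, 23, 30, 32, 33, 26, 17, 25, 7, 3, 4, 5, 8, 12,
      18, 19, 13, 20, 28, 27, 31, 24, 16, 14, 10, 35],
    [34, 37, 2, 0, 36, 1, 6, 7, 3, 4, 5, 8, 13, 20, 28, 27, 19, 18, 24, 31, 30, 23, 29, 21, 22,
      26, 33, 32, 25, 17, 9, 15, 10, 14, 16, 11, 35],
    [34, 37, 2, 0, 3, 4, 5, 8, 12, 18, 19, 27, 28, 20, 7, 6, 1, 36, 9, 15, 10, 14, 21, 22, 26,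
      17, 25, 32, 33, 29, 23, 30, 31, 24, 16, 11, 35],
    [34, 37, 2, 0, 36, 1, 6, 7, 3, 4, 5, 8, 12, 11, 16, 24, 18, 19, 13, 20, 28, 27, 31, 30, 23,
      29, 21, 22, 26, 33, 32, 25, 17, 9, 15, 10, 35],
    [34, 37, 5, 4, 2, 0, 36, 1, 3, 7, 6, 9, 17, 25, 32, 33, 26, 22, 21, 29, 23, 30, 31, 24, 18,
      19, 27, 28, 20, 13, 8, 12, 11, 16, 14, 10, 35],
    [34, 37, 5, 4, 2, 0, 36, 1, 3, 7, 6, 9, 15, 10, 14, 21, 22, 26, 17, 25, 32, 33, 29, 23, 30,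
      31, 24, 18, 19, 27, 28, 20, 13, 8, 12, 11, 35],
    [34, 37, 2, 0, 36, 1, 6, 9, 15, 22, 26, 33, 32, 25, 7, 3, 4, 5, 8, 12, 11, 16, 24, 18, 19,
      13, 20, 28, 27, 31, 30, 23, 29, 21, 14, 10, 35],
    [34, 37, 5, 7, 20, 28, 27, 19, 13, 8, 12, 11, 16, 24, 31, 30, 23, 29, 33, 32, 25, 17, 26,
      22, 21, 14, 10, 15, 9, 6, 1, 3, 4, 2, 0, 36, 35],
    [34, 37, 5, 4, 2, 0, 36, 1, 3, 7, 6, 9, 15, 10, 14, 21, 22, 26, 17, 25, 32, 33, 29, 23, 30,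
      31, 27, 28, 20, 13, 8, 12, 18, 24, 16, 11, 35],
    [34, 37, 5, 8, 13, 19, 18, 12, 11, 16, 24, 31, 27, 28, 32, 30, 23, 29, 33, 26, 22, 21, 14,
      10, 15, 9, 17, 25, 7, 6, 1, 3, 4, 2, 0, 36, 35],
    [34, 37, 5, 4, 2, 0, 36, 9, 6, 1, 3, 7, 25, 17, 26, 22, 15, 10, 14, 16, 23, 29, 33, 32, 30,
      31, 24, 18, 19, 27, 28, 20, 13, 8, 12, 11, 35],
    [34, 37, 5, 8, 12, 11, 16, 24, 18, 19, 13, 20, 28, 27, 31, 30, 23, 29, 21, 14, 10, 15, 9,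
      17, 26, 33, 32, 25, 7, 6, 1, 3, 4, 2, 0, 36, 35],
    [34, 37, 2, 0, 36, 9, 15, 22, 26, 17, 25, 7, 6, 1, 3, 4, 5, 8, 12, 11, 16, 24, 18, 19, 13,
      20, 28, 27, 31, 30, 32, 33, 29, 21, 14, 10, 35],
    [34, 37, 2, 0, 36, 1, 6, 7, 3, 4, 5, 8, 12, 18, 19, 13, 20, 28, 27, 31, 30, 23, 29, 21, 22,
      26, 33, 32, 25, 17, 9, 15, 10, 14, 16, 11, 35],
    [34, 37, 5, 7, 20, 28, 27, 31, 24, 18, 19, 13, 8, 12, 11, 16, 23, 30, 32, 33, 29, 21, 14,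
      10, 15, 22, 26, 17, 9, 6, 1, 3, 4, 2, 0, 36, 35],
    [34, 37, 2, 0, 36, 1, 6, 7, 3, 4, 5, 8, 12, 11, 16, 24, 18, 19, 13, 20, 28, 27, 31, 30, 23,
      29, 33, 32, 25, 17, 9, 15, 22, 21, 14, 10, 35],
    [34, 37, 5, 8, 13, 19, 18, 12, 11, 16, 24, 31, 30, 23, 29, 33, 32, 28, 20, 7, 25, 17, 26,
      22, 21, 14, 10, 15, 9, 6, 1, 3, 4, 2, 0, 36, 35],
    [34, 37, 2, 0, 36, 9, 6, 1, 3, 4, 5, 8, 13, 20, 7, 25, 17, 26, 33, 32, 30, 23, 29, 21, 22,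
      15, 10, 14, 16, 24, 31, 27, 19, 18, 12, 11, 35],
    [34, 8, 5, 37, 2, 4, 3, 0, 36, 1, 6, 7, 25, 17, 9, 15, 10, 14, 21, 22, 26, 33, 32, 30, 23,
      16, 24, 31, 27, 28, 20, 13, 19, 18, 12, 11, 35],
    [34, 37, 2, 0, 36, 9, 15, 10, 14, 21, 22, 26, 17, 25, 32, 33, 29, 23, 16, 24, 31, 27, 28,
      20, 7, 6, 1, 3, 4, 5, 8, 13, 19, 18, 12, 11, 35],
    [34, 37, 2, 0, 36, 9, 6, 1, 3, 4, 5, 8, 13, 19, 27, 28, 20, 7, 25, 17, 26, 33, 32, 30, 23,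
      29, 21, 22, 15, 10, 14, 16, 24, 18, 12, 11, 35],
    [34, 37, 5, 8, 13, 20, 28, 27, 19, 18, 12, 11, 16, 24, 31, 30, 23, 29, 33, 26, 22, 21, 14,
      10, 15, 9, 17, 25, 7, 6, 1, 3, 4, 2, 0, 36, 35],
    [34, 37, 5, 7, 25, 32, 30, 31, 24, 18, 19, 27, 28, 20, 13, 8, 12, 11, 16, 23, 29, 21, 14,
      10, 15, 22, 26, 17, 9, 6, 1, 3, 4, 2, 0, 36, 35],
    [36, 1, 6, 9, 15, 22, 21, 29, 33, 26, 17, 25, 32, 30, 23, 16, 14, 10, 35, 11, 12, 8, 13, 19,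
      18, 24, 31, 27, 28, 20, 7, 5, 4, 3, 0, 2, 37],
    [36, 1, 3, 0, 2, 4, 5, 7, 6, 9, 15, 10, 14, 21, 22, 26, 17, 25, 32, 33, 29, 23, 30, 31, 27,
      28, 20, 13, 19, 18, 24, 16, 11, 12, 8, 34, 37],
    [34, 37, 5, 4, 2, 0, 3, 1, 6, 7, 20, 28, 27, 31, 24, 18, 19, 13, 8, 12, 11, 16, 23, 30, 32,
      25, 17, 9, 15, 22, 26, 33, 29, 21, 14, 10, 35],
    [34, 8, 12, 11, 16, 24, 18, 19, 13, 20, 28, 27, 31, 30, 23, 29, 33, 32, 25, 17, 26, 22, 21,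
      14, 10, 15, 9, 6, 7, 5, 4, 2, 0, 3, 1, 36, 35]]
  diag02 := [
    34, 8, 12, 11, 35, 10, 14, 21, 29, 33, 26, 22, 15, 9, 17, 25, 32, 28, 27, 31, 30, 23, 16, 24,
    18, 19, 13, 20, 7, 6, 1, 3, 4, 5, 37, 2, 0, 36]
  diag13 := [
    35, 36, 1, 3, 0, 2, 4, 5, 7, 6, 9, 15, 10, 14, 21, 22, 26, 17, 25, 32, 33, 29, 23, 30, 31,
    27, 28, 20, 13, 19, 18, 24, 16, 11, 12, 8, 34, 37]

set_option maxRecDepth 10000 in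
theorem base38_isValid : base38.IsValid where
  nodup := by decide +kernel
  ne_nil := by decide +kernel
  length_rot := by decide +kernel
  symm := by decide +kernel
  corner := by decide +kernel
  face_lt := by decide +kernel
  card_face := by decide +kernel
  euler := by decide +kernel
  quads_le := by decide +kernel
  coloring := by decide +kernel
  terminals := by decide +kernel
  pts_lt := by decide +kernel
  pts_nodup := by decide +kernel
  edges_apart := by decide +kernel
  detour := by decide +kernel
  diag02 := by decide +kernel
  diag13 := by decide +kernel

/-- A plane graph on 39 vertices whose faces are pentagons and seven quadrilaterals. -/
def base39 : PlaneData where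
  p := 35
  faces := 27
  quads := 7
  radius := 50
  rot := [
    [(1, 0, 2), (37, 1, 0), (3, 2, 1)],
    [(38, 0, 4), (0, 2, 0), (2, 3, 2), (5, 4, 3)],
    [(1, 2, 3), (3, 5, 2), (4, 3, 5)],
    [(7, 5, 7), (2, 2, 5), (0, 1, 2), (6, 7, 1)],
    [(5, 3, 8), (2, 5, 3), (7, 8, 5)],
    [(11, 9, 8), (10, 10, 9), (35, 4, 10), (1, 3, 4), (4, 8, 3)],
    [(13, 11, 12), (15, 7, 11), (3, 1, 7), (37, 12, 1)],
    [(23, 13, 7), (18, 8, 13), (4, 5, 8), (3, 7, 5)],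
    [(13, 12, 15), (36, 14, 12), (12, 15, 14)],
    [(14, 14, 16), (36, 10, 14), (10, 16, 10)],
    [(5, 9, 10), (16, 16, 9), (9, 10, 16)],
    [(18, 17, 8), (17, 9, 17), (5, 8, 9)],
    [(14, 18, 14), (19, 15, 18), (8, 14, 15)],
    [(20, 11, 15), (6, 12, 11), (8, 15, 12)],
    [(22, 18, 19), (12, 14, 18), (9, 16, 14), (21, 19, 16)],
    [(6, 11, 7), (24, 20, 11), (23, 7, 20)],
    [(21, 16, 21), (10, 9, 16), (17, 21, 9)],
    [(25, 21, 17), (16, 9, 21), (11, 17, 9)],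
    [(7, 13, 8), (27, 22, 13), (26, 17, 22), (11, 8, 17)],
    [(28, 23, 18), (20, 15, 23), (12, 18, 15)],
    [(19, 23, 15), (24, 11, 23), (13, 15, 11)],
    [(16, 21, 16), (29, 19, 21), (14, 16, 19)],
    [(14, 19, 18), (30, 24, 19), (28, 18, 24)],
    [(31, 13, 20), (7, 7, 13), (15, 20, 7)],
    [(15, 11, 20), (20, 23, 11), (32, 20, 23)],
    [(29, 21, 25), (17, 17, 21), (26, 25, 17)],
    [(18, 22, 17), (33, 25, 22), (25, 17, 25)],
    [(34, 22, 26), (18, 13, 22), (31, 26, 13)],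
    [(34, 26, 24), (32, 23, 26), (19, 18, 23), (22, 24, 18)],
    [(21, 21, 19), (25, 25, 21), (30, 19, 25)],
    [(33, 24, 25), (22, 19, 24), (29, 25, 19)],
    [(27, 13, 26), (23, 20, 13), (32, 26, 20)],
    [(24, 23, 20), (28, 26, 23), (31, 20, 26)],
    [(30, 25, 24), (26, 22, 25), (34, 24, 22)],
    [(27, 26, 22), (28, 24, 26), (33, 22, 24)],
    [(38, 4, 6), (5, 10, 4), (36, 6, 10)],
    [(9, 14, 10), (8, 12, 14), (37, 6, 12), (35, 10, 6)],
    [(6, 1, 12), (0, 0, 1), (38, 6, 0), (36, 12, 6)],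
    [(1, 4, 0), (35, 6, 4), (37, 0, 6)]]
  clusters := [[0], [2], [0, 2]]
  pts := [
    (-13, -36), (25, -22), (4, -15), (-19, -21), (18, 2), (34, 16), (-41, -27), (-1, -9),
    (-47, 24), (-22, 39), (6, 27), (22, 10), (-35, 22), (-44, -1), (-23, 28), (-30, -19),
    (0, 20), (11, 14), (10, 1), (-32, 12), (-33, 1), (-12, 24), (-21, 18), (-16, -14), (-29, -9),
    (2, 15), (3, 7), (-1, 0), (-22, 8), (-6, 18), (-13, 15), (-11, -5), (-22, -1), (-5, 9),
    (-12, 5)]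
  detours := [
    [35, 38, 1, 2, 3, 7, 4, 5, 10, 9, 14, 21, 16, 17, 11, 18, 27, 34, 33, 26, 25, 29, 30, 22,
      28, 32, 31, 23, 15, 24, 20, 19, 12, 8, 13, 6, 37, 36],
    [37, 0, 3, 2, 4, 7, 18, 11, 17, 16, 21, 14, 22, 30, 29, 25, 26, 33, 34, 27, 31, 23, 15, 6,
      13, 20, 24, 32, 28, 19, 12, 8, 36, 9, 10, 5, 35, 38],
    [35, 38, 1, 0, 3, 7, 4, 5, 10, 9, 14, 21, 16, 17, 11, 18, 27, 34, 33, 26, 25, 29, 30, 22,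
      28, 32, 31, 23, 15, 24, 20, 19, 12, 8, 13, 6, 37, 36],
    [37, 0, 1, 2, 4, 7, 18, 11, 17, 16, 21, 14, 22, 30, 29, 25, 26, 33, 34, 27, 31, 23, 15, 6,
      13, 20, 24, 32, 28, 19, 12, 8, 36, 9, 10, 5, 35, 38],
    [35, 38, 1, 2, 3, 0, 37, 6, 13, 20, 19, 28, 22, 30, 33, 34, 27, 31, 32, 24, 15, 23, 7, 18,
      26, 25, 29, 21, 16, 17, 11, 5, 10, 9, 14, 12, 8, 36],
    [35, 38, 1, 0, 37, 6, 3, 2, 4, 7, 18, 11, 17, 25, 26, 33, 34, 27, 31, 23, 15, 24, 32, 28,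
      19, 20, 13, 8, 12, 14, 22, 30, 29, 21, 16, 10, 9, 36],
    [37, 36, 9, 10, 16, 21, 29, 30, 22, 14, 12, 8, 13, 20, 19, 28, 32, 24, 15, 23, 31, 27, 34,
      33, 26, 25, 17, 11, 18, 7, 3, 0, 1, 2, 4, 5, 35, 38],
    [35, 38, 1, 2, 4, 5, 10, 9, 14, 21, 16, 17, 11, 18, 27, 34, 33, 26, 25, 29, 30, 22, 28, 32,
      31, 23, 15, 24, 20, 19, 12, 8, 13, 6, 3, 0, 37, 36],
    [35, 38, 1, 2, 4, 5, 11, 17, 25, 26, 18, 27, 31, 32, 24, 15, 23, 7, 3, 0, 37, 6, 13, 20, 19,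
      12, 14, 22, 28, 34, 33, 30, 29, 21, 16, 10, 9, 36],
    [35, 38, 1, 0, 37, 6, 13, 20, 19, 28, 22, 30, 33, 34, 27, 31, 32, 24, 15, 23, 7, 3, 2, 4, 5,
      10, 16, 17, 11, 18, 26, 25, 29, 21, 14, 12, 8, 36],
    [35, 38, 1, 0, 37, 6, 3, 2, 4, 5, 11, 17, 16, 21, 29, 25, 26, 18, 7, 23, 15, 24, 32, 31, 27,
      34, 33, 30, 22, 28, 19, 20, 13, 8, 12, 14, 9, 36],
    [35, 38, 1, 2, 4, 5, 10, 16, 17, 25, 26, 33, 34, 27, 18, 7, 3, 0, 37, 6, 13, 8, 12, 19, 20,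
      24, 15, 23, 31, 32, 28, 22, 30, 29, 21, 14, 9, 36],
    [35, 38, 1, 0, 37, 6, 3, 2, 4, 5, 10, 9, 14, 21, 16, 17, 11, 18, 7, 23, 15, 24, 32, 31, 27,
      34, 33, 26, 25, 29, 30, 22, 28, 19, 20, 13, 8, 36],
    [35, 38, 1, 2, 4, 5, 10, 9, 14, 21, 16, 17, 11, 18, 7, 3, 0, 37, 6, 15, 23, 31, 27, 34, 33,
      26, 25, 29, 30, 22, 28, 32, 24, 20, 19, 12, 8, 36],
    [35, 38, 1, 2, 4, 5, 11, 17, 25, 26, 33, 34, 27, 18, 7, 3, 0, 37, 6, 13, 8, 12, 19, 20, 24,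
      15, 23, 31, 32, 28, 22, 30, 29, 21, 16, 10, 9, 36],
    [35, 38, 1, 0, 37, 6, 13, 20, 24, 32, 31, 23, 7, 3, 2, 4, 5, 10, 9, 14, 21, 16, 17, 11, 18,
      27, 34, 33, 26, 25, 29, 30, 22, 28, 19, 12, 8, 36],
    [35, 38, 1, 0, 3, 2, 4, 7, 18, 27, 34, 33, 26, 25, 17, 11, 5, 10, 9, 14, 21, 29, 30, 22, 28,
      32, 31, 23, 15, 24, 20, 19, 12, 8, 13, 6, 37, 36],
    [35, 38, 1, 2, 4, 7, 3, 0, 37, 6, 13, 8, 12, 19, 20, 24, 15, 23, 31, 32, 28, 22, 30, 29, 25,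
      26, 33, 34, 27, 18, 11, 5, 10, 16, 21, 14, 9, 36],
    [35, 38, 1, 5, 11, 17, 16, 10, 9, 14, 21, 29, 25, 26, 33, 30, 22, 28, 34, 27, 31, 32, 24,
      20, 19, 12, 8, 13, 6, 15, 23, 7, 4, 2, 3, 0, 37, 36],
    [35, 38, 1, 2, 4, 5, 11, 17, 25, 26, 33, 34, 27, 18, 7, 23, 31, 32, 28, 22, 30, 29, 21, 16,
      10, 9, 14, 12, 8, 13, 20, 24, 15, 6, 3, 0, 37, 36],
    [35, 38, 1, 2, 4, 5, 10, 9, 14, 21, 16, 17, 11, 18, 27, 34, 33, 26, 25, 29, 30, 22, 28, 19,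
      12, 8, 13, 6, 15, 24, 32, 31, 23, 7, 3, 0, 37, 36],
    [35, 38, 1, 0, 37, 6, 3, 2, 4, 5, 10, 16, 17, 11, 18, 7, 23, 15, 24, 32, 31, 27, 34, 33, 26,
      25, 29, 30, 22, 28, 19, 20, 13, 8, 12, 14, 9, 36],
    [35, 38, 1, 5, 11, 17, 25, 26, 33, 30, 29, 21, 16, 10, 9, 14, 12, 8, 13, 6, 15, 23, 31, 32,
      24, 20, 19, 28, 34, 27, 18, 7, 4, 2, 3, 0, 37, 36],
    [35, 38, 1, 2, 4, 7, 18, 26, 25, 29, 21, 16, 17, 11, 5, 10, 9, 14, 22, 30, 33, 34, 27, 31,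
      32, 28, 19, 12, 8, 13, 20, 24, 15, 6, 3, 0, 37, 36],
    [35, 38, 1, 2, 4, 5, 11, 17, 25, 26, 33, 34, 27, 18, 7, 3, 0, 37, 6, 15, 23, 31, 32, 28, 19,
      20, 13, 8, 12, 14, 22, 30, 29, 21, 16, 10, 9, 36],
    [35, 38, 1, 5, 11, 17, 16, 10, 9, 14, 21, 29, 30, 22, 28, 32, 24, 20, 19, 12, 8, 13, 6, 15,
      23, 31, 27, 34, 33, 26, 18, 7, 4, 2, 3, 0, 37, 36],
    [35, 38, 1, 0, 37, 6, 3, 2, 4, 5, 10, 16, 21, 29, 25, 17, 11, 18, 7, 23, 15, 24, 32, 31, 27,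
      34, 33, 30, 22, 28, 19, 20, 13, 8, 12, 14, 9, 36],
    [35, 38, 1, 5, 4, 2, 3, 0, 37, 6, 15, 24, 32, 31, 23, 7, 18, 11, 17, 25, 26, 33, 34, 28, 19,
      20, 13, 8, 12, 14, 22, 30, 29, 21, 16, 10, 9, 36],
    [37, 36, 9, 10, 16, 17, 11, 18, 26, 25, 29, 21, 14, 22, 30, 33, 34, 27, 31, 32, 24, 20, 19,
      12, 8, 13, 6, 15, 23, 7, 3, 0, 1, 2, 4, 5, 35, 38],
    [35, 38, 1, 2, 4, 7, 3, 0, 37, 6, 13, 8, 12, 19, 20, 24, 15, 23, 31, 32, 28, 22, 30, 33, 34,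
      27, 18, 26, 25, 17, 11, 5, 10, 16, 21, 14, 9, 36],
    [35, 38, 1, 0, 37, 6, 13, 8, 12, 19, 20, 24, 15, 23, 31, 32, 28, 22, 14, 21, 29, 25, 26, 33,
      34, 27, 18, 7, 3, 2, 4, 5, 11, 17, 16, 10, 9, 36],
    [35, 38, 1, 2, 4, 5, 10, 9, 14, 21, 16, 17, 11, 18, 27, 34, 33, 26, 25, 29, 30, 22, 28, 32,
      24, 20, 19, 12, 8, 13, 6, 15, 23, 7, 3, 0, 37, 36],
    [35, 38, 1, 2, 4, 5, 10, 9, 14, 21, 16, 17, 11, 18, 7, 23, 31, 27, 34, 33, 26, 25, 29, 30,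
      22, 28, 19, 12, 8, 13, 20, 24, 15, 6, 3, 0, 37, 36],
    [35, 38, 1, 2, 4, 7, 3, 0, 37, 6, 13, 8, 12, 19, 20, 24, 15, 23, 31, 32, 28, 34, 27, 18, 26,
      25, 17, 11, 5, 10, 16, 21, 29, 30, 22, 14, 9, 36],
    [35, 38, 1, 0, 37, 6, 13, 20, 19, 28, 22, 30, 33, 26, 18, 27, 31, 32, 24, 15, 23, 7, 3, 2,
      4, 5, 11, 17, 25, 29, 21, 16, 10, 9, 14, 12, 8, 36],
    [37, 36, 8, 12, 19, 28, 22, 30, 29, 25, 26, 33, 34, 27, 31, 32, 24, 20, 13, 6, 15, 23, 7,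
      18, 11, 17, 16, 21, 14, 9, 10, 5, 4, 2, 3, 0, 1, 38],
    [37, 0, 1, 2, 4, 7, 3, 6, 13, 8, 12, 19, 20, 24, 15, 23, 31, 32, 28, 22, 30, 29, 25, 26, 33,
      34, 27, 18, 11, 17, 16, 21, 14, 9, 10, 5, 35, 38],
    [35, 38, 1, 0, 3, 2, 4, 5, 10, 9, 14, 21, 16, 17, 11, 18, 7, 23, 15, 6, 13, 20, 24, 32, 31,
      27, 34, 33, 26, 25, 29, 30, 22, 28, 19, 12, 8, 36],
    [35, 5, 4, 2, 1, 0, 37, 6, 3, 7, 18, 11, 17, 25, 26, 33, 34, 27, 31, 23, 15, 24, 32, 28, 22,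
      30, 29, 21, 16, 10, 9, 14, 12, 19, 20, 13, 8, 36]]
  diag02 := [
    35, 38, 1, 0, 3, 2, 4, 5, 10, 9, 14, 21, 16, 17, 11, 18, 7, 23, 15, 6, 13, 20, 24, 32, 31,
    27, 34, 33, 26, 25, 29, 30, 22, 28, 19, 12, 8, 36, 37]
  diag13 := [
    36, 8, 13, 20, 19, 12, 14, 9, 10, 16, 21, 29, 30, 22, 28, 32, 24, 15, 23, 31, 27, 34, 33, 26,
    25, 17, 11, 18, 7, 3, 6, 37, 0, 1, 2, 4, 5, 35, 38]

set_option maxRecDepth 10000 in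
theorem base39_isValid : base39.IsValid where
  nodup := by decide +kernel
  ne_nil := by decide +kernel
  length_rot := by decide +kernel
  symm := by decide +kernel
  corner := by decide +kernel
  face_lt := by decide +kernel
  card_face := by decide +kernel
  euler := by decide +kernel
  quads_le := by decide +kernel
  coloring := by decide +kernel
  terminals := by decide +kernel
  pts_lt := by decide +kernel
  pts_nodup := by decide +kernel
  edges_apart := by decide +kernel
  detour := by decide +kernel
  diag02 := by decide +kernel
  diag13 := by decide +kernel

/-- A plane graph on 41 vertices whose faces are pentagons and nine quadrilaterals. -/
def base41 : PlaneData where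
  p := 37
  faces := 29
  quads := 9
  radius := 50
  rot := [
    [(3, 0, 2), (2, 1, 0), (39, 2, 1)],
    [(3, 2, 4), (39, 3, 2), (6, 4, 3)],
    [(0, 0, 1), (4, 5, 0), (40, 1, 5)],
    [(4, 0, 6), (0, 2, 0), (1, 4, 2), (7, 6, 4)],
    [(2, 0, 5), (3, 6, 0), (5, 5, 6)],
    [(40, 5, 7), (4, 6, 5), (7, 9, 6), (8, 7, 9)],
    [(7, 4, 10), (1, 3, 4), (9, 10, 3)],
    [(26, 11, 10), (21, 9, 11), (5, 6, 9), (3, 4, 6), (6, 10, 4)],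
    [(13, 12, 9), (12, 13, 12), (37, 7, 13), (5, 9, 7)],
    [(14, 14, 15), (17, 10, 14), (6, 3, 10), (39, 15, 3)],
    [(15, 16, 17), (14, 15, 16), (38, 17, 15)],
    [(38, 13, 17), (12, 18, 13), (16, 17, 18)],
    [(19, 18, 19), (11, 13, 18), (8, 12, 13), (18, 19, 12)],
    [(21, 20, 9), (20, 12, 20), (8, 9, 12)],
    [(22, 14, 16), (9, 15, 14), (10, 16, 15)],
    [(10, 17, 16), (16, 21, 17), (23, 16, 21)],
    [(11, 18, 17), (24, 21, 18), (15, 17, 21)],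
    [(26, 10, 22), (9, 14, 10), (25, 22, 14)],
    [(20, 23, 12), (27, 19, 23), (12, 12, 19)],
    [(24, 18, 24), (12, 19, 18), (28, 24, 19)],
    [(18, 12, 23), (13, 20, 12), (29, 23, 20)],
    [(30, 20, 11), (13, 9, 20), (7, 11, 9)],
    [(25, 14, 25), (14, 16, 14), (23, 25, 16)],
    [(15, 21, 16), (31, 25, 21), (22, 16, 25)],
    [(19, 24, 18), (31, 21, 24), (16, 18, 21)],
    [(22, 25, 14), (32, 22, 25), (17, 14, 22)],
    [(17, 22, 10), (33, 11, 22), (7, 10, 11)],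
    [(18, 23, 19), (34, 26, 23), (28, 19, 26)],
    [(35, 24, 26), (19, 19, 24), (27, 26, 19)],
    [(34, 23, 27), (20, 20, 23), (30, 27, 20)],
    [(33, 27, 11), (29, 20, 27), (21, 11, 20)],
    [(23, 21, 25), (24, 24, 21), (35, 28, 24), (32, 25, 28)],
    [(33, 22, 28), (25, 25, 22), (31, 28, 25)],
    [(30, 11, 27), (26, 22, 11), (32, 28, 22), (36, 27, 28)],
    [(27, 23, 26), (29, 27, 23), (36, 26, 27)],
    [(28, 26, 24), (36, 28, 26), (31, 24, 28)],
    [(33, 28, 27), (35, 26, 28), (34, 27, 26)],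
    [(38, 8, 13), (40, 7, 8), (8, 13, 7)],
    [(11, 17, 13), (10, 15, 17), (39, 8, 15), (37, 13, 8)],
    [(9, 3, 15), (1, 2, 3), (0, 1, 2), (40, 8, 1), (38, 15, 8)],
    [(39, 1, 8), (2, 5, 1), (5, 7, 5), (37, 8, 7)]]
  clusters := [[0], [1], [2], [5], [0, 2], [0, 5], [1, 5], [0, 2, 5], [1, 2, 5]]
  pts := [
    (-16, -41), (-28, -36), (13, -41), (-12, -32), (6, -32), (15, -22), (-23, -26), (-8, -20),
    (14, 12), (-32, -22), (-37, 23), (-29, 28), (-10, 15), (1, 3), (-32, 1), (-30, 17),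
    (-26, 19), (-24, -12), (-9, 9), (-15, 12), (-6, 5), (-6, -6), (-27, 2), (-26, 9), (-21, 13),
    (-24, -3), (-16, -12), (-12, 7), (-14, 8), (-9, 2), (-10, -2), (-21, 7), (-20, 0), (-15, -3),
    (-12, 4), (-17, 6), (-14, 2)]
  detours := [
    [37, 40, 2, 4, 3, 1, 6, 7, 5, 8, 12, 11, 16, 24, 19, 28, 27, 18, 20, 13, 21, 30, 29, 34, 36,
      35, 31, 32, 33, 26, 17, 25, 22, 23, 15, 10, 14, 9, 39, 38],
    [37, 8, 12, 11, 16, 24, 19, 28, 27, 18, 20, 13, 21, 30, 29, 34, 36, 35, 31, 32, 33, 26, 17,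
      25, 22, 23, 15, 10, 14, 9, 6, 7, 3, 4, 5, 40, 2, 0, 39, 38],
    [37, 40, 5, 4, 3, 0, 39, 1, 6, 7, 21, 30, 29, 34, 36, 35, 31, 23, 22, 25, 32, 33, 26, 17, 9,
      14, 10, 15, 16, 24, 19, 28, 27, 18, 20, 13, 8, 12, 11, 38],
    [37, 40, 5, 4, 2, 0, 39, 1, 6, 7, 21, 30, 29, 34, 36, 35, 31, 23, 22, 25, 32, 33, 26, 17, 9,
      14, 10, 15, 16, 24, 19, 28, 27, 18, 20, 13, 8, 12, 11, 38],
    [37, 40, 2, 0, 3, 1, 6, 7, 5, 8, 12, 11, 16, 24, 19, 28, 27, 18, 20, 13, 21, 30, 29, 34, 36,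
      35, 31, 32, 33, 26, 17, 25, 22, 23, 15, 10, 14, 9, 39, 38],
    [37, 40, 2, 4, 3, 0, 39, 1, 6, 7, 21, 30, 29, 34, 36, 35, 31, 23, 22, 25, 32, 33, 26, 17, 9,
      14, 10, 15, 16, 24, 19, 28, 27, 18, 20, 13, 8, 12, 11, 38],
    [37, 40, 2, 0, 39, 1, 3, 4, 5, 7, 21, 30, 29, 34, 36, 35, 31, 23, 22, 25, 32, 33, 26, 17, 9,
      14, 10, 15, 16, 24, 19, 28, 27, 18, 20, 13, 8, 12, 11, 38],
    [37, 40, 2, 4, 5, 8, 12, 11, 16, 24, 19, 28, 27, 18, 20, 13, 21, 30, 29, 34, 36, 35, 31, 32,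
      33, 26, 17, 25, 22, 23, 15, 10, 14, 9, 6, 1, 3, 0, 39, 38],
    [37, 40, 5, 4, 2, 0, 39, 9, 6, 1, 3, 7, 26, 17, 25, 32, 33, 36, 35, 31, 24, 19, 28, 27, 34,
      29, 30, 21, 13, 20, 18, 12, 11, 16, 15, 23, 22, 14, 10, 38],
    [37, 8, 5, 40, 2, 4, 3, 0, 39, 1, 6, 7, 26, 17, 25, 32, 33, 36, 35, 28, 27, 34, 29, 30, 21,
      13, 20, 18, 12, 19, 24, 31, 23, 22, 14, 10, 15, 16, 11, 38],
    [37, 40, 2, 0, 3, 4, 5, 8, 12, 19, 24, 31, 32, 25, 17, 26, 33, 30, 29, 34, 36, 35, 28, 27,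
      18, 20, 13, 21, 7, 6, 1, 39, 9, 14, 22, 23, 15, 16, 11, 38],
    [37, 40, 2, 0, 39, 1, 6, 9, 14, 22, 23, 31, 32, 25, 17, 26, 33, 30, 29, 20, 13, 21, 7, 3, 4,
      5, 8, 12, 18, 27, 34, 36, 35, 28, 19, 24, 16, 15, 10, 38],
    [37, 40, 2, 0, 39, 1, 6, 7, 3, 4, 5, 8, 13, 21, 30, 29, 20, 18, 27, 34, 36, 35, 28, 19, 24,
      31, 23, 22, 25, 32, 33, 26, 17, 9, 14, 10, 15, 16, 11, 38],
    [37, 40, 2, 0, 3, 4, 5, 8, 12, 18, 20, 29, 30, 21, 7, 6, 1, 39, 9, 14, 10, 15, 23, 22, 25,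
      17, 26, 33, 32, 31, 35, 36, 34, 27, 28, 19, 24, 16, 11, 38],
    [37, 40, 5, 4, 2, 0, 39, 1, 3, 7, 6, 9, 17, 26, 33, 32, 25, 22, 23, 31, 24, 19, 28, 35, 36,
      34, 27, 18, 20, 29, 30, 21, 13, 8, 12, 11, 16, 15, 10, 38],
    [37, 40, 2, 0, 39, 1, 6, 7, 3, 4, 5, 8, 12, 11, 16, 24, 19, 28, 27, 18, 20, 13, 21, 30, 29,
      34, 36, 35, 31, 23, 22, 25, 32, 33, 26, 17, 9, 14, 10, 38],
    [37, 40, 2, 0, 3, 4, 5, 8, 13, 20, 18, 27, 28, 35, 36, 34, 29, 30, 21, 7, 6, 1, 39, 9, 14,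
      10, 15, 23, 22, 25, 17, 26, 33, 32, 31, 24, 19, 12, 11, 38],
    [37, 40, 2, 0, 39, 1, 6, 9, 14, 22, 25, 32, 33, 26, 7, 3, 4, 5, 8, 12, 11, 16, 24, 19, 28,
      27, 18, 20, 13, 21, 30, 29, 34, 36, 35, 31, 23, 15, 10, 38],
    [37, 40, 5, 7, 21, 30, 29, 20, 13, 8, 12, 11, 16, 24, 19, 28, 27, 34, 36, 35, 31, 32, 33,
      26, 17, 25, 22, 23, 15, 10, 14, 9, 6, 1, 3, 4, 2, 0, 39, 38],
    [37, 40, 5, 7, 21, 30, 29, 34, 36, 35, 28, 27, 18, 20, 13, 8, 12, 11, 16, 24, 31, 32, 33,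
      26, 17, 25, 22, 23, 15, 10, 14, 9, 6, 1, 3, 4, 2, 0, 39, 38],
    [37, 40, 2, 0, 39, 9, 6, 1, 3, 4, 5, 8, 13, 21, 7, 26, 17, 25, 32, 33, 30, 29, 34, 36, 35,
      31, 23, 22, 14, 10, 15, 16, 24, 19, 28, 27, 18, 12, 11, 38],
    [37, 40, 5, 8, 13, 20, 18, 12, 11, 16, 24, 19, 28, 27, 34, 29, 30, 33, 36, 35, 31, 32, 25,
      22, 23, 15, 10, 14, 9, 17, 26, 7, 6, 1, 3, 4, 2, 0, 39, 38],
    [37, 40, 5, 8, 12, 11, 16, 24, 19, 28, 27, 18, 20, 13, 21, 30, 29, 34, 36, 35, 31, 23, 15,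
      10, 14, 9, 17, 25, 32, 33, 26, 7, 6, 1, 3, 4, 2, 0, 39, 38],
    [37, 40, 5, 8, 13, 20, 18, 27, 28, 35, 36, 34, 29, 30, 21, 7, 26, 33, 32, 31, 24, 19, 12,
      11, 16, 15, 10, 14, 22, 25, 17, 9, 6, 1, 3, 4, 2, 0, 39, 38],
    [37, 40, 5, 8, 13, 20, 18, 27, 34, 29, 30, 21, 7, 26, 17, 25, 22, 23, 31, 32, 33, 36, 35,
      28, 19, 12, 11, 16, 15, 10, 14, 9, 6, 1, 3, 4, 2, 0, 39, 38],
    [37, 40, 2, 0, 39, 1, 6, 7, 3, 4, 5, 8, 12, 11, 16, 24, 19, 28, 27, 18, 20, 13, 21, 30, 29,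
      34, 36, 35, 31, 32, 33, 26, 17, 9, 14, 22, 23, 15, 10, 38],
    [37, 40, 5, 7, 21, 30, 29, 34, 27, 18, 20, 13, 8, 12, 11, 16, 24, 19, 28, 35, 36, 33, 32,
      31, 23, 15, 10, 14, 22, 25, 17, 9, 6, 1, 3, 4, 2, 0, 39, 38],
    [37, 40, 2, 0, 3, 4, 5, 8, 13, 20, 18, 12, 19, 28, 35, 36, 34, 29, 30, 21, 7, 6, 1, 39, 9,
      14, 10, 15, 23, 22, 25, 17, 26, 33, 32, 31, 24, 16, 11, 38],
    [37, 40, 2, 0, 3, 4, 5, 8, 13, 20, 29, 30, 21, 7, 6, 1, 39, 9, 14, 10, 15, 23, 22, 25, 17,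
      26, 33, 32, 31, 35, 36, 34, 27, 18, 12, 19, 24, 16, 11, 38],
    [37, 40, 5, 8, 13, 20, 18, 12, 11, 16, 24, 19, 28, 27, 34, 36, 35, 31, 32, 33, 30, 21, 7,
      26, 17, 25, 22, 23, 15, 10, 14, 9, 6, 1, 3, 4, 2, 0, 39, 38],
    [37, 40, 2, 0, 39, 9, 6, 1, 3, 4, 5, 8, 13, 21, 7, 26, 17, 25, 32, 33, 36, 35, 31, 23, 22,
      14, 10, 15, 16, 24, 19, 28, 27, 34, 29, 20, 18, 12, 11, 38],
    [37, 8, 5, 40, 2, 4, 3, 0, 39, 1, 6, 7, 26, 17, 9, 14, 10, 15, 23, 22, 25, 32, 33, 36, 35,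
      28, 27, 34, 29, 30, 21, 13, 20, 18, 12, 19, 24, 16, 11, 38],
    [37, 40, 5, 7, 26, 33, 30, 21, 13, 8, 12, 11, 16, 24, 19, 28, 27, 18, 20, 29, 34, 36, 35,
      31, 23, 15, 10, 14, 22, 25, 17, 9, 6, 1, 3, 4, 2, 0, 39, 38],
    [37, 40, 5, 8, 13, 21, 30, 29, 20, 18, 12, 11, 16, 24, 19, 28, 27, 34, 36, 35, 31, 32, 25,
      22, 23, 15, 10, 14, 9, 17, 26, 7, 6, 1, 3, 4, 2, 0, 39, 38],
    [37, 40, 2, 0, 39, 9, 6, 1, 3, 4, 5, 8, 13, 20, 29, 30, 21, 7, 26, 17, 25, 32, 33, 36, 35,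
      31, 23, 22, 14, 10, 15, 16, 24, 19, 28, 27, 18, 12, 11, 38],
    [37, 40, 5, 8, 13, 20, 18, 27, 28, 19, 12, 11, 16, 24, 31, 32, 33, 36, 34, 29, 30, 21, 7,
      26, 17, 25, 22, 23, 15, 10, 14, 9, 6, 1, 3, 4, 2, 0, 39, 38],
    [37, 40, 5, 8, 13, 20, 29, 34, 27, 18, 12, 11, 16, 24, 19, 28, 35, 31, 32, 33, 30, 21, 7,
      26, 17, 25, 22, 23, 15, 10, 14, 9, 6, 1, 3, 4, 2, 0, 39, 38],
    [39, 1, 6, 9, 14, 10, 38, 11, 12, 8, 13, 20, 18, 27, 28, 19, 24, 16, 15, 23, 22, 25, 17, 26,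
      33, 32, 31, 35, 36, 34, 29, 30, 21, 7, 5, 4, 3, 0, 2, 40],
    [39, 1, 3, 0, 2, 4, 5, 7, 6, 9, 14, 10, 15, 23, 22, 25, 17, 26, 33, 32, 31, 35, 36, 34, 29,
      30, 21, 13, 20, 18, 27, 28, 19, 24, 16, 11, 12, 8, 37, 40],
    [37, 40, 5, 4, 2, 0, 3, 1, 6, 7, 21, 30, 29, 34, 36, 35, 31, 23, 22, 25, 32, 33, 26, 17, 9,
      14, 10, 15, 16, 24, 19, 28, 27, 18, 20, 13, 8, 12, 11, 38],
    [37, 8, 12, 11, 16, 24, 19, 28, 27, 18, 20, 13, 21, 30, 29, 34, 36, 35, 31, 32, 33, 26, 17,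
      25, 22, 23, 15, 10, 14, 9, 6, 7, 5, 4, 2, 0, 3, 1, 39, 38]]
  diag02 := [
    37, 8, 12, 11, 38, 10, 14, 9, 17, 26, 33, 30, 29, 34, 36, 35, 31, 32, 25, 22, 23, 15, 16, 24,
    19, 28, 27, 18, 20, 13, 21, 7, 6, 1, 3, 4, 5, 40, 2, 0, 39]
  diag13 := [
    38, 39, 1, 3, 0, 2, 4, 5, 7, 6, 9, 14, 10, 15, 23, 22, 25, 17, 26, 33, 32, 31, 35, 36, 34,
    29, 30, 21, 13, 20, 18, 27, 28, 19, 24, 16, 11, 12, 8, 37, 40]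

set_option maxRecDepth 10000 in
theorem base41_isValid : base41.IsValid where
  nodup := by decide +kernel
  ne_nil := by decide +kernel
  length_rot := by decide +kernel
  symm := by decide +kernel
  corner := by decide +kernel
  face_lt := by decide +kernel
  card_face := by decide +kernel
  euler := by decide +kernel
  quads_le := by decide +kernel
  coloring := by decide +kernel
  terminals := by decide +kernel
  pts_lt := by decide +kernel
  pts_nodup := by decide +kernel
  edges_apart := by decide +kernel
  detour := by decide +kernel
  diag02 := by decide +kernel
  diag13 := by decide +kernel

theorem theorem3p4 (n : ℕ) (hn : 40 ≤ n) :
    ∃ G : SimpleGraph (Fin n), IsPlanar G ∧ IsHypohamiltonian G := by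
  have key : ∀ {D : PlaneData} (m : ℕ), D.IsValid → D.p + 4 = m → m ≤ n → n % 4 = m % 4 →
      ∃ G : SimpleGraph (Fin n), IsPlanar G ∧ IsHypohamiltonian G := by
    rintro D m h rfl hmn hmod
    obtain ⟨k, rfl⟩ : ∃ k, n = D.p + 4 * (k + 1) := ⟨(n - D.p) / 4 - 1, by omega⟩
    exact PlaneData.exists_isPlanar_isHypohamiltonian h k
  have : n % 4 < 4 := Nat.mod_lt _ (by norm_num)
  interval_cases hr : n % 4
  · exact key 36 base36_isValid rfl (by omega) (by omega)
  · exact key 41 base41_isValid rfl (by omega) (by omega)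
  · exact key 38 base38_isValid rfl (by omega) (by omega)
  · exact key 39 base39_isValid rfl (by omega) (by omega)
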